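/- Let $n\ge 2$, let $k>1$ be an odd integer and let $q=e^{2\pi i r/k}$ with an integer $r$ coprime to $k$ (so $q$ is a primitive $k$-th root of unity). Put $q^x:=e^{2\pi i r x/k}$ for $x\in\mathbb C$ and $[x]:=(q^x-q^{-x})/(q-q^{-1})$. Let $U'_q(\mathrm{so}_n)$ be the complex unital associative algebra with generators $I_{21},I_{32},\dots,I_{n,n-1}$ and relations $$I_{i,i-1}^2I_{i+1,i}-(q+q^{-1})I_{i,i-1}I_{i+1,i}I_{i,i-1}+I_{i+1,i}I_{i,i-1}^2=-I_{i+1,i},$$ $$I_{i,i-1}I_{i+1,i}^2-(q+q^{-1})I_{i+1,i}I_{i,i-1}I_{i+1,i}+I_{i+1,i}^2I_{i,i-1}=-I_{i,i-1},$$ and $I_{i,i-1}I_{j,j-1}=I_{j,j-1}I_{i,i-1}$ for $|i-j|>1$. Let $\omega$ consist of complex numbers $m_{i,n}$ ($1\le i\le\lfloor n/2\rfloor$) and $c_{ij}\neq0$, $h_{ij}$ ($2\le j\le n-1$, $1\le i\le\lfloor j/2\rfloor$) such that none of the numbers $$m_{in},\quad h_{ij},\quad h_{ij}-h_{sj}\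 (i\ne s),\quad h_{ij}+h_{sj}\ (i=s\text{ allowed}),\quad h_{ij}\pm h_{s,j+1}\ (j+1\le n-1),\quad h_{i,n-1}\pm m_{sn}$$ belongs to $\frac1{2r}\mathbb Z$ (which is $\frac12\mathbb Z$ for $q=e^{\pm 2\pi i/k}$, $r=\pm1$). Let $V$ be the complex vector space with basis vectors $|\xi\rangle$ labelled by the tableaux $\xi=(m_{i,s})_{2\le s\le n,\,1\le i\le\lfloor s/2\rfloor}$ in which the row $s=n$ is the given one and, for $s\le n-1$, each $m_{i,s}$ runs independently through $h_{i,s},h_{i,s}+1,\dots,h_{i,s}+k-1$. Put $l_{j,2p+1}=m_{j,2p+1}+p-j+1$, $l_{j,2p}=m_{j,2p}+p-j$. Let $\xi^{\pm j}_s$ be $\xi$ with $m_{j,s}$ replaced by $m_{j,s}\pm1$, where $h_{j,s}+k$ is read as $h_{j,s}$ and $h_{j,s}-1$ as $h_{j,s}+k-1$. Consider the operators $$T_\omega(I_{2p+1,2p})|\xi\rangle=\sum_{j=1}^p c_{j,2p}\frac{A^j_{2p}(\xi)}{q^{l_{j,2p}}+q^{-l_{j,2p}}}|\xi^{+j}_{2p}\rangle-\sum_{j=1}^p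 c_{j,2p}^{-1}\frac{A^j_{2p}(\xi^{-j}_{2p})}{q^{l_{j,2p}}+q^{-l_{j,2p}}}|\xi^{-j}_{2p}\rangle,$$ $$T_\omega(I_{2p,2p-1})|\xi\rangle=\sum_{j=1}^{p-1} c_{j,2p-1}\frac{B^j_{2p-1}(\xi)}{[2l_{j,2p-1}-1][l_{j,2p-1}]}|\xi^{+j}_{2p-1}\rangle-\sum_{j=1}^{p-1} c_{j,2p-1}^{-1}\frac{B^j_{2p-1}(\xi^{-j}_{2p-1})}{[2l_{j,2p-1}-1][l_{j,2p-1}-1]}|\xi^{-j}_{2p-1}\rangle+i\,C_{2p-1}(\xi)|\xi\rangle,$$ where $$A^j_{2p}(\xi)^2=\frac{\prod_{i=1}^p[l_{i,2p+1}+l_{j,2p}][l_{i,2p+1}-l_{j,2p}-1]\ \prod_{i=1}^{p-1}[l_{i,2p-1}+l_{j,2p}][l_{i,2p-1}-l_{j,2p}-1]}{\prod_{i\ne j}[l_{i,2p}+l_{j,2p}][l_{i,2p}-l_{j,2p}][l_{i,2p}+l_{j,2p}+1][l_{i,2p}-l_{j,2p}-1]},$$ $$B^j_{2p-1}(\xi)^2=\frac{\prod_{i=1}^p[l_{i,2p}+l_{j,2p-1}][l_{i,2p}-l_{j,2p-1}]\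 \prod_{i=1}^{p-1}[l_{i,2p-2}+l_{j,2p-1}][l_{i,2p-2}-l_{j,2p-1}]}{\prod_{i\ne j}[l_{i,2p-1}+l_{j,2p-1}][l_{i,2p-1}-l_{j,2p-1}][l_{i,2p-1}+l_{j,2p-1}-1][l_{i,2p-1}-l_{j,2p-1}-1]},$$ $$C_{2p-1}(\xi)=\frac{\prod_{s=1}^p[l_{s,2p}]\ \prod_{s=1}^{p-1}[l_{s,2p-2}]}{\prod_{s=1}^{p-1}[l_{s,2p-1}][l_{s,2p-1}-1]}.$$ Then: 1. $\dim V=k^N$, where $N$ is the number of positive roots of $\mathrm{so}_n$, and the square roots $A^j_{2p}(\xi)$, $B^j_{2p-1}(\xi)$ can be chosen so that these operators define a representation $T_\omega$ of $U'_q(\mathrm{so}_n)$ on $V$. 2. For every choice of the square roots for which the operators define a representation, this representation $T_\omega$ is irreducible. 3. Suppose moreover that none of the numbers $m_{in}-m_{sn}$ ($i\neq s$) and $m_{in}+m_{sn}$ ($i=s$ allowed) belongs to $\frac1{2r}\mathbb Z$. Let $\omega'$ be obtained from $\omega$ by replacing the top row $(m_{in})_i$ by a different row $(m'_{in})_i$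 such that all $l_{i,n}-l'_{i,n}$ are integers of absolute value less than $k$. Then $T_\omega$ and $T_{\omega'}$ (for any choices of the square roots that define representations) are not equivalent. -/

import Mathlib

namespace UqSo

/-! ### The algebra `U'_q(so_n)` -/

/-- The defining relations of `U'_q(so_n)`. The generator with index `i : Fin (n - 1)` is
`I_{i+2,i+1}`, so that `I_{21}, I_{32}, …, I_{n,n-1}` have the indices `0, 1, …, n - 2`. -/
inductive Rel (q : ℂ) (n : ℕ) :
    FreeAlgebra ℂ (Fin (n - 1)) → FreeAlgebra ℂ (Fin (n - 1)) → Prop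
  | serre_left (i j : Fin (n - 1)) (h : (j : ℕ) = i + 1) :
      Rel q n
        (FreeAlgebra.ι ℂ i ^ 2 * FreeAlgebra.ι ℂ j
          - (q + q⁻¹) • (FreeAlgebra.ι ℂ i * FreeAlgebra.ι ℂ j * FreeAlgebra.ι ℂ i)
          + FreeAlgebra.ι ℂ j * FreeAlgebra.ι ℂ i ^ 2)
        (-FreeAlgebra.ι ℂ j)
  | serre_right (i j : Fin (n - 1)) (h : (j : ℕ) = i + 1) :
      Rel q n
        (FreeAlgebra.ι ℂ i * FreeAlgebra.ι ℂ j ^ 2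
          - (q + q⁻¹) • (FreeAlgebra.ι ℂ j * FreeAlgebra.ι ℂ i * FreeAlgebra.ι ℂ j)
          + FreeAlgebra.ι ℂ j ^ 2 * FreeAlgebra.ι ℂ i)
        (-FreeAlgebra.ι ℂ i)
  | comm (i j : Fin (n - 1)) (h : (i : ℕ) + 1 < j) :
      Rel q n
        (FreeAlgebra.ι ℂ i * FreeAlgebra.ι ℂ j)
        (FreeAlgebra.ι ℂ j * FreeAlgebra.ι ℂ i)

/-- The complex unital associative algebra `U'_q(so_n)`, by generators and relations. -/
abbrev Alg (q : ℂ) (n : ℕ) : Type := RingQuot (Rel q n)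

/-- The generator `I_{i+2,i+1}` of `U'_q(so_n)`. -/
noncomputable def gen (q : ℂ) (n : ℕ) (i : Fin (n - 1)) : Alg q n :=
  RingQuot.mkAlgHom ℂ (Rel q n) (FreeAlgebra.ι ℂ i)

/-! ### Representations of an algebra -/

/-- An irreducible representation: the space is nonzero, and the only invariant subspaces are
zero and the whole space. -/
def IsIrreducibleRep {A V : Type*} [Ring A] [Algebra ℂ A] [AddCommGroup V] [Module ℂ V]
    (T : A →ₐ[ℂ] Module.End ℂ V) : Prop :=
  Nontrivial V ∧ ∀ W : Submodule ℂ V, (∀ a : A, ∀ v ∈ W, T a v ∈ W) → W = ⊥ ∨ W = ⊤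

/-- Equivalence of two representations on spaces `V` and `V'`. -/
def AreEquivalent {A V V' : Type*} [Ring A] [Algebra ℂ A] [AddCommGroup V] [Module ℂ V]
    [AddCommGroup V'] [Module ℂ V']
    (T : A →ₐ[ℂ] Module.End ℂ V) (T' : A →ₐ[ℂ] Module.End ℂ V') : Prop :=
  ∃ f : V ≃ₗ[ℂ] V', ∀ (a : A) (v : V), f (T a v) = T' a (f v)

/-! ### Complex powers of `q` and `q`-numbers -/

/-- The power `q ^ x = exp (2 π i r x / k)` of `q = exp (2 π i r / k)`. -/
noncomputable def qpow (k : ℕ) (r : ℤ) (x : ℂ) : ℂ :=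
  Complex.exp (2 * Real.pi * Complex.I * r * x / k)

/-- The root of unity `q = exp (2 π i r / k)`. -/
noncomputable def qroot (k : ℕ) (r : ℤ) : ℂ := qpow k r 1

/-- The `q`-number `[x] = (q ^ x - q ^ (-x)) / (q - q⁻¹)`. -/
noncomputable def qnum (k : ℕ) (r : ℤ) (x : ℂ) : ℂ :=
  (qpow k r x - qpow k r (-x)) / (qroot k r - (qroot k r)⁻¹)

/-! ### Parameters and tableaux -/

/-- The parameters `ω`. Row `s` of a tableau has `s / 2` entries, so the rows `0` and `1` are
empty. The number `h_{i,s}` of the usual numbering (`i = 1, …, s / 2`) is `h s (i - 1)`, and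
likewise for `c` and `m`. -/
structure Params (n : ℕ) where
  /-- the top row `m_{i,n}` -/
  m : Fin (n / 2) → ℂ
  /-- the numbers `h_{i,s}`, `2 ≤ s ≤ n - 1` -/
  h : (s : Fin n) → Fin ((s : ℕ) / 2) → ℂ
  /-- the numbers `c_{i,s}`, `2 ≤ s ≤ n - 1` -/
  c : (s : Fin n) → Fin ((s : ℕ) / 2) → ℂ

/-- `x` does not belong to `(1 / (2 r)) ℤ`; for `r = 1` and `r = -1` this says that `x` does not
belong to `(1 / 2) ℤ`. -/
def OffLattice (r : ℤ) (x : ℂ) : Prop := ∀ t : ℤ, 2 * (r : ℂ) * x ≠ (t : ℂ)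

/-- The condition on the parameters `ω`. In the sums of two numbers of the same row the two
indices may be equal, so that `2 h_{i,s}` is excluded from the lattice, too. -/
structure Params.IsGeneric {n : ℕ} (r : ℤ) (ω : Params n) : Prop where
  c_ne_zero : ∀ s i, ω.c s i ≠ 0
  top : ∀ i, OffLattice r (ω.m i)
  row : ∀ s i, OffLattice r (ω.h s i)
  row_sub : ∀ s i j, i ≠ j → OffLattice r (ω.h s i - ω.h s j)
  row_add : ∀ s i j, OffLattice r (ω.h s i + ω.h s j)
  next_sub : ∀ s t : Fin n, (t : ℕ) = s + 1 → ∀ i j, OffLattice r (ω.h s i - ω.h t j)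
  next_add : ∀ s t : Fin n, (t : ℕ) = s + 1 → ∀ i j, OffLattice r (ω.h s i + ω.h t j)
  top_sub : ∀ s : Fin n, (s : ℕ) + 1 = n → ∀ i j, OffLattice r (ω.h s i - ω.m j)
  top_add : ∀ s : Fin n, (s : ℕ) + 1 = n → ∀ i j, OffLattice r (ω.h s i + ω.m j)

/-- The conditions inside a row, imposed on the top row. -/
structure Params.IsTopGeneric {n : ℕ} (r : ℤ) (ω : Params n) : Prop where
  sub : ∀ i j, i ≠ j → OffLattice r (ω.m i - ω.m j)
  add : ∀ i j, OffLattice r (ω.m i + ω.m j)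

/-- The tableaux: the entry `m_{i,s}`, `2 ≤ s ≤ n - 1`, is `h_{i,s} + a` with `0 ≤ a < k`, and
`a` is recorded as an element of `ZMod k`. The top row is fixed. -/
abbrev Tableau (n k : ℕ) : Type := (s : Fin n) → Fin ((s : ℕ) / 2) → ZMod k

/-- The tableau with the entry `m_{j,s}` replaced by `m_{j,s} + d`, cyclically modulo `k`. -/
def Tableau.shift {n k : ℕ} (ξ : Tableau n k) (s : Fin n) (j : Fin ((s : ℕ) / 2)) (d : ZMod k) :
    Tableau n k :=
  Function.update ξ s (Function.update (ξ s) j (ξ s j + d))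

/-- The representation space, with a basis labelled by the tableaux. -/
abbrev Space (n k : ℕ) : Type := Tableau n k →₀ ℂ

/-- The basis vector labelled by the tableau `ξ`. -/
noncomputable def ket {n k : ℕ} (ξ : Tableau n k) : Space n k := Finsupp.single ξ 1

/-- The number of positive roots of `so_n`: `p (p - 1)` for `n = 2 p` and `p ^ 2` for
`n = 2 p + 1`. -/
def numPosRoots (n : ℕ) : ℕ := (n / 2) * ((n - 1) / 2)

/-- The passage from an entry `m_{j,s}` to the `l`-coordinate:
`l_{j,2p+1} = m_{j,2p+1} + p - j + 1` and `l_{j,2p} = m_{j,2p} + p - j`, where `j = i + 1`. -/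
noncomputable def lOf (s : ℕ) (i : Fin (s / 2)) (x : ℂ) : ℂ :=
  x + (((s + 1) / 2 : ℕ) : ℂ) - ((i : ℕ) + 1)

section Operators

variable {n : ℕ} (k : ℕ) (r : ℤ) (ω : Params n)

/-- The entry `m_{j,s}` of a tableau, `s ≤ n` (the value for `s > n` is irrelevant). -/
noncomputable def entry (ξ : Tableau n k) (s : ℕ) (j : Fin (s / 2)) : ℂ :=
  if hs : s < n then ω.h ⟨s, hs⟩ j + ((ξ ⟨s, hs⟩ j).val : ℂ)
  else if hn : s = n then ω.m (Fin.cast (by rw [hn]) j)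
  else 0

/-- The `l`-coordinate `l_{j,s}` of a tableau. -/
noncomputable def lc (ξ : Tableau n k) (s : ℕ) (j : Fin (s / 2)) : ℂ :=
  lOf s j (entry k ω ξ s j)

/-- The expression under the square root in `A^j_s(ξ)`, for `s = 2p`. -/
noncomputable def radA (s : Fin n) (j : Fin ((s : ℕ) / 2)) (ξ : Tableau n k) : ℂ :=
  ((∏ i : Fin (((s : ℕ) + 1) / 2),
      qnum k r (lc k ω ξ (s + 1) i + lc k ω ξ s j)
        * qnum k r (lc k ω ξ (s + 1) i - lc k ω ξ s j - 1))
    * ∏ i : Fin (((s : ℕ) - 1) / 2),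
      qnum k r (lc k ω ξ (s - 1) i + lc k ω ξ s j)
        * qnum k r (lc k ω ξ (s - 1) i - lc k ω ξ s j - 1))
  / ∏ i ∈ Finset.univ.erase j,
      qnum k r (lc k ω ξ s i + lc k ω ξ s j)
        * qnum k r (lc k ω ξ s i - lc k ω ξ s j)
        * qnum k r (lc k ω ξ s i + lc k ω ξ s j + 1)
        * qnum k r (lc k ω ξ s i - lc k ω ξ s j - 1)

/-- The expression under the square root in `B^j_s(ξ)`, for `s = 2p - 1`. -/
noncomputable def radB (s : Fin n) (j : Fin ((s : ℕ) / 2)) (ξ : Tableau n k) : ℂ :=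
  ((∏ i : Fin (((s : ℕ) + 1) / 2),
      qnum k r (lc k ω ξ (s + 1) i + lc k ω ξ s j)
        * qnum k r (lc k ω ξ (s + 1) i - lc k ω ξ s j))
    * ∏ i : Fin (((s : ℕ) - 1) / 2),
      qnum k r (lc k ω ξ (s - 1) i + lc k ω ξ s j)
        * qnum k r (lc k ω ξ (s - 1) i - lc k ω ξ s j))
  / ∏ i ∈ Finset.univ.erase j,
      qnum k r (lc k ω ξ s i + lc k ω ξ s j)
        * qnum k r (lc k ω ξ s i - lc k ω ξ s j)
        * qnum k r (lc k ω ξ s i + lc k ω ξ s j - 1)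
        * qnum k r (lc k ω ξ s i - lc k ω ξ s j - 1)

/-- The coefficient `C_s(ξ)`, for `s = 2p - 1`. -/
noncomputable def coefC (s : Fin n) (ξ : Tableau n k) : ℂ :=
  ((∏ i : Fin (((s : ℕ) + 1) / 2), qnum k r (lc k ω ξ (s + 1) i))
    * ∏ i : Fin (((s : ℕ) - 1) / 2), qnum k r (lc k ω ξ (s - 1) i))
  / ∏ i : Fin ((s : ℕ) / 2), qnum k r (lc k ω ξ s i) * qnum k r (lc k ω ξ s i - 1)

/-- A choice of the square roots: `R s j ξ` is `A^j_s(ξ)` for even `s`, `B^j_s(ξ)` for odd `s`. -/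
abbrev Roots (n k : ℕ) : Type := (s : Fin n) → Fin ((s : ℕ) / 2) → Tableau n k → ℂ

/-- `R` is a choice of the square roots that define `A^j_{2p}(ξ)` and `B^j_{2p-1}(ξ)`. -/
def IsRootChoice (R : Roots n k) : Prop :=
  ∀ (s : Fin n) (j : Fin ((s : ℕ) / 2)) (ξ : Tableau n k),
    R s j ξ ^ 2 = if Even (s : ℕ) then radA k r ω s j ξ else radB k r ω s j ξ

/-- The action of `I_{2p+1,2p}` on basis vectors, `s = 2p`. -/
noncomputable def actEven (R : Roots n k) (s : Fin n) (ξ : Tableau n k) : Space n k :=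
  (∑ j, (ω.c s j * (R s j ξ / (qpow k r (lc k ω ξ s j) + qpow k r (-lc k ω ξ s j))))
      • ket (ξ.shift s j 1))
  - ∑ j, ((ω.c s j)⁻¹
        * (R s j (ξ.shift s j (-1)) / (qpow k r (lc k ω ξ s j) + qpow k r (-lc k ω ξ s j))))
      • ket (ξ.shift s j (-1))

/-- The action of `I_{2p,2p-1}` on basis vectors, `s = 2p - 1`. -/
noncomputable def actOdd (R : Roots n k) (s : Fin n) (ξ : Tableau n k) : Space n k :=
  (∑ j, (ω.c s j
        * (R s j ξ / (qnum k r (2 * lc k ω ξ s j - 1) * qnum k r (lc k ω ξ s j))))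
      • ket (ξ.shift s j 1))
  - (∑ j, ((ω.c s j)⁻¹
        * (R s j (ξ.shift s j (-1))
            / (qnum k r (2 * lc k ω ξ s j - 1) * qnum k r (lc k ω ξ s j - 1))))
      • ket (ξ.shift s j (-1)))
  + (Complex.I * coefC k r ω s ξ) • ket ξ

/-- The operator of `I_{s+1,s}`, `1 ≤ s ≤ n - 1`. -/
noncomputable def op (R : Roots n k) (s : Fin n) : Module.End ℂ (Space n k) :=
  Finsupp.linearCombination ℂ
    (fun ξ => if Even (s : ℕ) then actEven k r ω R s ξ else actOdd k r ω R s ξ)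

/-- `T` is the representation `T_ω` with the choice `R` of the square roots: it sends the
generator `I_{s+1,s}`, `s = i + 1`, to the operator given above. -/
def IsTomega (R : Roots n k) (T : Alg (qroot k r) n →ₐ[ℂ] Module.End ℂ (Space n k)) : Prop :=
  ∀ i : Fin (n - 1), T (gen (qroot k r) n i) = op k r ω R ⟨(i : ℕ) + 1, by omega⟩

end Operators

end UqSo

namespace UqSo

/-! Put `h` = q^(1/2) and use the multiplicative coordinate `Y` = q^l in even rows, q^(l - 1/2) in
odd rows. After this half shift A and B have one and the same radicand `radU`, built from the
brackets `gg` (with the two adjacent rows) and `dd` (inside the row). Both are symmetric under the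
reflection that exchanges a move with its reverse, so a backward move is a forward move with the
inverted coordinate. Every operator becomes a sum of weighted shifts indexed by (place, direction),
plus a diagonal part (`op_eq`). Since q^k = 1, the wrap-around modulo k never shows.

Existence. The cubic relation is checked on one weighted shift T at a time (`serre_of_local`). The
coefficient of a path with two moves of X has a closed form, because T can be transported past each
move. Repeating one move gives the factor [0]; moves at different places cancel in pairs by an
exchange relation; a move cancels against the diagonal part. What remains are the round trips, whose
sum must be -1. With `rho` z = z^2 + z^(-2) this sum says that the Lagrange interpolant of a monic
polynomial has leading coefficient 1: the nodes are the `rho` of the moving coordinates in both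
directions and, in odd rows, the further node `rho 1`, whose term is the diagonal contribution
(`interpolation_even`, `interpolation_odd`). The exchange and transport relations need coherent
signs of the square roots; `stdRoots` takes products of fixed square roots of single brackets, with
ratios oriented by the order of the rows and of the places (`ds_exchange`, `gs_exchange`).

Irreducibility and nonequivalence. For a family of representations consider the functions on the
union of the bases by which some algebra element acts diagonally in all members at once. Two states
that no such function separates agree row by row (`Linked.Y_eq`). Row 2 is read off from I_21, which
is diagonal. If the rows up to s are known, indicator projections cut one move out of I_{s+1,s}; the
product of its matrix elements there and back is a separating function, contains only squares of the
roots, and determines the row s + 1 because a monic polynomial is determined by its values at enough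
nodes. One representation as a family gives the projections on all basis lines, and nonvanishing
matrix elements give irreducibility for any admissible choice of roots. The family of T_ω and T_ω'
gives an element that fixes a basis vector in the first and vanishes in the second. -/

/-! ### The bracket `[x]` as a function of `z = q ^ x` -/

/-- The bracket `(z - z⁻¹) / (q - q⁻¹)` with `q = h ^ 2`. -/
noncomputable def br (h z : ℂ) : ℂ := (z - z⁻¹) / (h ^ 2 - (h ^ 2)⁻¹)

/-- The scalars `h` with `q = h ^ 2 ≠ 0` and `q ^ 2 ≠ 1`. -/
structure Admissible (h : ℂ) : Prop where
  ne_zero : h ≠ 0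
  pow_ne_one : h ^ 4 ≠ 1

section Bracket

variable {h : ℂ}

lemma Admissible.den_ne_zero (hh : Admissible h) : h ^ 2 - (h ^ 2)⁻¹ ≠ 0 := by
  have h0 := hh.ne_zero
  intro h1
  apply hh.pow_ne_one
  field_simp at h1
  linear_combination h1

lemma br_inv (h z : ℂ) : br h z⁻¹ = -br h z := by
  simp only [br, inv_inv]; ring

lemma br_one (h : ℂ) : br h 1 = 0 := by simp [br]

lemma br_sq (hh : Admissible h) : br h (h ^ 2) = 1 := div_self hh.den_ne_zero

lemma br_ne_zero (hh : Admissible h) {z : ℂ} (hz : z ≠ 0) (hz1 : z ^ 2 ≠ 1) : br h z ≠ 0 := by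
  refine div_ne_zero (fun h1 => hz1 ?_) hh.den_ne_zero
  field_simp at h1
  linear_combination h1

/-- Additively: [a+1/2][b+1/2] - (q+q⁻¹)[a-1/2][b+1/2] + [a-1/2][b-1/2] = [b-a+1]. It sums the three
positions of T among two moves of X. -/
lemma br_transport (hh : Admissible h) {z w : ℂ} (hz : z ≠ 0) (hw : w ≠ 0) :
    br h (z * h) * br h (w * h) - (h ^ 2 + (h ^ 2)⁻¹) * (br h (z / h) * br h (w * h))
      + br h (z / h) * br h (w / h) = br h (w / z * h ^ 2) := by
  have h0 := hh.ne_zero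
  have h1 := hh.den_ne_zero
  -- The factor [1] = 1 makes the identity homogeneous of degree two, so both sides have the same
  -- denominator.
  have h2 : br h (w / z * h ^ 2) = br h (w / z * h ^ 2) * br h (h ^ 2) := by
    rw [br_sq hh, mul_one]
  rw [h2]
  simp only [br]
  rw [div_mul_div_comm, div_mul_div_comm, div_mul_div_comm, div_mul_div_comm, ← mul_div_assoc,
    ← sub_div, ← add_div]
  congr 1
  field_simp
  ring

/-- The analogue of `br_transport` for one move and one diagonal step of X, with both orders added.
It is homogeneous in the brackets, so their common denominator plays no role. -/
lemma br_transport_diag (hh : Admissible h) {e y : ℂ} (he : e ≠ 0) (hy : y ≠ 0) :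
    br h (y * h ^ 3) * (br h (e / y * h) * (br h (e * h ^ 2) - (h ^ 2 + (h ^ 2)⁻¹) * br h e)
        + br h (e / (y * h)) * br h e)
      + br h (y / h) * (br h (e / y * h) * br h (e * h ^ 2)
        - (h ^ 2 + (h ^ 2)⁻¹) * (br h (e / (y * h)) * br h (e * h ^ 2))
        + br h (e / (y * h)) * br h e) = 0 := by
  have h0 := hh.ne_zero
  have h1 := hh.den_ne_zero
  simp only [br]
  rw [← sub_eq_zero]
  generalize h ^ 2 - (h ^ 2)⁻¹ = D at h1
  field_simp
  ring

end Bracket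

/-! ### Weighted shifts -/

lemma end_ext {G : Type*} {A B : Module.End ℂ (G →₀ ℂ)}
    (hAB : ∀ ξ, A (Finsupp.single ξ 1) = B (Finsupp.single ξ 1)) : A = B := by
  apply Finsupp.lhom_ext'
  intro ξ
  apply LinearMap.ext_ring
  simpa using hAB ξ

section Shift

variable {G : Type*} [AddCommGroup G]

/-- The operator `|ξ⟩ ↦ f(ξ) |ξ + g⟩`. -/
noncomputable def wshift (f : G → ℂ) (g : G) : Module.End ℂ (G →₀ ℂ) :=
  Finsupp.linearCombination ℂ (fun ξ => f ξ • Finsupp.single (ξ + g) 1)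

lemma wshift_single (f : G → ℂ) (g ξ : G) :
    wshift f g (Finsupp.single ξ 1) = f ξ • Finsupp.single (ξ + g) 1 := by
  simp [wshift]

lemma wshift_mul (f f' : G → ℂ) (g g' : G) :
    wshift f g * wshift f' g' = wshift (fun ξ => f' ξ * f (ξ + g')) (g' + g) :=
  end_ext fun ξ => by
    simp only [Module.End.mul_apply, wshift_single, map_smul, smul_smul, add_assoc]

lemma wshift_add (f f' : G → ℂ) (g : G) :
    wshift f g + wshift f' g = wshift (fun ξ => f ξ + f' ξ) g :=
  end_ext fun ξ => by simp only [LinearMap.add_apply, wshift_single, add_smul]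

lemma wshift_neg (f : G → ℂ) (g : G) : -wshift f g = wshift (fun ξ => -f ξ) g :=
  end_ext fun ξ => by simp only [LinearMap.neg_apply, wshift_single, neg_smul]

lemma wshift_zero (g : G) : wshift (fun _ => 0) g = 0 :=
  end_ext fun ξ => by simp only [LinearMap.zero_apply, wshift_single, zero_smul]

lemma wshift_sum {ι : Type*} (s : Finset ι) (f : ι → G → ℂ) (g : G) :
    ∑ i ∈ s, wshift (f i) g = wshift (fun ξ => ∑ i ∈ s, f i ξ) g :=
  end_ext fun ξ => by
    simp only [LinearMap.coe_sum, Finset.sum_apply, wshift_single, Finset.sum_smul]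

end Shift

/-! ### The cubic relation -/

section Serre

/-- The polarized left side of the cubic relation. -/
def serre {A : Type*} [Ring A] [Algebra ℂ A] (c : ℂ) (X Y T : A) : A :=
  X * Y * T - c • (X * T * Y) + T * X * Y

variable {A : Type*} [Ring A] [Algebra ℂ A]

lemma serre_sum_sum {κ κ' : Type*} (s : Finset κ) (s' : Finset κ') (c : ℂ) (X : κ → A)
    (Y : κ' → A) (T : A) :
    serre c (∑ i ∈ s, X i) (∑ j ∈ s', Y j) T = ∑ i ∈ s, ∑ j ∈ s', serre c (X i) (Y j) T := by
  simp only [serre, Finset.sum_mul, Finset.mul_sum, Finset.sum_add_distrib,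
    Finset.sum_sub_distrib, Finset.smul_sum, mul_assoc]
  rw [Finset.sum_comm (s := s') (t := s) (f := fun x x_1 => X x_1 * (Y x * T)),
    Finset.sum_comm (s := s') (t := s) (f := fun x x_1 => c • (X x_1 * (T * Y x))),
    Finset.sum_comm (s := s') (t := s) (f := fun x x_1 => T * (X x_1 * Y x))]

lemma serre_sum_right {κ : Type*} (s : Finset κ) (c : ℂ) (X : A) (T : κ → A) :
    serre c X X (∑ i ∈ s, T i) = ∑ i ∈ s, serre c X X (T i) := by
  simp only [serre, Finset.sum_mul, Finset.mul_sum, Finset.sum_add_distrib,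
    Finset.sum_sub_distrib, Finset.smul_sum]

lemma serre_add_right (c : ℂ) (X T T' : A) :
    serre c X X (T + T') = serre c X X T + serre c X X T' := by
  simp only [serre, mul_add, add_mul, smul_add]
  abel

/-- Polarization: the symmetrized terms vanish except for opposite pairs, so only round trips
survive. The case j = i is among those that must vanish, unless `opp` fixes i. -/
lemma serre_eq_sum_opp {κ : Type*} [Fintype κ] [DecidableEq κ] (opp : κ → κ) (c : ℂ)
    (X : κ → A) (T : A)
    (hopp : ∀ i, opp (opp i) = i)
    (hX : ∀ i j, j ≠ opp i → serre c (X j) (X i) T + serre c (X i) (X j) T = 0) :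
    serre c (∑ i, X i) (∑ i, X i) T = ∑ i, serre c (X (opp i)) (X i) T := by
  -- Doubling lets the double sum be symmetrized without halves.
  have h2 : ∀ a b : A, (2 : ℂ) • a = (2 : ℂ) • b → a = b := fun a b hab =>
    smul_right_injective A (two_ne_zero (α := ℂ)) hab
  apply h2
  rw [serre_sum_sum, two_smul, two_smul]
  conv_lhs => enter [2]; rw [Finset.sum_comm]
  rw [← Finset.sum_add_distrib]
  simp_rw [← Finset.sum_add_distrib]
  have hi : ∀ i, ∑ j, (serre c (X i) (X j) T + serre c (X j) (X i) T)
      = serre c (X i) (X (opp i)) T + serre c (X (opp i)) (X i) T := by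
    intro i
    refine Finset.sum_eq_single_of_mem (opp i) (Finset.mem_univ _) fun j _ hj => ?_
    rw [add_comm]
    exact hX i j hj
  simp_rw [hi]
  rw [Finset.sum_add_distrib, Finset.sum_add_distrib]
  congr 1
  exact Fintype.sum_equiv ⟨opp, opp, hopp, hopp⟩ _ _ fun i => by simp [hopp]

end Serre

/-! ### The cubic relation for weighted shifts -/

section LocalSerre

variable {G : Type*} [AddCommGroup G]

/-- The three summands correspond to T acting first, between the two moves, and last. -/
lemma serre_wshift (c : ℂ) (f g t : G → ℂ) (a b β : G) :
    serre c (wshift g b) (wshift f a) (wshift t β)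
      = wshift (fun ξ => t ξ * f (ξ + β) * g (ξ + β + a)
          - c * (f ξ * t (ξ + a) * g (ξ + a + β)) + f ξ * g (ξ + a) * t (ξ + a + b))
        (a + b + β) := by
  refine end_ext fun ξ => ?_
  have e1 : ξ + β + a + b = ξ + (a + b + β) := by abel
  have e2 : ξ + a + β + b = ξ + (a + b + β) := by abel
  have e3 : ξ + a + b + β = ξ + (a + b + β) := by abel
  simp only [serre, LinearMap.add_apply, LinearMap.sub_apply, LinearMap.smul_apply,
    Module.End.mul_apply, wshift_single, map_smul, smul_smul, add_smul, sub_smul, e1, e2, e3,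
    mul_assoc]

/-- The cubic relation `X² T - (q + q⁻¹) X T X + T X² = -T` for a sum `X` of weighted shifts
in the directions `± e_i` and a diagonal part `D`, and one weighted shift `T`. -/
theorem serre_of_local {ι : Type*} [Fintype ι] [DecidableEq ι] {h : ℂ} (hh : Admissible h)
    {vec : ι × Bool → G} {S y : ι × Bool → G → ℂ} {t D η : G → ℂ} {β : G}
    (vec_not : ∀ i b, vec (i, !b) = -vec (i, b))
    (y_not : ∀ i b ξ, y (i, !b) ξ = (y (i, b) ξ)⁻¹)
    (y_ne : ∀ α ξ, y α ξ ≠ 0) (η_ne : ∀ ξ, η ξ ≠ 0)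
    (y_β : ∀ α ξ, y α (ξ + β) = y α ξ)
    (y_self : ∀ α ξ, y α (ξ + vec α) = y α ξ * h ^ 2)
    (y_other : ∀ α α' ξ, α.1 ≠ α'.1 → y α' (ξ + vec α) = y α' ξ)
    (η_vec : ∀ α ξ, η (ξ + vec α) = η ξ)
    (br_η : ∀ α ξ, br h (η ξ / y α ξ * h) ≠ 0)
    (transport : ∀ α ξ, S α ξ * t (ξ + vec α) * br h (η ξ / y α ξ * h)
      = t ξ * S α (ξ + β) * br h (η ξ / (y α ξ * h)))
    (exchange : ∀ α α' ξ, α.1 ≠ α'.1 →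
      S α ξ * S α' (ξ + vec α) * br h (y α ξ / y α' ξ * h ^ 2)
        = S α' ξ * S α (ξ + vec α') * br h (y α ξ / (y α' ξ * h ^ 2)))
    (diag : (∀ ξ, D ξ = 0) ∨ ((∀ ξ, br h (η ξ) ≠ 0 ∧ ∀ α, br h (y α ξ * h ^ 3) ≠ 0) ∧
      (∀ ξ, D (ξ + β) * br h (η ξ) = D ξ * br h (η ξ * h ^ 2)) ∧
      ∀ α ξ, D (ξ + vec α) * br h (y α ξ * h ^ 3) = D ξ * br h (y α ξ / h)))
    (total : ∀ ξ, ∑ α : ι × Bool, S α (ξ + β) * S (α.1, !α.2) (ξ + β + vec α)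
          * (br h (y α ξ ^ 2 * h ^ 4)
            / (br h (η ξ / y α ξ * h) * br h (η ξ * y α ξ * h ^ 3)))
        + (D (ξ + β) ^ 2 - (h ^ 2 + (h ^ 2)⁻¹) * (D (ξ + β) * D ξ) + D ξ ^ 2) = -1) :
    serre (h ^ 2 + (h ^ 2)⁻¹) (∑ α, wshift (S α) (vec α) + wshift D 0)
      (∑ α, wshift (S α) (vec α) + wshift D 0) (wshift t β) = -wshift t β := by
  have h0 := hh.ne_zero
  set c := h ^ 2 + (h ^ 2)⁻¹ with hc
  have hβ : ∀ ξ a : G, ξ + a + β = ξ + β + a := fun ξ a => add_right_comm _ _ _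
  -- the coefficient of the path `α`, `α'`
  have key : ∀ α α' ξ, t ξ * S α (ξ + β) * S α' (ξ + β + vec α)
          - c * (S α ξ * t (ξ + vec α) * S α' (ξ + vec α + β))
          + S α ξ * S α' (ξ + vec α) * t (ξ + vec α + vec α')
        = t ξ * S α (ξ + β) * S α' (ξ + β + vec α)
          * (br h (y α ξ / y α' (ξ + vec α) * h ^ 2)
            / (br h (η ξ / y α ξ * h) * br h (η ξ / y α' (ξ + vec α) * h))) := by
    intro α α' ξ
    have hp := br_η α ξ
    have hp' := br_η α' (ξ + vec α)
    -- Transporting T across both moves gives all three terms the common factor `t ξ * S α (ξ + β) *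
    -- S α' (ξ + β + vec α)`; `br_transport` adds up the rest.
    have e1 := transport α ξ
    have e2 := transport α' (ξ + vec α)
    rw [η_vec] at hp' e2
    have hF := br_transport hh (div_ne_zero (η_ne ξ) (y_ne α ξ))
      (div_ne_zero (η_ne ξ) (y_ne α' (ξ + vec α)))
    rw [div_div_div_cancel_left' _ _ (η_ne ξ), div_div, div_div, ← hc] at hF
    rw [← hF]
    rw [hβ] at e2 ⊢
    have e3 : S α ξ * S α' (ξ + vec α) * t (ξ + vec α + vec α')
          * (br h (η ξ / y α ξ * h) * br h (η ξ / y α' (ξ + vec α) * h))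
        = t ξ * S α (ξ + β) * S α' (ξ + β + vec α) *
          (br h (η ξ / (y α ξ * h)) * br h (η ξ / (y α' (ξ + vec α) * h))) := by
      linear_combination (S α ξ * br h (η ξ / y α ξ * h)) * e2
        + (S α' (ξ + β + vec α) * br h (η ξ / (y α' (ξ + vec α) * h))) * e1
    rw [mul_div_assoc', eq_div_iff (mul_ne_zero hp hp')]
    linear_combination e3 - c * S α' (ξ + β + vec α) * br h (η ξ / y α' (ξ + vec α) * h) * e1
  -- The diagonal part is the summand `none`, its own opposite; hence the square of the diagonal
  -- part stays in the final sum.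
  let X : Option (ι × Bool) → Module.End ℂ (G →₀ ℂ) :=
    fun o => o.elim (wshift D 0) fun α => wshift (S α) (vec α)
  let opp : Option (ι × Bool) → Option (ι × Bool) := Option.map fun α => (α.1, !α.2)
  have hXsum : ∑ α, wshift (S α) (vec α) + wshift D 0 = ∑ o, X o := by
    rw [Fintype.sum_option, add_comm]
    rfl
  have hdiag : ∀ α, serre c (wshift D 0) (wshift (S α) (vec α)) (wshift t β)
      + serre c (wshift (S α) (vec α)) (wshift D 0) (wshift t β) = 0 := by
    intro α
    rw [serre_wshift, serre_wshift, zero_add, add_zero, wshift_add]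
    convert wshift_zero _ using 2
    ext ξ
    simp only [add_zero]
    rcases diag with hD | ⟨hne, hD1, hD2⟩
    · simp only [hD]; ring
    · obtain ⟨hb, hb3⟩ := hne ξ
      have hb3 := hb3 α
      have e1 := transport α ξ
      have hp := br_η α ξ
      have e2 := hD1 ξ
      have e3 := hD2 α ξ
      have e4 := hD1 (ξ + vec α)
      rw [η_vec, hβ] at e4
      rw [hβ]
      have hI := br_transport_diag hh (η_ne ξ) (y_ne α ξ)
      rw [← hc] at hI
      have e1' : S α ξ * t (ξ + vec α) = t ξ * S α (ξ + β) * br h (η ξ / (y α ξ * h))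
          / br h (η ξ / y α ξ * h) := by rw [eq_div_iff hp, e1]
      have e2' : D (ξ + β) = D ξ * br h (η ξ * h ^ 2) / br h (η ξ) := by
        rw [eq_div_iff hb, e2]
      have e3' : D (ξ + vec α) = D ξ * br h (y α ξ / h) / br h (y α ξ * h ^ 3) := by
        rw [eq_div_iff hb3, e3]
      have e4' : D (ξ + β + vec α) = D (ξ + vec α) * br h (η ξ * h ^ 2) / br h (η ξ) := by
        rw [eq_div_iff hb, e4]
      have e5 : D ξ * S α ξ * t (ξ + vec α) = D ξ * (S α ξ * t (ξ + vec α)) := by ring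
      have e6 : S α ξ * D (ξ + vec α) * t (ξ + vec α)
        = D (ξ + vec α) * (S α ξ * t (ξ + vec α)) := by ring
      rw [e5, e6, e1', e4', e2', e3']
      clear e1 e2 e3 e4 e5 e6 e1' e2' e3' e4' key
      generalize br h (y α ξ * h ^ 3) = b1 at *
      generalize br h (η ξ / y α ξ * h) = b2 at *
      generalize br h (η ξ * h ^ 2) = b3 at *
      generalize br h (η ξ / (y α ξ * h)) = b4 at *
      generalize br h (η ξ) = b5 at *
      generalize br h (y α ξ / h) = b6 at *
      clear_value c
      field_simp
      linear_combination (t ξ * S α (ξ + β) * D ξ) * hI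
  -- After the first move the coordinate has been multiplied by q, so the bracket in `key` is [0].
  have hself : ∀ α, serre c (wshift (S α) (vec α)) (wshift (S α) (vec α)) (wshift t β) = 0 := by
    intro α
    rw [serre_wshift]
    convert wshift_zero _ using 2
    ext ξ
    rw [key, y_self, div_mul_eq_mul_div, div_self (mul_ne_zero (y_ne α ξ) (pow_ne_zero 2 h0)),
      br_one, zero_div, mul_zero]
  rw [hXsum, serre_eq_sum_opp opp c X _ (by
    rintro (_ | ⟨i, b⟩)
    · rfl
    · change some (i, !!b) = _
      rw [Bool.not_not])]
  · rw [Fintype.sum_option]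
    simp only [X, opp, Option.map_none, Option.map_some, Option.elim_none, Option.elim_some]
    simp only [serre_wshift, add_zero, zero_add]
    have hv : ∀ α : ι × Bool, vec α + vec (α.1, !α.2) + β = β := by
      intro α; rw [vec_not]; simp
    simp only [hv, wshift_sum, wshift_add, wshift_neg]
    congr 1
    ext ξ
    have ht := total ξ
    have hsum : ∑ α : ι × Bool, (t ξ * S α (ξ + β) * S (α.1, !α.2) (ξ + β + vec α)
          - c * (S α ξ * t (ξ + vec α) * S (α.1, !α.2) (ξ + vec α + β))
          + S α ξ * S (α.1, !α.2) (ξ + vec α) * t (ξ + vec α + vec (α.1, !α.2)))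
        = t ξ * ∑ α : ι × Bool, S α (ξ + β) * S (α.1, !α.2) (ξ + β + vec α)
          * (br h (y α ξ ^ 2 * h ^ 4)
            / (br h (η ξ / y α ξ * h) * br h (η ξ * y α ξ * h ^ 3))) := by
      rw [Finset.mul_sum]
      refine Finset.sum_congr rfl fun α _ => ?_
      rw [key, y_not α.1 α.2, y_self]
      have hy := y_ne α ξ
      rw [show y α ξ / (y α ξ * h ^ 2)⁻¹ * h ^ 2 = y α ξ ^ 2 * h ^ 4 by field_simp,
        show η ξ / (y α ξ * h ^ 2)⁻¹ * h = η ξ * y α ξ * h ^ 3 by field_simp]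
      ring
    rw [hsum]
    linear_combination t ξ * ht
  · rintro (_ | α) (_ | α') hne
    · exact absurd rfl hne
    · simpa only [X, Option.elim_none, Option.elim_some, add_comm] using hdiag α'
    · simpa only [X, Option.elim_none, Option.elim_some] using hdiag α
    · simp only [X, Option.elim_some]
      by_cases h1 : α.1 = α'.1
      · obtain ⟨i, b⟩ := α
        obtain ⟨i', b'⟩ := α'
        simp only at h1
        subst h1
        have hb : b' = b := by
          by_contra hb
          apply hne
          rw [(Bool.eq_not).mpr hb]
          rfl
        subst hb
        rw [hself, add_zero]
      · rw [serre_wshift, serre_wshift, add_comm (vec α') (vec α), wshift_add]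
        convert wshift_zero _ using 2
        ext ξ
        rw [key, key, y_other α α' ξ h1, y_other α' α ξ (Ne.symm h1)]
        -- The closed form in `key` carries the matrix elements after T has acted, hence the base
        -- point `ξ + β`.
        have e := exchange α α' (ξ + β) h1
        rw [y_β, y_β] at e
        have hi : br h (y α ξ / (y α' ξ * h ^ 2)) = -br h (y α' ξ / y α ξ * h ^ 2) := by
          rw [← br_inv]
          congr 1
          have := y_ne α ξ
          have := y_ne α' ξ
          field_simp
        rw [hi] at e
        have hp := br_η α ξ
        have hp' := br_η α' ξ
        rw [mul_comm (br h (η ξ / y α' ξ * h)), ← mul_div_assoc, ← mul_div_assoc, ← add_div]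
        refine div_eq_zero_iff.mpr (Or.inl ?_)
        linear_combination t ξ * e

end LocalSerre

end UqSo

namespace UqSo

/-! ### Interpolation identities -/

section Interpolation

/-- The left side is the leading coefficient of the Lagrange interpolant of a monic polynomial whose
degree is one less than the number of nodes. The signs from reversing the differences cancel. -/
lemma sum_prod_sub_div_prod_sub {κ γ : Type*} [Fintype κ] [DecidableEq κ] (P : κ → ℂ)
    (hP : Function.Injective P) (M : Finset γ) (ρ : γ → ℂ) (hM : M.card + 1 = Fintype.card κ) :
    ∑ α, (∏ c ∈ M, (ρ c - P α)) / ∏ α' ∈ Finset.univ.erase α, (P α' - P α) = 1 := by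
  have hdeg : (∏ c ∈ M, (Polynomial.X - Polynomial.C (ρ c))).degree = (M.card : WithBot ℕ) := by
    rw [Polynomial.degree_prod]
    simp
  have h := Lagrange.leadingCoeff_eq_sum (s := Finset.univ) (v := P) (hP.injOn)
    (P := ∏ c ∈ M, (Polynomial.X - Polynomial.C (ρ c)))
    (by rw [hdeg, Finset.card_univ, ← hM]; norm_cast)
  rw [(Polynomial.monic_prod_of_monic _ _ fun c _ => Polynomial.monic_X_sub_C _).leadingCoeff] at h
  rw [h]
  refine Finset.sum_congr rfl fun α _ => ?_
  have e1 : ∏ c ∈ M, (ρ c - P α) = (-1) ^ M.card * ∏ c ∈ M, (P α - ρ c) := by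
    rw [← Finset.prod_const, ← Finset.prod_mul_distrib]
    exact Finset.prod_congr rfl fun c _ => by ring
  have e2 : ∏ α' ∈ Finset.univ.erase α, (P α' - P α)
      = (-1) ^ M.card * ∏ α' ∈ Finset.univ.erase α, (P α - P α') := by
    have hc : M.card = (Finset.univ.erase α).card := by
      rw [Finset.card_erase_of_mem (Finset.mem_univ _), Finset.card_univ]; omega
    rw [hc, ← Finset.prod_const, ← Finset.prod_mul_distrib]
    exact Finset.prod_congr rfl fun c _ => by ring
  rw [e1, e2, mul_div_mul_left _ _ (pow_ne_zero _ (by norm_num)), Polynomial.eval_prod]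
  simp

/-- The symmetric function `z ^ 2 + z ^ (-2)`. -/
noncomputable def rho (z : ℂ) : ℂ := z ^ 2 + (z ^ 2)⁻¹

/-- The bracket product `[x + y + 1/2] [x - y - 1/2]`. -/
noncomputable def gg (h v u : ℂ) : ℂ := br h (v * u * h) * br h (v / (u * h))

/-- The bracket product `[x + y] [x - y] [x + y + 1] [x - y - 1]`. -/
noncomputable def dd (h v u : ℂ) : ℂ :=
  br h (v * u) * br h (v / u) * br h (v * u * h ^ 2) * br h (v / (u * h ^ 2))

/-- The coordinate or its inverse, for moves in the positive or the negative direction. -/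
noncomputable def sgn (b : Bool) (u : ℂ) : ℂ := if b then u else u⁻¹

lemma sgn_true (u : ℂ) : sgn true u = u := rfl

lemma sgn_false (u : ℂ) : sgn false u = u⁻¹ := rfl

lemma sgn_not (b : Bool) (u : ℂ) : sgn (!b) u = (sgn b u)⁻¹ := by
  cases b <;> simp [sgn]

lemma sgn_ne_zero (b : Bool) {u : ℂ} (hu : u ≠ 0) : sgn b u ≠ 0 := by
  cases b <;> simpa [sgn] using hu

variable {h : ℂ}

/-- The scale factor `(q - q⁻¹) ^ 2`. -/
noncomputable def kap (h : ℂ) : ℂ := (h ^ 2 - (h ^ 2)⁻¹) ^ 2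

lemma kap_ne_zero (hh : Admissible h) : kap h ≠ 0 := pow_ne_zero _ hh.den_ne_zero

/-- For z = q^x, w = q^y the difference is (q-q⁻¹)² [x+y][x-y]. This turns products of brackets into
linear factors for the interpolation. -/
lemma rho_sub_rho (hh : Admissible h) {z w : ℂ} (hz : z ≠ 0) (hw : w ≠ 0) :
    rho z - rho w = kap h * (br h (z * w) * br h (z / w)) := by
  have h1 := hh.den_ne_zero
  simp only [br, kap, rho]
  generalize h ^ 2 - (h ^ 2)⁻¹ = D at h1
  field_simp
  ring

lemma rho_sub_two (hh : Admissible h) {z : ℂ} (hz : z ≠ 0) :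
    rho z - rho 1 = kap h * br h z ^ 2 := by
  rw [rho_sub_rho hh hz one_ne_zero]
  simp [sq]

lemma kap_mul_gg (hh : Admissible h) {v u : ℂ} (hv : v ≠ 0) (hu : u ≠ 0) :
    kap h * gg h v u = rho v - rho (u * h) := by
  rw [rho_sub_rho hh hv (mul_ne_zero hu hh.ne_zero), gg, mul_assoc v]

/-- The two factors belong to the two nodes of one place, for the positive and for the negative
direction. -/
lemma kap_mul_dd (hh : Admissible h) {v u : ℂ} (hv : v ≠ 0) (hu : u ≠ 0) :
    kap h ^ 2 * dd h v u = (rho (v * h) - rho (u * h)) * (rho (v⁻¹ * h) - rho (u * h)) := by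
  have h0 := hh.ne_zero
  rw [rho_sub_rho hh (mul_ne_zero hv h0) (mul_ne_zero hu h0),
    rho_sub_rho hh (mul_ne_zero (inv_ne_zero hv) h0) (mul_ne_zero hu h0), dd]
  have e1 : v⁻¹ * h * (u * h) = (v / (u * h ^ 2))⁻¹ := by field_simp
  have e2 : v⁻¹ * h / (u * h) = (v * u)⁻¹ := by field_simp
  have e3 : v * h / (u * h) = v / u := by field_simp
  have e4 : v * h * (u * h) = v * u * h ^ 2 := by ring
  rw [e1, e2, e3, e4, br_inv, br_inv]
  ring

lemma kap_mul_br_sq (hh : Admissible h) {u : ℂ} (hu : u ≠ 0) :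
    -(kap h * br h (u ^ 2)) = rho (u⁻¹ * h) - rho (u * h) := by
  have h0 := hh.ne_zero
  rw [rho_sub_rho hh (mul_ne_zero (inv_ne_zero hu) h0) (mul_ne_zero hu h0)]
  have e1 : u⁻¹ * h * (u * h) = h ^ 2 := by field_simp
  have e2 : u⁻¹ * h / (u * h) = (u ^ 2)⁻¹ := by field_simp
  rw [e1, e2, br_inv, br_sq hh]
  ring

/-- The opposite node of the same place contributes the bracket of y² with a minus sign; each other
place contributes a pair of nodes, hence one `dd`. -/
lemma prod_erase_points (hh : Admissible h) {ι : Type*} [Fintype ι] [DecidableEq ι] {u : ι → ℂ}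
    (hu : ∀ i, u i ≠ 0) (α : ι × Bool) :
    ∏ α' ∈ Finset.univ.erase α, (rho (sgn α'.2 (u α'.1) * h) - rho (sgn α.2 (u α.1) * h))
      = -(kap h ^ (2 * Fintype.card ι - 1) * (br h (sgn α.2 (u α.1) ^ 2)
        * ∏ i ∈ Finset.univ.erase α.1, dd h (u i) (sgn α.2 (u α.1)))) := by
  obtain ⟨j, b⟩ := α
  simp only
  set y := sgn b (u j) with hy
  have hy0 : y ≠ 0 := sgn_ne_zero b (hu j)
  have hset : (Finset.univ.erase (j, b) : Finset (ι × Bool))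
      = insert (j, !b) ((Finset.univ.erase j) ×ˢ Finset.univ) := by
    ext ⟨i, b'⟩
    simp only [Finset.mem_erase, Finset.mem_univ, and_true, Finset.mem_insert,
      Finset.mem_product, Prod.mk.injEq, ne_eq]
    by_cases hi : i = j <;> cases b <;> cases b' <;> simp [hi]
  rw [hset, Finset.prod_insert (by simp), Finset.prod_product]
  simp only [Fintype.prod_bool, sgn_not, ← hy, ← kap_mul_br_sq hh hy0]
  have e : ∀ i ∈ Finset.univ.erase j,
      (rho (sgn true (u i) * h) - rho (y * h)) * (rho (sgn false (u i) * h) - rho (y * h))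
        = kap h ^ 2 * dd h (u i) y := fun i _ => (kap_mul_dd hh (hu i) hy0).symm
  rw [Finset.prod_congr rfl e, Finset.prod_mul_distrib, Finset.prod_const,
    Finset.card_erase_of_mem (Finset.mem_univ _), Finset.card_univ, ← pow_mul]
  have hc : 0 < Fintype.card ι := Fintype.card_pos_iff.mpr ⟨j⟩
  have e2 : 2 * Fintype.card ι - 1 = 2 * (Fintype.card ι - 1) + 1 := by omega
  rw [e2, pow_succ]
  ring

/-- There are twice as many nodes as places and the polynomial has degree one less, so all powers of
`kap` cancel. The value -1 comes from the sign in `prod_erase_points`. -/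
theorem interpolation_even (hh : Admissible h) {ι γ : Type*} [Fintype ι] [DecidableEq ι]
    {u : ι → ℂ} (hu : ∀ i, u i ≠ 0) (M : Finset γ) {v : γ → ℂ} (hv : ∀ c ∈ M, v c ≠ 0)
    (hM : M.card + 1 = 2 * Fintype.card ι)
    (hinj : Function.Injective fun α : ι × Bool => rho (sgn α.2 (u α.1) * h)) :
    ∑ α : ι × Bool, (∏ c ∈ M, gg h (v c) (sgn α.2 (u α.1)))
        / (br h (sgn α.2 (u α.1) ^ 2)
          * ∏ i ∈ Finset.univ.erase α.1, dd h (u i) (sgn α.2 (u α.1))) = -1 := by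
  have key := sum_prod_sub_div_prod_sub _ hinj M (fun c => rho (v c))
    (by rw [hM, Fintype.card_prod, Fintype.card_bool, mul_comm])
  rw [← neg_eq_iff_eq_neg, ← key, ← Finset.sum_neg_distrib]
  refine Finset.sum_congr rfl fun α _ => ?_
  have hy0 : sgn α.2 (u α.1) ≠ 0 := sgn_ne_zero _ (hu _)
  rw [prod_erase_points hh hu α, Finset.prod_congr rfl fun c hc =>
    (kap_mul_gg hh (hv c hc) hy0).symm, Finset.prod_mul_distrib, Finset.prod_const,
    show 2 * Fintype.card ι - 1 = M.card by omega, div_neg,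
    mul_div_mul_left _ _ (pow_ne_zero _ (kap_ne_zero hh))]

/-- The extra node `rho 1` has a Lagrange term that is a perfect square, the second summand, and it
puts a squared bracket into the denominator of every other term. -/
theorem interpolation_odd (hh : Admissible h) {ι γ : Type*} [Fintype ι] [DecidableEq ι]
    {u : ι → ℂ} (hu : ∀ i, u i ≠ 0) (M : Finset γ) {v : γ → ℂ} (hv : ∀ c ∈ M, v c ≠ 0)
    (hM : M.card = 2 * Fintype.card ι)
    (hinj : Function.Injective fun α : ι × Bool => rho (sgn α.2 (u α.1) * h))
    (hone : ∀ α : ι × Bool, rho (sgn α.2 (u α.1) * h) ≠ rho 1) :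
    ∑ α : ι × Bool, (∏ c ∈ M, gg h (v c) (sgn α.2 (u α.1)))
        / (br h (sgn α.2 (u α.1) ^ 2) * br h (sgn α.2 (u α.1) * h) ^ 2
          * ∏ i ∈ Finset.univ.erase α.1, dd h (u i) (sgn α.2 (u α.1)))
      + ((∏ c ∈ M, br h (v c)) / ∏ i, (br h (u i * h) * br h (u i / h))) ^ 2 = 1 := by
  have h0 := hh.ne_zero
  let P : Option (ι × Bool) → ℂ := fun o => o.elim (rho 1) fun α => rho (sgn α.2 (u α.1) * h)
  have hPinj : Function.Injective P := by
    rintro (_ | α) (_ | α') hP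
    · rfl
    · exact absurd hP.symm (hone α')
    · exact absurd hP (hone α)
    · exact congrArg some (hinj hP)
  have key := sum_prod_sub_div_prod_sub P hPinj M (fun c => rho (v c))
    (by rw [hM, Fintype.card_option, Fintype.card_prod, Fintype.card_bool, mul_comm])
  rw [← key, Fintype.sum_option, add_comm]
  congr 1
  · have e : (Finset.univ.erase none : Finset (Option (ι × Bool)))
        = Finset.univ.map Function.Embedding.some := by
      ext o; cases o <;> simp
    simp only [P, Option.elim_none, e, Finset.prod_map, Function.Embedding.some_apply,
      Option.elim_some]
    rw [Finset.prod_congr rfl fun c hc => rho_sub_two hh (hv c hc), Fintype.prod_prod_type]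
    have e2 : ∀ i, ∏ b : Bool, (rho (sgn b (u i) * h) - rho 1)
        = kap h ^ 2 * (br h (u i * h) * br h (u i / h)) ^ 2 := by
      intro i
      rw [Fintype.prod_bool, sgn_true, sgn_false, rho_sub_two hh (mul_ne_zero (hu i) h0),
        rho_sub_two hh (mul_ne_zero (inv_ne_zero (hu i)) h0),
        show (u i)⁻¹ * h = (u i / h)⁻¹ by field_simp, br_inv]
      ring
    simp only [e2, Finset.prod_mul_distrib, Finset.prod_const, Finset.card_univ, hM, ← pow_mul,
      Finset.prod_pow]
    rw [mul_div_mul_left _ _ (pow_ne_zero _ (kap_ne_zero hh)), div_pow]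
  · refine Finset.sum_congr rfl fun α _ => ?_
    have hy0 : sgn α.2 (u α.1) ≠ 0 := sgn_ne_zero _ (hu _)
    have e : (Finset.univ.erase (some α) : Finset (Option (ι × Bool)))
        = insert none ((Finset.univ.erase α).map Function.Embedding.some) := by
      ext o; cases o <;> simp
    rw [e, Finset.prod_insert (by simp), Finset.prod_map]
    simp only [P, Option.elim_none, Function.Embedding.some_apply, Option.elim_some]
    rw [prod_erase_points hh hu α, Finset.prod_congr rfl fun c hc =>
      (kap_mul_gg hh (hv c hc) hy0).symm, Finset.prod_mul_distrib, Finset.prod_const,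
      ← neg_sub, rho_sub_two hh (mul_ne_zero hy0 h0)]
    have hc : 0 < Fintype.card ι := Fintype.card_pos_iff.mpr ⟨α.1⟩
    have hk : kap h ^ M.card = kap h * kap h ^ (2 * Fintype.card ι - 1) := by
      rw [← pow_succ']; congr 1; omega
    rw [hk, neg_mul_neg, mul_mul_mul_comm, mul_comm (br h (sgn α.2 (u α.1) * h) ^ 2),
      mul_div_mul_left _ _ (mul_ne_zero (kap_ne_zero hh) (pow_ne_zero _ (kap_ne_zero hh)))]
    congr 1
    ring

end Interpolation

end UqSo

namespace UqSo

/-! ### Powers of `q` -/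

section Powers

variable {k : ℕ} {r : ℤ}

lemma qpow_add (k : ℕ) (r : ℤ) (x y : ℂ) : qpow k r (x + y) = qpow k r x * qpow k r y := by
  rw [qpow, qpow, qpow, ← Complex.exp_add]
  congr 1
  ring

lemma qpow_zero (k : ℕ) (r : ℤ) : qpow k r 0 = 1 := by simp [qpow]

lemma qpow_ne_zero (k : ℕ) (r : ℤ) (x : ℂ) : qpow k r x ≠ 0 := Complex.exp_ne_zero _

lemma qpow_neg (k : ℕ) (r : ℤ) (x : ℂ) : qpow k r (-x) = (qpow k r x)⁻¹ := by
  rw [← mul_eq_one_iff_eq_inv₀ (qpow_ne_zero k r x), ← qpow_add, neg_add_cancel, qpow_zero]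

lemma qpow_sub (k : ℕ) (r : ℤ) (x y : ℂ) : qpow k r (x - y) = qpow k r x / qpow k r y := by
  rw [sub_eq_add_neg, qpow_add, qpow_neg, div_eq_mul_inv]

lemma qpow_int_mul (k : ℕ) (r : ℤ) (m : ℤ) (x : ℂ) : qpow k r (m * x) = qpow k r x ^ m := by
  rw [qpow, qpow, ← Complex.exp_int_mul]
  congr 1
  ring

lemma qpow_eq_one_iff (hk : k ≠ 0) (x : ℂ) : qpow k r x = 1 ↔ ∃ t : ℤ, (r : ℂ) * x = k * t := by
  have hk' : (k : ℂ) ≠ 0 := Nat.cast_ne_zero.mpr hk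
  rw [qpow, Complex.exp_eq_one_iff]
  refine exists_congr fun t => ?_
  have hpi := Complex.two_pi_I_ne_zero
  constructor
  · intro e
    field_simp at e
    have : (2 * Real.pi * Complex.I) * ((r : ℂ) * x) = (2 * Real.pi * Complex.I) * (k * t) := by
      linear_combination (2 * Complex.I * Real.pi) * e
    exact mul_left_cancel₀ hpi this
  · intro e
    field_simp
    linear_combination e

/-- The square root `q ^ (1/2)` of `q`. -/
noncomputable def qhalf (k : ℕ) (r : ℤ) : ℂ := qpow k r (1 / 2)

lemma qhalf_ne_zero (k : ℕ) (r : ℤ) : qhalf k r ≠ 0 := qpow_ne_zero _ _ _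

lemma qhalf_sq (k : ℕ) (r : ℤ) : qhalf k r ^ 2 = qroot k r := by
  rw [qhalf, qroot, sq, ← qpow_add]
  norm_num

lemma qhalf_zpow (k : ℕ) (r : ℤ) (m : ℤ) : qhalf k r ^ m = qpow k r (m / 2) := by
  rw [qhalf, ← qpow_int_mul]
  congr 1
  ring

lemma qroot_zpow (k : ℕ) (r : ℤ) (m : ℤ) : (qhalf k r ^ 2) ^ m = qpow k r m := by
  rw [qhalf_sq, qroot, ← qpow_int_mul, mul_one]

lemma qnum_eq_br (k : ℕ) (r : ℤ) (x : ℂ) : qnum k r x = br (qhalf k r) (qpow k r x) := by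
  rw [qnum, br, qhalf_sq, qpow_neg]

lemma qroot_zpow_eq_one_iff (hk : k ≠ 0) (hr : IsCoprime r (k : ℤ)) (m : ℤ) :
    (qhalf k r ^ 2) ^ m = 1 ↔ (k : ℤ) ∣ m := by
  rw [qroot_zpow, qpow_eq_one_iff hk]
  constructor
  · rintro ⟨t, ht⟩
    refine hr.symm.dvd_of_dvd_mul_left ⟨t, ?_⟩
    exact_mod_cast ht
  · rintro ⟨t, rfl⟩
    exact ⟨r * t, by push_cast; ring⟩

lemma qroot_pow_card (hk : k ≠ 0) (r : ℤ) : (qhalf k r ^ 2) ^ k = 1 := by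
  have := qroot_zpow k r k
  rw [zpow_natCast] at this
  rw [this, qpow_eq_one_iff hk]
  exact ⟨r, by push_cast; ring⟩

lemma admissible_qhalf (hk : Odd k) (hk1 : 1 < k) (hr : IsCoprime r (k : ℤ)) :
    Admissible (qhalf k r) where
  ne_zero := qhalf_ne_zero k r
  pow_ne_one := by
    intro h4
    have h2 : (qhalf k r ^ 2) ^ (2 : ℤ) = 1 := by
      rw [← h4]; norm_cast; rw [← pow_mul]
    rw [qroot_zpow_eq_one_iff (by omega) hr] at h2
    obtain ⟨c, hc⟩ := hk
    have := Int.le_of_dvd (by norm_num) h2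
    omega

/-- `q ^ a` for an exponent `a` modulo `k`. -/
noncomputable def qv (k : ℕ) (r : ℤ) (a : ZMod k) : ℂ := (qhalf k r ^ 2) ^ a.val

lemma qv_ne_zero (k : ℕ) (r : ℤ) (a : ZMod k) : qv k r a ≠ 0 :=
  pow_ne_zero _ (pow_ne_zero _ (qhalf_ne_zero k r))

/-- Independence of the representative is q^k = 1; it makes the cyclic reading of the entries
harmless. -/
lemma qv_intCast (hk : k ≠ 0) (r : ℤ) (m : ℤ) : qv k r (m : ZMod k) = (qhalf k r ^ 2) ^ m := by
  have : NeZero k := ⟨hk⟩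
  have h0 : qhalf k r ^ 2 ≠ 0 := pow_ne_zero _ (qhalf_ne_zero k r)
  have e : (((m : ZMod k).val : ℕ) : ℤ) = m % k := ZMod.val_intCast m
  rw [qv, ← zpow_natCast, e]
  conv_rhs => rw [← Int.emod_add_mul_ediv m k]
  rw [zpow_add₀ h0, zpow_mul, zpow_natCast, qroot_pow_card hk, one_zpow, mul_one]

lemma qv_add (hk : k ≠ 0) (r : ℤ) (a b : ZMod k) : qv k r (a + b) = qv k r a * qv k r b := by
  have : NeZero k := ⟨hk⟩
  have h0 : qhalf k r ^ 2 ≠ 0 := pow_ne_zero _ (qhalf_ne_zero k r)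
  obtain ⟨a, rfl⟩ := ZMod.intCast_surjective a
  obtain ⟨b, rfl⟩ := ZMod.intCast_surjective b
  rw [← Int.cast_add, qv_intCast hk, qv_intCast hk, qv_intCast hk, zpow_add₀ h0]

lemma qv_one (hk : k ≠ 0) (r : ℤ) : qv k r 1 = qhalf k r ^ 2 := by
  simpa using qv_intCast hk r 1

lemma qv_neg_one (hk : k ≠ 0) (r : ℤ) : qv k r (-1) = (qhalf k r ^ 2)⁻¹ := by
  simpa using qv_intCast hk r (-1)

lemma qv_eq_zpow (k : ℕ) (r : ℤ) (a : ZMod k) :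
    qv k r a = qhalf k r ^ (2 * (a.val : ℤ)) := by
  rw [qv, zpow_mul, zpow_natCast]
  norm_cast

lemma qv_eq_one_iff (hk : k ≠ 0) (hr : IsCoprime r (k : ℤ)) (a : ZMod k) :
    qv k r a = 1 ↔ a = 0 := by
  obtain ⟨a, rfl⟩ := ZMod.intCast_surjective a
  rw [qv_intCast hk, qroot_zpow_eq_one_iff hk hr, ZMod.intCast_zmod_eq_zero_iff_dvd]

lemma qv_injective (hk : k ≠ 0) (hr : IsCoprime r (k : ℤ)) : Function.Injective (qv k r) := by
  intro a b hab
  rw [← sub_eq_zero, ← qv_eq_one_iff hk hr, sub_eq_add_neg]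
  have := qv_add hk r (a + -b) b
  rw [neg_add_cancel_right, hab] at this
  exact mul_right_cancel₀ (qv_ne_zero k r b) (by rw [one_mul]; exact this.symm)

end Powers

/-! ### Generic scalars -/

/-- The square of `z` is not an integral power of `q = h ^ 2`. -/
def Indep (h z : ℂ) : Prop := z ≠ 0 ∧ ∀ m : ℤ, z ^ 2 ≠ (h ^ 2) ^ m

section Indep

variable {h z : ℂ}

lemma Indep.mul_zpow (hz : Indep h z) (hh : h ≠ 0) (m : ℤ) : Indep h (z * h ^ m) := by
  have h0 : h ^ 2 ≠ 0 := pow_ne_zero _ hh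
  refine ⟨mul_ne_zero hz.1 (zpow_ne_zero _ hh), fun l hl => hz.2 (l - m) ?_⟩
  rw [zpow_sub₀ h0, ← hl, eq_div_iff (zpow_ne_zero _ h0), mul_pow]
  congr 1
  rw [← zpow_natCast, ← zpow_natCast, ← zpow_mul, ← zpow_mul, mul_comm]

lemma Indep.inv (hz : Indep h z) : Indep h z⁻¹ := by
  refine ⟨inv_ne_zero hz.1, fun m hm => hz.2 (-m) ?_⟩
  rw [zpow_neg, ← hm, inv_pow, inv_inv]

/-- A bracket vanishes only where the square of its argument is 1, and the square of z h^m is z²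
q^m. One condition thus covers all integral and half-integral shifts. -/
lemma Indep.br_ne_zero (hh : Admissible h) (hz : Indep h z) (m : ℤ) : br h (z * h ^ m) ≠ 0 := by
  have := hz.mul_zpow hh.ne_zero m
  exact UqSo.br_ne_zero hh this.1 (by simpa using this.2 0)

lemma Indep.br_ne_zero' (hh : Admissible h) (hz : Indep h z) {w : ℂ} (m : ℤ)
    (hw : w = z * h ^ m) : br h w ≠ 0 := hw ▸ hz.br_ne_zero hh m

lemma indep_qpow {k : ℕ} {r : ℤ} (hk : k ≠ 0) {x : ℂ} (hx : OffLattice r x) :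
    Indep (qhalf k r) (qpow k r x) := by
  refine ⟨qpow_ne_zero _ _ _, fun m hm => ?_⟩
  rw [qroot_zpow, sq, ← qpow_add, ← div_eq_one_iff_eq (qpow_ne_zero _ _ _), ← qpow_sub,
    qpow_eq_one_iff hk] at hm
  obtain ⟨t, ht⟩ := hm
  apply hx (k * t + r * m)
  push_cast
  linear_combination ht

end Indep

/-! ### Coordinates of tableaux -/

section Coordinates

variable {n k : ℕ}

/-- The entry of a tableau at a place given by two natural numbers. -/
def ent (ξ : Tableau n k) (s j : ℕ) : ZMod k :=
  if hs : s < n ∧ j < s / 2 then ξ ⟨s, hs.1⟩ ⟨j, hs.2⟩ else 0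

/-- The tableau with the only nonzero entry `d`, at the place `(s, j)`. -/
def ev (n k : ℕ) (s j : ℕ) (d : ZMod k) : Tableau n k :=
  fun s' j' => if (s' : ℕ) = s ∧ (j' : ℕ) = j then d else 0

/-- The unit step at the place `(s, j)` in the positive or the negative direction. -/
def step (n k : ℕ) (s j : ℕ) (b : Bool) : Tableau n k := ev n k s j (if b then 1 else -1)

lemma ent_add (ξ ζ : Tableau n k) (s j : ℕ) : ent (ξ + ζ) s j = ent ξ s j + ent ζ s j := by
  unfold ent
  split <;> simp

lemma ent_ev_self {s j : ℕ} (hs : s < n) (hj : j < s / 2) (d : ZMod k) :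
    ent (ev n k s j d) s j = d := by
  simp [ent, ev, hs, hj]

lemma ent_ev_other {s j s' j' : ℕ} (h : ¬ (s' = s ∧ j' = j)) (d : ZMod k) :
    ent (ev n k s j d) s' j' = 0 := by
  simp [ent, ev, h]

lemma ev_neg (s j : ℕ) (d : ZMod k) : ev n k s j (-d) = -ev n k s j d := by
  funext s' j'
  simp only [ev, Pi.neg_apply]
  split <;> simp

lemma step_not (s j : ℕ) (b : Bool) : step n k s j (!b) = -step n k s j b := by
  rw [step, step, ← ev_neg]
  cases b <;> simp

lemma shift_eq (ξ : Tableau n k) (s : Fin n) (j : Fin ((s : ℕ) / 2)) (d : ZMod k) :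
    ξ.shift s j d = ξ + ev n k s j d := by
  funext s' j'
  simp only [Tableau.shift, Pi.add_apply, ev]
  by_cases hs : s' = s
  · subst hs
    rw [Function.update_self]
    by_cases hj : j' = j
    · subst hj
      simp
    · have : ¬ ((j' : ℕ) = (j : ℕ)) := fun e => hj (Fin.ext e)
      simp [hj, this]
  · have : ¬ ((s' : ℕ) = (s : ℕ)) := fun e => hs (Fin.ext e)
    simp [hs, this]

lemma tableau_ext {ξ ζ : Tableau n k}
    (h : ∀ s j, s < n → j < s / 2 → ent ξ s j = ent ζ s j) : ξ = ζ := by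
  funext s j
  have := h s j s.2 j.2
  simpa [ent] using this

variable (r : ℤ) (ω : Params n)

/-- The parameter `h_{j,s}` or, in the top row, `m_{j,n}`. -/
noncomputable def base (s j : ℕ) : ℂ :=
  if hj : j < s / 2 then
    if hs : s < n then ω.h ⟨s, hs⟩ ⟨j, hj⟩
    else if hn : s = n then ω.m (Fin.cast (by rw [hn]) (⟨j, hj⟩ : Fin (s / 2))) else 0
  else 0

/-- Twice the integral or half-integral shift between an entry and its coordinate. -/
def lshift (s j : ℕ) : ℤ := 2 * ((s + 1) / 2 : ℕ) - 2 * (j + 1) - (if Even s then 0 else 1)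

/-- The multiplicative coordinate: `q ^ l` in even rows and `q ^ (l - 1/2)` in odd rows. -/
noncomputable def Y (s j : ℕ) (ξ : Tableau n k) : ℂ :=
  qpow k r (base ω s j) * qhalf k r ^ lshift s j * qv k r (ent ξ s j)

variable {r ω}

lemma Y_ne_zero (s j : ℕ) (ξ : Tableau n k) : Y r ω s j ξ ≠ 0 :=
  mul_ne_zero (mul_ne_zero (qpow_ne_zero _ _ _) (zpow_ne_zero _ (qhalf_ne_zero _ _)))
    (qv_ne_zero _ _ _)

lemma exists_Y_eq (s j : ℕ) (ξ : Tableau n k) :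
    ∃ m : ℤ, Y r ω s j ξ = qpow k r (base ω s j) * qhalf k r ^ m := by
  refine ⟨lshift s j + 2 * ((ent ξ s j).val : ℤ), ?_⟩
  rw [Y, qv_eq_zpow, mul_assoc, ← zpow_add₀ (qhalf_ne_zero k r)]

lemma Y_add_ev (hk : k ≠ 0) {s j : ℕ} (hs : s < n) (hj : j < s / 2) (ξ : Tableau n k)
    (d : ZMod k) : Y r ω s j (ξ + ev n k s j d) = Y r ω s j ξ * qv k r d := by
  rw [Y, Y, ent_add, ent_ev_self hs hj, qv_add hk, mul_assoc _ _ (qv k r d)]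

lemma Y_add_ev_other {s j s' j' : ℕ} (h : ¬ (s' = s ∧ j' = j)) (ξ : Tableau n k)
    (d : ZMod k) : Y r ω s' j' (ξ + ev n k s j d) = Y r ω s' j' ξ := by
  rw [Y, Y, ent_add, ent_ev_other h, add_zero]

lemma Y_add_step_other {s j s' j' : ℕ} (h : ¬ (s' = s ∧ j' = j)) (ξ : Tableau n k)
    (b : Bool) : Y r ω s' j' (ξ + step n k s j b) = Y r ω s' j' ξ := Y_add_ev_other h _ _

lemma sgn_Y_add_step (hk : k ≠ 0) {s j : ℕ} (hs : s < n) (hj : j < s / 2) (ξ : Tableau n k)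
    (b : Bool) : sgn b (Y r ω s j (ξ + step n k s j b)) = sgn b (Y r ω s j ξ) * qhalf k r ^ 2 := by
  rw [step, Y_add_ev hk hs hj]
  cases b
  · simp only [Bool.false_eq_true, if_false, qv_neg_one hk, sgn_false, mul_inv, inv_inv]
  · simp only [if_true, qv_one hk, sgn_true]

lemma qpow_lc {s : ℕ} (hs : s ≤ n) (j : Fin (s / 2)) (ξ : Tableau n k) :
    qpow k r (lc k ω ξ s j) = Y r ω s j ξ * qhalf k r ^ (if Even s then 0 else 1 : ℤ) := by
  have hent : entry k ω ξ s j = base ω s j + ((ent ξ s j).val : ℂ) := by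
    rcases Nat.lt_or_ge s n with h | h
    · simp [entry, base, ent, h]
    · have hsn : s = n := le_antisymm hs h
      subst hsn
      simp [entry, base, ent]
  rw [lc, lOf, hent, Y, qv_eq_zpow, qhalf_zpow, qhalf_zpow, qhalf_zpow, ← qpow_add, ← qpow_add,
    ← qpow_add, lshift]
  congr 1
  generalize (s + 1) / 2 = p
  push_cast
  ring

/-- The genericity condition on two places. -/
lemma indep_mul (hk : k ≠ 0) {ω' : Params n} {s j s' j' : ℕ}
    (h : OffLattice r (base ω s j + base ω' s' j')) (ξ ζ : Tableau n k) : Indep (qhalf k r) (Y r ω s j ξ * Y r ω' s' j' ζ) := by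
  obtain ⟨m, hm⟩ := exists_Y_eq (r := r) (ω := ω) s j ξ
  obtain ⟨m', hm'⟩ := exists_Y_eq (r := r) (ω := ω') s' j' ζ
  have := (indep_qpow hk h).mul_zpow (qhalf_ne_zero k r) (m + m')
  rw [qpow_add, zpow_add₀ (qhalf_ne_zero k r)] at this
  rw [hm, hm']
  convert this using 1
  ring

lemma indep_div (hk : k ≠ 0) {ω' : Params n} {s j s' j' : ℕ}
    (h : OffLattice r (base ω s j - base ω' s' j')) (ξ ζ : Tableau n k) :
    Indep (qhalf k r) (Y r ω s j ξ / Y r ω' s' j' ζ) := by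
  obtain ⟨m, hm⟩ := exists_Y_eq (r := r) (ω := ω) s j ξ
  obtain ⟨m', hm'⟩ := exists_Y_eq (r := r) (ω := ω') s' j' ζ
  have := (indep_qpow hk h).mul_zpow (qhalf_ne_zero k r) (m - m')
  rw [qpow_sub, zpow_sub₀ (qhalf_ne_zero k r)] at this
  rw [hm, hm']
  convert this using 1
  have := qpow_ne_zero k r (base ω' s' j')
  have := zpow_ne_zero m' (qhalf_ne_zero k r)
  field_simp

lemma indep_Y (hk : k ≠ 0) {s j : ℕ} (h : OffLattice r (base ω s j)) (ξ : Tableau n k) :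
    Indep (qhalf k r) (Y r ω s j ξ) := by
  obtain ⟨m, hm⟩ := exists_Y_eq (r := r) (ω := ω) s j ξ
  rw [hm]
  exact (indep_qpow hk h).mul_zpow (qhalf_ne_zero k r) m

lemma Params.IsGeneric.base_single (hω : ω.IsGeneric r) {s j : ℕ} (hs : s ≤ n) (hj : j < s / 2) :
    OffLattice r (base ω s j) := by
  rcases Nat.lt_or_ge s n with h | h
  · simpa [base, h, hj] using hω.row ⟨s, h⟩ ⟨j, hj⟩
  · have hsn : s = n := le_antisymm hs h
    subst hsn
    simpa [base, hj] using hω.top ⟨j, hj⟩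

lemma Params.IsGeneric.base_add (hω : ω.IsGeneric r) {s i j : ℕ} (hs : s < n) (hi : i < s / 2)
    (hj : j < s / 2) : OffLattice r (base ω s i + base ω s j) := by
  simpa [base, hs, hi, hj] using hω.row_add ⟨s, hs⟩ ⟨i, hi⟩ ⟨j, hj⟩

lemma Params.IsGeneric.base_sub (hω : ω.IsGeneric r) {s i j : ℕ} (hs : s < n) (hi : i < s / 2)
    (hj : j < s / 2) (hij : i ≠ j) : OffLattice r (base ω s i - base ω s j) := by
  simpa [base, hs, hi, hj] using hω.row_sub ⟨s, hs⟩ ⟨i, hi⟩ ⟨j, hj⟩ (by simpa using hij)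

lemma Params.IsGeneric.base_next_add (hω : ω.IsGeneric r) {s i j : ℕ} (hs : s + 1 ≤ n)
    (hi : i < s / 2) (hj : j < (s + 1) / 2) :
    OffLattice r (base ω s i + base ω (s + 1) j) := by
  have hs' : s < n := hs
  rcases Nat.lt_or_ge (s + 1) n with h | h
  · simpa [base, h, hs', hi, hj] using hω.next_add ⟨s, hs⟩ ⟨s + 1, h⟩ rfl ⟨i, hi⟩ ⟨j, hj⟩
  · have hsn : s + 1 = n := le_antisymm hs h
    subst hsn
    simpa [base, hi, hj] using hω.top_add ⟨s, hs⟩ rfl ⟨i, hi⟩ ⟨j, hj⟩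

lemma Params.IsGeneric.base_next_sub (hω : ω.IsGeneric r) {s i j : ℕ} (hs : s + 1 ≤ n)
    (hi : i < s / 2) (hj : j < (s + 1) / 2) :
    OffLattice r (base ω s i - base ω (s + 1) j) := by
  have hs' : s < n := hs
  rcases Nat.lt_or_ge (s + 1) n with h | h
  · simpa [base, h, hs', hi, hj] using hω.next_sub ⟨s, hs⟩ ⟨s + 1, h⟩ rfl ⟨i, hi⟩ ⟨j, hj⟩
  · have hsn : s + 1 = n := le_antisymm hs h
    subst hsn
    simpa [base, hi, hj] using hω.top_sub ⟨s, hs⟩ rfl ⟨i, hi⟩ ⟨j, hj⟩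

lemma OffLattice.neg {x : ℂ} (hx : OffLattice r x) : OffLattice r (-x) := by
  intro t ht
  apply hx (-t)
  push_cast
  linear_combination -ht

lemma OffLattice.sub_comm {x y : ℂ} (hx : OffLattice r (x - y)) : OffLattice r (y - x) := by
  simpa using hx.neg

end Coordinates

end UqSo

namespace UqSo

/-! ### The operators as sums of weighted shifts -/

section OperatorForm

variable {n k : ℕ} (r : ℤ) (ω : Params n)

/-- The places in the two rows adjacent to the row `s`. -/
def nbs (s : ℕ) : Finset (ℕ × ℕ) :=
  ({s + 1} ×ˢ Finset.range ((s + 1) / 2)) ∪ ({s - 1} ×ˢ Finset.range ((s - 1) / 2))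

lemma mem_nbs {s : ℕ} {c : ℕ × ℕ} :
    c ∈ nbs s ↔ (c.1 = s + 1 ∨ c.1 = s - 1) ∧ c.2 < c.1 / 2 := by
  simp only [nbs, Finset.mem_union, Finset.mem_product, Finset.mem_singleton, Finset.mem_range]
  constructor
  · rintro (⟨h1, h2⟩ | ⟨h1, h2⟩) <;> rw [h1] <;> simp [h2]
  · rintro ⟨h1 | h1, h2⟩ <;> rw [h1] at h2 ⊢ <;> simp [h2]

lemma disjoint_nbs (s : ℕ) : Disjoint (({s + 1} : Finset ℕ) ×ˢ Finset.range ((s + 1) / 2))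
    ({s - 1} ×ˢ Finset.range ((s - 1) / 2)) := by
  rw [Finset.disjoint_left]
  rintro ⟨a, b⟩ h1 h2
  simp only [Finset.mem_product, Finset.mem_singleton] at h1 h2
  omega

lemma prod_nbs (s : ℕ) (f : ℕ × ℕ → ℂ) :
    ∏ c ∈ nbs s, f c = (∏ i : Fin ((s + 1) / 2), f (s + 1, i))
      * ∏ i : Fin ((s - 1) / 2), f (s - 1, i) := by
  rw [nbs, Finset.prod_union (disjoint_nbs s), Finset.prod_product, Finset.prod_product,
    Finset.prod_singleton, Finset.prod_singleton, Finset.prod_range, Finset.prod_range]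

lemma card_nbs {s : ℕ} (hs : 1 ≤ s) : (nbs s).card = s - 1 + s % 2 := by
  rw [nbs, Finset.card_union_of_disjoint (disjoint_nbs s), Finset.card_product,
    Finset.card_product]
  simp only [Finset.card_singleton, Finset.card_range, one_mul]
  omega

/-- The radicand with the moving coordinate `u`. -/
noncomputable def radU (s : ℕ) (j : Fin (s / 2)) (ξ : Tableau n k) (u : ℂ) : ℂ :=
  (∏ c ∈ nbs s, gg (qhalf k r) (Y r ω c.1 c.2 ξ) u)
    / ∏ i ∈ Finset.univ.erase j, dd (qhalf k r) (Y r ω s i ξ) u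

/-- The factor of the matrix elements that depends on the moving coordinate only. -/
noncomputable def wt (h : ℂ) (s : ℕ) (y : ℂ) : ℂ :=
  if Even s then (y + y⁻¹)⁻¹ else (br h (y ^ 2) * br h (y * h))⁻¹

/-- The square root attached to a move. -/
def hop (R : Roots n k) (s : Fin n) (α : Fin ((s : ℕ) / 2) × Bool) (ξ : Tableau n k) : ℂ :=
  if α.2 then R s α.1 ξ else R s α.1 (ξ + step n k s α.1 false)

/-- The constant factor attached to a move. -/
noncomputable def cst (ω : Params n) (s : Fin n) (α : Fin ((s : ℕ) / 2) × Bool) : ℂ :=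
  if α.2 then ω.c s α.1 else -(ω.c s α.1)⁻¹

/-- The matrix element of a move. -/
noncomputable def coef (R : Roots n k) (s : Fin n) (α : Fin ((s : ℕ) / 2) × Bool)
    (ξ : Tableau n k) : ℂ :=
  cst ω s α * hop R s α ξ * wt (qhalf k r) s (sgn α.2 (Y r ω s α.1 ξ))

/-- The diagonal matrix element. -/
noncomputable def dcoef (s : Fin n) (ξ : Tableau n k) : ℂ :=
  if Even (s : ℕ) then 0
  else Complex.I * ((∏ c ∈ nbs s, br (qhalf k r) (Y r ω c.1 c.2 ξ))
    / ∏ i : Fin ((s : ℕ) / 2), (br (qhalf k r) (Y r ω s i ξ * qhalf k r)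
      * br (qhalf k r) (Y r ω s i ξ / qhalf k r)))

variable {r ω}

lemma qnum_lc_mul_even {s : ℕ} (hs : s ≤ n) (h : Even s) (j : Fin (s / 2)) (ξ : Tableau n k) :
    qpow k r (lc k ω ξ s j) = Y r ω s j ξ := by
  rw [qpow_lc hs, if_pos h, zpow_zero, mul_one]

lemma qpow_lc_odd {s : ℕ} (hs : s ≤ n) (h : ¬ Even s) (j : Fin (s / 2)) (ξ : Tableau n k) :
    qpow k r (lc k ω ξ s j) = Y r ω s j ξ * qhalf k r := by
  rw [qpow_lc hs, if_neg h, zpow_one]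

lemma qpow_one_eq (k : ℕ) (r : ℤ) : qpow k r 1 = qhalf k r ^ 2 := by
  rw [qhalf_sq, qroot]

/-- In the coordinates `Y` the neighbours lie in odd rows and carry the half shift, which turns the
brackets of A into the symmetric form `gg`. -/
lemma radA_eq (s : Fin n) (hs : Even (s : ℕ)) (j : Fin ((s : ℕ) / 2)) (ξ : Tableau n k) :
    radA k r ω s j ξ = radU r ω s j ξ (Y r ω s j ξ) := by
  have hs0 : 1 ≤ (s : ℕ) := by have := j.2; omega
  have hs1 : ¬ Even ((s : ℕ) + 1) := by rw [Nat.even_add_one]; simpa using hs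
  have hs2 : ¬ Even ((s : ℕ) - 1) := by rw [Nat.even_sub hs0]; simp [hs]
  have hsn : (s : ℕ) < n := s.2
  have hu := Y_ne_zero (r := r) (ω := ω) s j ξ
  have h0 := qhalf_ne_zero k r
  have e : ∀ (a : ℂ), br (qhalf k r) (a * qhalf k r * Y r ω s j ξ)
      * br (qhalf k r) (a * qhalf k r / Y r ω s j ξ / qhalf k r ^ 2)
      = gg (qhalf k r) a (Y r ω s j ξ) := by
    intro a
    rw [gg]
    congr 2
    · ring
    · field_simp
  rw [radA, radU, prod_nbs]
  simp only [qnum_eq_br, qpow_add, qpow_sub, qpow_one_eq, qnum_lc_mul_even hsn.le hs,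
    qpow_lc_odd (show (s : ℕ) + 1 ≤ n from hsn) hs1,
    qpow_lc_odd (show (s : ℕ) - 1 ≤ n by omega) hs2, e]
  congr 1
  refine Finset.prod_congr rfl fun i _ => ?_
  rw [dd]
  congr 2
  field_simp

/-- Here the moving row itself carries the half shift; the outcome is the same expression as for
even rows. -/
lemma radB_eq (s : Fin n) (hs : ¬ Even (s : ℕ)) (j : Fin ((s : ℕ) / 2)) (ξ : Tableau n k) :
    radB k r ω s j ξ = radU r ω s j ξ (Y r ω s j ξ) := by
  have hs0 : 1 ≤ (s : ℕ) := by have := j.2; omega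
  have hs1 : Even ((s : ℕ) + 1) := by rw [Nat.even_add_one]; exact hs
  have hs2 : Even ((s : ℕ) - 1) := by rw [Nat.even_sub hs0]; simp [hs]
  have hsn : (s : ℕ) < n := s.2
  have hu := Y_ne_zero (r := r) (ω := ω) s j ξ
  have h0 := qhalf_ne_zero k r
  have e : ∀ (a : ℂ), br (qhalf k r) (a * (Y r ω s j ξ * qhalf k r))
      * br (qhalf k r) (a / (Y r ω s j ξ * qhalf k r))
      = gg (qhalf k r) a (Y r ω s j ξ) := by
    intro a
    rw [gg, mul_assoc]
  rw [radB, radU, prod_nbs]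
  simp only [qnum_eq_br, qpow_add, qpow_sub, qpow_one_eq, qpow_lc_odd hsn.le hs,
    qnum_lc_mul_even (show (s : ℕ) + 1 ≤ n from hsn) hs1,
    qnum_lc_mul_even (show (s : ℕ) - 1 ≤ n by omega) hs2, e]
  congr 1
  refine Finset.prod_congr rfl fun i _ => ?_
  have e1 : Y r ω s i ξ * qhalf k r * (Y r ω s j ξ * qhalf k r)
      = Y r ω s i ξ * Y r ω s j ξ * qhalf k r ^ 2 := by ring
  rw [← e, dd, e1, mul_div_mul_right _ _ h0, mul_div_cancel_right₀ _ (pow_ne_zero 2 h0), div_div]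
  ring

lemma isRootChoice_iff (R : Roots n k) : IsRootChoice k r ω R ↔
    ∀ (s : Fin n) (j : Fin ((s : ℕ) / 2)) (ξ : Tableau n k),
      R s j ξ ^ 2 = radU r ω s j ξ (Y r ω s j ξ) := by
  refine forall_congr' fun s => forall_congr' fun j => forall_congr' fun ξ => ?_
  split_ifs with hs
  · rw [radA_eq s hs]
  · rw [radB_eq s hs]

lemma coefC_eq (s : Fin n) (hs0 : 1 ≤ (s : ℕ)) (hs : ¬ Even (s : ℕ)) (ξ : Tableau n k) :
    Complex.I * coefC k r ω s ξ = dcoef r ω s ξ := by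
  have hs1 : Even ((s : ℕ) + 1) := by rw [Nat.even_add_one]; exact hs
  have hs2 : Even ((s : ℕ) - 1) := by rw [Nat.even_sub hs0]; simp [hs]
  have hsn : (s : ℕ) < n := s.2
  have h0 := qhalf_ne_zero k r
  rw [dcoef, if_neg hs, coefC, prod_nbs]
  simp only [qnum_eq_br, qpow_sub, qpow_one_eq, qpow_lc_odd hsn.le hs,
    qnum_lc_mul_even (show (s : ℕ) + 1 ≤ n from hsn) hs1,
    qnum_lc_mul_even (show (s : ℕ) - 1 ≤ n by omega) hs2]
  congr 2
  refine Finset.prod_congr rfl fun i _ => ?_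
  congr 2
  field_simp

/-- The two sums of the definition become one sum over places and directions: replacing y by y⁻¹
leaves y + y⁻¹ fixed and carries [2l-1][l] into [2l-1][l-1]. -/
lemma op_eq (R : Roots n k) (s : Fin n) (hs0 : 1 ≤ (s : ℕ)) :
    op k r ω R s = ∑ α : Fin ((s : ℕ) / 2) × Bool, wshift (coef r ω R s α) (step n k s α.1 α.2)
      + wshift (dcoef r ω s) 0 := by
  have h0 := qhalf_ne_zero k r
  refine end_ext fun ξ => ?_
  have hsn : (s : ℕ) < n := s.2
  simp only [op, Finsupp.linearCombination_single, one_smul, LinearMap.add_apply,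
    LinearMap.coe_sum, Finset.sum_apply, wshift_single, add_zero]
  rw [Fintype.sum_prod_type]
  simp only [Fintype.sum_bool, Finset.sum_add_distrib]
  split_ifs with hs
  · rw [actEven, dcoef, if_pos hs, zero_smul, add_zero, sub_eq_add_neg, ← Finset.sum_neg_distrib]
    simp only [shift_eq, ket, qpow_neg, qnum_lc_mul_even hsn.le hs]
    congr 1
    · refine Finset.sum_congr rfl fun j _ => ?_
      rw [coef, cst, hop, wt, if_pos hs]
      simp only [if_true, sgn_true, step]
      congr 1
      ring
    · refine Finset.sum_congr rfl fun j _ => ?_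
      rw [coef, cst, hop, wt, if_pos hs, ← neg_smul]
      simp only [Bool.false_eq_true, if_false, sgn_false, step, inv_inv]
      congr 1
      rw [add_comm (Y r ω s j ξ)⁻¹]
      ring
  · rw [actOdd, coefC_eq s hs0 hs, sub_eq_add_neg, ← Finset.sum_neg_distrib]
    simp only [shift_eq, ket, qnum_eq_br, qpow_sub, two_mul, qpow_add, qpow_one_eq,
      qpow_lc_odd hsn.le hs]
    congr 2
    · refine Finset.sum_congr rfl fun j _ => ?_
      rw [coef, cst, hop, wt, if_neg hs]
      simp only [if_true, sgn_true, step]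
      congr 1
      rw [show Y r ω s j ξ * qhalf k r * (Y r ω s j ξ * qhalf k r) / qhalf k r ^ 2
        = Y r ω s j ξ ^ 2 by field_simp]
      ring
    · refine Finset.sum_congr rfl fun j _ => ?_
      rw [coef, cst, hop, wt, if_neg hs, ← neg_smul]
      simp only [Bool.false_eq_true, if_false, sgn_false, step]
      congr 1
      have hu := Y_ne_zero (r := r) (ω := ω) s j ξ
      rw [show Y r ω s j ξ * qhalf k r * (Y r ω s j ξ * qhalf k r) / qhalf k r ^ 2
        = Y r ω s j ξ ^ 2 by field_simp,
        show Y r ω s j ξ * qhalf k r / qhalf k r ^ 2 = Y r ω s j ξ / qhalf k r by field_simp,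
        show (Y r ω s j ξ)⁻¹ * qhalf k r = (Y r ω s j ξ / qhalf k r)⁻¹ by field_simp,
        inv_pow, br_inv, br_inv, neg_mul_neg]
      ring

/-- With u = q^y this is the symmetry of [x+y+1/2][x-y-1/2] under y ↦ -1-y. It identifies the
radicand at the lower end of a backward move with the radicand at the inverted coordinate. -/
lemma gg_div_sq {h v u : ℂ} (hh : h ≠ 0) (hu : u ≠ 0) :
    gg h v (u * (h ^ 2)⁻¹) = gg h v u⁻¹ := by
  rw [gg, gg, mul_comm (br h _)]
  congr 2 <;> field_simp

lemma dd_div_sq {h v u : ℂ} (hh : h ≠ 0) (hu : u ≠ 0) :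
    dd h v (u * (h ^ 2)⁻¹) = dd h v u⁻¹ := by
  have e1 : v * (u * (h ^ 2)⁻¹) = v / (u⁻¹ * h ^ 2) := by field_simp
  have e2 : v / (u * (h ^ 2)⁻¹) = v * u⁻¹ * h ^ 2 := by field_simp
  have e3 : v * (u * (h ^ 2)⁻¹) * h ^ 2 = v / u⁻¹ := by field_simp
  have e4 : v / (u * (h ^ 2)⁻¹ * h ^ 2) = v * u⁻¹ := by field_simp
  rw [dd, dd, e3, e4, e1, e2]
  ring

lemma radU_congr {s : ℕ} {j : Fin (s / 2)} {ξ ζ : Tableau n k} {u : ℂ}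
    (h1 : ∀ c ∈ nbs s, Y r ω c.1 c.2 ξ = Y r ω c.1 c.2 ζ)
    (h2 : ∀ i : Fin (s / 2), i ≠ j → Y r ω s i ξ = Y r ω s i ζ) :
    radU r ω s j ξ u = radU r ω s j ζ u := by
  rw [radU, radU]
  congr 1
  · exact Finset.prod_congr rfl fun c hc => by rw [h1 c hc]
  · exact Finset.prod_congr rfl fun i hi => by rw [h2 i (Finset.ne_of_mem_erase hi)]

/-- The squares of the square roots, in both directions. -/
lemma hop_sq (hk : k ≠ 0) {R : Roots n k} (hR : IsRootChoice k r ω R) (s : Fin n)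
    (α : Fin ((s : ℕ) / 2) × Bool) (ξ : Tableau n k) :
    hop R s α ξ ^ 2 = radU r ω s α.1 ξ (sgn α.2 (Y r ω s α.1 ξ)) := by
  rw [isRootChoice_iff] at hR
  obtain ⟨j, b⟩ := α
  have hu := Y_ne_zero (r := r) (ω := ω) s j ξ
  cases b
  · simp only [hop, Bool.false_eq_true, if_false, hR, sgn_false]
    rw [step, if_neg Bool.false_ne_true, Y_add_ev hk s.2 j.2, qv_neg_one hk, ← radU_congr (ξ := ξ)]
    · simp only [radU, gg_div_sq (qhalf_ne_zero k r) hu, dd_div_sq (qhalf_ne_zero k r) hu]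
    · intro c hc
      refine (Y_add_ev_other ?_ _ _).symm
      rw [mem_nbs] at hc
      have := j.2
      omega
    · intro i hi
      refine (Y_add_ev_other ?_ _ _).symm
      exact fun e => hi (Fin.ext e.2)
  · simp only [hop, if_true, hR, sgn_true]

/-- One square root belongs to each edge, whatever its direction. Round trips therefore see only its
square and do not depend on its sign. -/
lemma hop_back {R : Roots n k} (s : Fin n) (α : Fin ((s : ℕ) / 2) × Bool) (ξ : Tableau n k) :
    hop R s (α.1, !α.2) (ξ + step n k s α.1 α.2) = hop R s α ξ := by
  obtain ⟨j, b⟩ := α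
  cases b
  · simp [hop]
  · simp only [hop, Bool.not_true, Bool.false_eq_true, if_false, if_true]
    rw [add_assoc, ← Bool.not_true, step_not, add_neg_cancel, add_zero]

/-- The parameters c drop out of all round trips. -/
lemma cst_mul_cst (hω : ω.IsGeneric r) (s : Fin n) (α : Fin ((s : ℕ) / 2) × Bool) :
    cst ω s α * cst ω s (α.1, !α.2) = -1 := by
  obtain ⟨j, b⟩ := α
  have := hω.c_ne_zero s j
  cases b <;> simp [cst, this]

/-- The product of the matrix elements of a move and of its reverse. -/
lemma coef_mul_coef_back (hk : k ≠ 0) (hω : ω.IsGeneric r) {R : Roots n k}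
    (hR : IsRootChoice k r ω R) (s : Fin n) (α : Fin ((s : ℕ) / 2) × Bool) (ξ : Tableau n k) :
    coef r ω R s α ξ * coef r ω R s (α.1, !α.2) (ξ + step n k s α.1 α.2)
      = -(radU r ω s α.1 ξ (sgn α.2 (Y r ω s α.1 ξ))
        * (wt (qhalf k r) s (sgn α.2 (Y r ω s α.1 ξ))
          * wt (qhalf k r) s (sgn α.2 (Y r ω s α.1 ξ) * qhalf k r ^ 2)⁻¹)) := by
  rw [coef, coef, hop_back, ← hop_sq hk hR, sgn_not, sgn_Y_add_step hk s.2 α.1.2]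
  linear_combination (hop R s α ξ ^ 2 * wt (qhalf k r) s (sgn α.2 (Y r ω s α.1 ξ))
          * wt (qhalf k r) s (sgn α.2 (Y r ω s α.1 ξ) * qhalf k r ^ 2)⁻¹)
            * cst_mul_cst hω s α

end OperatorForm

end UqSo

namespace UqSo

/-! ### A consistent choice of the square roots -/

section Roots

/-- A square root of the bracket. -/
noncomputable def sb (h z : ℂ) : ℂ := br h z ^ ((2 : ℂ)⁻¹)

lemma sb_mul_self (h z : ℂ) : sb h z * sb h z = br h z := by
  rw [← sq, sb]
  exact_mod_cast Complex.cpow_nat_inv_pow (br h z) two_ne_zero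

lemma sb_sq (h z : ℂ) : sb h z ^ 2 = br h z := by rw [sq, sb_mul_self]

/-- A square root of `gg h v u`, for a coordinate `v` in the row above or below. -/
noncomputable def gs (h : ℂ) (up : Bool) (v u : ℂ) : ℂ :=
  if up then sb h (v * u * h) * sb h (v / (u * h))
  else Complex.I * (sb h (v * u * h) * sb h (u * h / v))

/-- A square root of `dd h v u`, for a coordinate `v` in the same row. -/
noncomputable def ds (h : ℂ) (lt : Bool) (v u : ℂ) : ℂ :=
  if lt then sb h (v * u) * sb h (v * u * h ^ 2) * (sb h (v / u) * sb h (v / (u * h ^ 2)))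
  else sb h (v * u) * sb h (v * u * h ^ 2) * (sb h (u / v) * sb h (u * h ^ 2 / v))

/-- The coordinate at the lower end of a move. -/
noncomputable def mv (h : ℂ) (b : Bool) (u : ℂ) : ℂ := if b then u else u * (h ^ 2)⁻¹

/-- The coordinate after a move. -/
noncomputable def stp (h : ℂ) (b : Bool) (u : ℂ) : ℂ := if b then u * h ^ 2 else u * (h ^ 2)⁻¹

lemma gs_sq (h : ℂ) (up : Bool) (v u : ℂ) : gs h up v u ^ 2 = gg h v u := by
  cases up
  · simp only [gs, gg, Bool.false_eq_true, if_false, mul_pow, sb_sq, Complex.I_sq]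
    rw [← inv_div v, br_inv]
    ring
  · simp only [gs, gg, if_true, mul_pow, sb_sq]

lemma ds_sq (h : ℂ) (lt : Bool) (v u : ℂ) : ds h lt v u ^ 2 = dd h v u := by
  cases lt
  · simp only [ds, dd, Bool.false_eq_true, if_false, mul_pow, sb_sq]
    rw [← inv_div v, ← inv_div v, br_inv, br_inv]
    ring
  · simp only [ds, dd, if_true, mul_pow, sb_sq]
    ring

lemma br_of_mul_eq_one {h z w : ℂ} (hzw : z * w = 1) : br h z = -br h w := by
  rw [← br_inv, eq_inv_of_mul_eq_one_left hzw]

/-- In `ds` the ratio is always y over x, whichever of the two moves. Hence the same square roots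
occur on both sides and pair up to genuine brackets; no sign is left undetermined. -/
lemma ds_exchange {h : ℂ} (hh : h ≠ 0) {x y : ℂ} (hx : x ≠ 0) (hy : y ≠ 0) (b b' : Bool) :
    ds h false x (mv h b' y) * ds h true (stp h b' y) (mv h b x)
        * br h (sgn b x / sgn b' y * h ^ 2)
      = ds h true y (mv h b x) * ds h false (stp h b x) (mv h b' y)
        * br h (sgn b x / (sgn b' y * h ^ 2)) := by
  cases b <;> cases b' <;> simp only [ds, mv, stp, sgn, Bool.false_eq_true, if_false, if_true]
  all_goals simp only [← sb_mul_self]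
  all_goals field_simp
  all_goals simp only [sb_sq]
  · rw [br_of_mul_eq_one (show h ^ 2 / (x * y) * (x * y / h ^ 2) = 1 by field_simp),
      br_of_mul_eq_one (show 1 / (x * y * h ^ 2) * (x * y * h ^ 2) = 1 by field_simp)]
    ring
  · rw [br_of_mul_eq_one (show x * h ^ 2 / y * (y / (x * h ^ 2)) = 1 by field_simp),
      br_of_mul_eq_one (show x / (y * h ^ 2) * (y * h ^ 2 / x) = 1 by field_simp)]
    ring

/-- The analogue for adjacent rows: the ratio is always upper over lower coordinate. The factor i in
`gs` makes up for the sign of the bracket whose ratio is inverted. -/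
lemma gs_exchange {h : ℂ} (hh : h ≠ 0) {u v : ℂ} (hu : u ≠ 0) (hv : v ≠ 0) (b b' : Bool) :
    gs h false (stp h b u) (mv h b' v) * gs h true v (mv h b u)
        * br h (sgn b' v / sgn b u * h)
      = gs h true (stp h b' v) (mv h b u) * gs h false u (mv h b' v)
        * br h (sgn b' v / (sgn b u * h)) := by
  cases b <;> cases b' <;> simp only [gs, mv, stp, sgn, Bool.false_eq_true, if_false, if_true]
  all_goals simp only [← sb_mul_self]
  all_goals field_simp
  all_goals simp only [sb_sq]
  · rw [br_of_mul_eq_one (show u * h / v * (v / (u * h)) = 1 by field_simp),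
      br_of_mul_eq_one (show u / (h * v) * (h * v / u) = 1 by field_simp)]
    ring
  · rw [br_of_mul_eq_one (show h / (u * v) * (u * v / h) = 1 by field_simp),
      br_of_mul_eq_one (show 1 / (u * h * v) * (u * h * v) = 1 by field_simp)]
    ring

lemma prod_mul_swap {κ : Type*} [DecidableEq κ] {s : Finset κ} {f g : κ → ℂ} {i : κ}
    (hi : i ∈ s) (h : ∀ c ∈ s, c ≠ i → f c = g c) :
    (∏ c ∈ s, f c) * g i = (∏ c ∈ s, g c) * f i := by
  rw [← Finset.mul_prod_erase s f hi, ← Finset.mul_prod_erase s g hi,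
    Finset.prod_congr rfl fun c hc => h c (Finset.mem_of_mem_erase hc) (Finset.ne_of_mem_erase hc)]
  ring

variable {n k : ℕ} {r : ℤ} {ω : Params n}

lemma indep_nbs_mul (hk : k ≠ 0) (hω : ω.IsGeneric r) {s j : ℕ} (hs : s < n) (hj : j < s / 2)
    {c : ℕ × ℕ} (hc : c ∈ nbs s) (ξ ζ : Tableau n k) :
    Indep (qhalf k r) (Y r ω c.1 c.2 ξ * Y r ω s j ζ) := by
  rw [mem_nbs] at hc
  obtain ⟨c1, c2⟩ := c
  obtain ⟨h1 | h1, h2⟩ := hc <;> simp only at h1 h2 ⊢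
  · subst h1
    rw [mul_comm]
    exact indep_mul hk (hω.base_next_add hs hj h2) _ _
  · obtain rfl : s = c1 + 1 := by omega
    exact indep_mul hk (hω.base_next_add hs.le h2 hj) _ _

lemma indep_nbs_div (hk : k ≠ 0) (hω : ω.IsGeneric r) {s j : ℕ} (hs : s < n) (hj : j < s / 2)
    {c : ℕ × ℕ} (hc : c ∈ nbs s) (ξ ζ : Tableau n k) :
    Indep (qhalf k r) (Y r ω c.1 c.2 ξ / Y r ω s j ζ) := by
  rw [mem_nbs] at hc
  obtain ⟨c1, c2⟩ := c
  obtain ⟨h1 | h1, h2⟩ := hc <;> simp only at h1 h2 ⊢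
  · subst h1
    exact indep_div hk (hω.base_next_sub hs hj h2).sub_comm _ _
  · obtain rfl : s = c1 + 1 := by omega
    exact indep_div hk (hω.base_next_sub hs.le h2 hj) _ _

lemma gg_ne_zero {h v u : ℂ} (hh : Admissible h) (h1 : Indep h (v * u)) (h2 : Indep h (v / u)) :
    gg h v u ≠ 0 := by
  have h0 := hh.ne_zero
  refine mul_ne_zero (h1.br_ne_zero' hh 1 (by simp)) (h2.br_ne_zero' hh (-1) ?_)
  rw [zpow_neg, zpow_one, ← div_div, div_eq_mul_inv (v / u)]

lemma dd_ne_zero {h v u : ℂ} (hh : Admissible h) (h1 : Indep h (v * u)) (h2 : Indep h (v / u)) :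
    dd h v u ≠ 0 := by
  have h0 := hh.ne_zero
  refine mul_ne_zero (mul_ne_zero (mul_ne_zero (h1.br_ne_zero' hh 0 (by simp))
    (h2.br_ne_zero' hh 0 (by simp))) (h1.br_ne_zero' hh 2 ?_)) (h2.br_ne_zero' hh (-2) ?_)
  · norm_cast
  · rw [zpow_neg, ← div_div, div_eq_mul_inv (v / u)]
    norm_cast

lemma gg_Y_ne_zero (hh : Admissible (qhalf k r)) (hk : k ≠ 0) (hω : ω.IsGeneric r) {s j : ℕ}
    (hs : s < n) (hj : j < s / 2) {c : ℕ × ℕ} (hc : c ∈ nbs s) (ξ ζ : Tableau n k) :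
    gg (qhalf k r) (Y r ω c.1 c.2 ξ) (Y r ω s j ζ) ≠ 0 :=
  gg_ne_zero hh (indep_nbs_mul hk hω hs hj hc _ _) (indep_nbs_div hk hω hs hj hc _ _)

lemma dd_Y_ne_zero (hh : Admissible (qhalf k r)) (hk : k ≠ 0) (hω : ω.IsGeneric r) {s i j : ℕ}
    (hs : s < n) (hi : i < s / 2) (hj : j < s / 2) (hij : i ≠ j) (ξ ζ : Tableau n k) :
    dd (qhalf k r) (Y r ω s i ξ) (Y r ω s j ζ) ≠ 0 :=
  dd_ne_zero hh (indep_mul hk (hω.base_add hs hi hj) _ _)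
    (indep_div hk (hω.base_sub hs hi hj hij) _ _)

variable (r ω)

/-- The product of square roots that defines the standard choice, with moving coordinate `u`. -/
noncomputable def rootU (s : ℕ) (j : Fin (s / 2)) (ξ : Tableau n k) (u : ℂ) : ℂ :=
  (∏ c ∈ nbs s, gs (qhalf k r) (decide (s < c.1)) (Y r ω c.1 c.2 ξ) u)
    / ∏ i ∈ Finset.univ.erase j, ds (qhalf k r) (decide (j < i)) (Y r ω s i ξ) u

/-- The standard choice of the square roots. -/
noncomputable def stdRoots : Roots n k := fun s j ξ => rootU r ω s j ξ (Y r ω s j ξ)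

variable {r ω}

lemma stdRoots_isRootChoice : IsRootChoice k r ω (stdRoots r ω) := by
  rw [isRootChoice_iff]
  intro s j ξ
  simp only [stdRoots, rootU, radU, div_pow, ← Finset.prod_pow, gs_sq, ds_sq]

/-! ### The effect of a unit step on the standard square roots -/

lemma Y_add_step (hk : k ≠ 0) {s j : ℕ} (hs : s < n) (hj : j < s / 2) (ξ : Tableau n k)
    (b : Bool) : Y r ω s j (ξ + step n k s j b) = stp (qhalf k r) b (Y r ω s j ξ) := by
  rw [step, Y_add_ev hk hs hj]
  cases b
  · simp only [stp, Bool.false_eq_true, if_false, qv_neg_one hk]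
  · simp only [stp, if_true, qv_one hk]

/-- The lower end of a move is the coordinate of an actual tableau, so the nonvanishing lemmas for
`Y` apply to it. -/
lemma exists_mv_eq (hk : k ≠ 0) {s j : ℕ} (hs : s < n) (hj : j < s / 2) (ξ : Tableau n k)
    (b : Bool) : ∃ ζ : Tableau n k, mv (qhalf k r) b (Y r ω s j ξ) = Y r ω s j ζ := by
  cases b
  · exact ⟨ξ + step n k s j false, by rw [Y_add_step hk hs hj]; rfl⟩
  · exact ⟨ξ, rfl⟩

lemma rootU_congr {s : ℕ} {j : Fin (s / 2)} {ξ ζ : Tableau n k} {u : ℂ}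
    (h1 : ∀ c ∈ nbs s, Y r ω c.1 c.2 ξ = Y r ω c.1 c.2 ζ)
    (h2 : ∀ i : Fin (s / 2), i ≠ j → Y r ω s i ξ = Y r ω s i ζ) :
    rootU r ω s j ξ u = rootU r ω s j ζ u := by
  rw [rootU, rootU]
  congr 1
  · exact Finset.prod_congr rfl fun c hc => by rw [h1 c hc]
  · exact Finset.prod_congr rfl fun i hi => by rw [h2 i (Finset.ne_of_mem_erase hi)]

lemma hop_stdRoots (hk : k ≠ 0) (s : Fin n) (α : Fin ((s : ℕ) / 2) × Bool) (ξ : Tableau n k) :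
    hop (stdRoots r ω) s α ξ = rootU r ω s α.1 ξ (mv (qhalf k r) α.2 (Y r ω s α.1 ξ)) := by
  obtain ⟨j, b⟩ := α
  cases b
  · simp only [hop, stdRoots, Bool.false_eq_true, if_false]
    rw [Y_add_step hk s.2 j.2, ← rootU_congr (ξ := ξ)]
    · rfl
    · intro c hc
      refine (Y_add_step_other ?_ _ _).symm
      rw [mem_nbs] at hc
      have := j.2
      omega
    · intro i hi
      exact (Y_add_step_other (fun e => hi (Fin.ext e.2)) _ _).symm
  · rfl

/-- Only the factor attached to c feels the step; the cross-multiplied form avoids dividing by it.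
-/
lemma hop_add_nbs (hk : k ≠ 0) (s : Fin n) (α : Fin ((s : ℕ) / 2) × Bool) {c : ℕ × ℕ}
    (hc : c ∈ nbs s) (b : Bool) (ξ : Tableau n k) :
    hop (stdRoots r ω) s α (ξ + step n k c.1 c.2 b)
        * gs (qhalf k r) (decide ((s : ℕ) < c.1)) (Y r ω c.1 c.2 ξ)
          (mv (qhalf k r) α.2 (Y r ω s α.1 ξ))
      = hop (stdRoots r ω) s α ξ
        * gs (qhalf k r) (decide ((s : ℕ) < c.1)) (Y r ω c.1 c.2 (ξ + step n k c.1 c.2 b))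
          (mv (qhalf k r) α.2 (Y r ω s α.1 ξ)) := by
  have hc' := mem_nbs.mp hc
  have hs : ∀ i : Fin ((s : ℕ) / 2), ¬ ((s : ℕ) = c.1 ∧ (i : ℕ) = c.2) := by
    intro i; have := i.2; omega
  rw [hop_stdRoots hk, hop_stdRoots hk, Y_add_step_other (hs _), rootU, rootU, div_mul_eq_mul_div,
    div_mul_eq_mul_div]
  congr 1
  · refine prod_mul_swap (f := fun d : ℕ × ℕ => gs (qhalf k r) (decide ((s : ℕ) < d.1))
      (Y r ω d.1 d.2 (ξ + step n k c.1 c.2 b)) (mv (qhalf k r) α.2 (Y r ω s α.1 ξ)))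
      (g := fun d : ℕ × ℕ => gs (qhalf k r) (decide ((s : ℕ) < d.1))
      (Y r ω d.1 d.2 ξ) (mv (qhalf k r) α.2 (Y r ω s α.1 ξ))) hc fun d hd hdc => ?_
    rw [Y_add_step_other]
    exact fun e => hdc (Prod.ext e.1 e.2)
  · exact Finset.prod_congr rfl fun i _ => by rw [Y_add_step_other (hs _)]

lemma hop_add_same (hh : Admissible (qhalf k r)) (hk : k ≠ 0) (hω : ω.IsGeneric r) (s : Fin n)
    (α : Fin ((s : ℕ) / 2) × Bool) (i : Fin ((s : ℕ) / 2)) (hi : i ≠ α.1) (b : Bool)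
    (ξ : Tableau n k) :
    hop (stdRoots r ω) s α (ξ + step n k s i b)
        * ds (qhalf k r) (decide (α.1 < i)) (Y r ω s i (ξ + step n k s i b))
          (mv (qhalf k r) α.2 (Y r ω s α.1 ξ))
      = hop (stdRoots r ω) s α ξ
        * ds (qhalf k r) (decide (α.1 < i)) (Y r ω s i ξ)
          (mv (qhalf k r) α.2 (Y r ω s α.1 ξ)) := by
  obtain ⟨ζ, hζ⟩ := exists_mv_eq (r := r) (ω := ω) hk s.2 α.1.2 ξ α.2
  have hne : ∀ ξ' : Tableau n k, ∏ i' ∈ Finset.univ.erase α.1,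
      ds (qhalf k r) (decide (α.1 < i')) (Y r ω s i' ξ') (mv (qhalf k r) α.2 (Y r ω s α.1 ξ))
        ≠ 0 := by
    intro ξ'
    rw [Finset.prod_ne_zero_iff]
    intro i' hi'
    rw [hζ, ← pow_ne_zero_iff two_ne_zero, ds_sq]
    exact dd_Y_ne_zero hh hk hω s.2 i'.2 α.1.2
      (fun e => Finset.ne_of_mem_erase hi' (Fin.ext e)) _ _
  rw [hop_stdRoots hk, hop_stdRoots hk, Y_add_step_other (fun e => hi (Fin.ext e.2).symm),
    rootU, rootU, div_mul_eq_mul_div, div_mul_eq_mul_div, div_eq_div_iff (hne _) (hne _)]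
  have h1 : ∏ c ∈ nbs s, gs (qhalf k r) (decide ((s : ℕ) < c.1))
      (Y r ω c.1 c.2 (ξ + step n k s i b)) (mv (qhalf k r) α.2 (Y r ω s α.1 ξ))
      = ∏ c ∈ nbs s, gs (qhalf k r) (decide ((s : ℕ) < c.1))
      (Y r ω c.1 c.2 ξ) (mv (qhalf k r) α.2 (Y r ω s α.1 ξ)) := by
    refine Finset.prod_congr rfl fun c hc => ?_
    rw [Y_add_step_other]
    rw [mem_nbs] at hc
    have := i.2
    omega
  have h2 := prod_mul_swap (s := Finset.univ.erase α.1) (i := i)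
    (f := fun i' => ds (qhalf k r) (decide (α.1 < i')) (Y r ω s i' ξ)
      (mv (qhalf k r) α.2 (Y r ω s α.1 ξ)))
    (g := fun i' => ds (qhalf k r) (decide (α.1 < i')) (Y r ω s i' (ξ + step n k s i b))
      (mv (qhalf k r) α.2 (Y r ω s α.1 ξ)))
    (by simp [hi]) (fun c _ hc => by rw [Y_add_step_other fun e => hc (Fin.ext e.2)])
  rw [h1]
  linear_combination (∏ c ∈ nbs s, gs (qhalf k r) (decide ((s : ℕ) < c.1))
      (Y r ω c.1 c.2 ξ) (mv (qhalf k r) α.2 (Y r ω s α.1 ξ))) * h2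

lemma hop_add_far (hk : k ≠ 0) (s : Fin n) (α : Fin ((s : ℕ) / 2) × Bool) {t i : ℕ}
    (ht : t ≠ s) (ht1 : t ≠ s + 1) (ht2 : t + 1 ≠ s) (b : Bool) (ξ : Tableau n k) :
    hop (stdRoots r ω) s α (ξ + step n k t i b) = hop (stdRoots r ω) s α ξ := by
  have hj := α.1.2
  rw [hop_stdRoots hk, hop_stdRoots hk, Y_add_step_other (fun e => ht e.1.symm)]
  refine rootU_congr (fun c hc => ?_) fun i _ => ?_
  · rw [Y_add_step_other]
    rw [mem_nbs] at hc
    omega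
  · rw [Y_add_step_other (fun e => ht e.1.symm)]

lemma hop_exchange_of_lt (hh : Admissible (qhalf k r)) (hk : k ≠ 0) (hω : ω.IsGeneric r)
    (s : Fin n) (α α' : Fin ((s : ℕ) / 2) × Bool) (hα : α.1 < α'.1) (ξ : Tableau n k) :
    hop (stdRoots r ω) s α ξ * hop (stdRoots r ω) s α' (ξ + step n k s α.1 α.2)
        * br (qhalf k r) (sgn α.2 (Y r ω s α.1 ξ) / sgn α'.2 (Y r ω s α'.1 ξ) * qhalf k r ^ 2)
      = hop (stdRoots r ω) s α' ξ * hop (stdRoots r ω) s α (ξ + step n k s α'.1 α'.2)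
        * br (qhalf k r)
          (sgn α.2 (Y r ω s α.1 ξ) / (sgn α'.2 (Y r ω s α'.1 ξ) * qhalf k r ^ 2)) := by
  obtain ⟨j, b⟩ := α
  obtain ⟨j', b'⟩ := α'
  simp only at hα ⊢
  have e1 := hop_add_same hh hk hω s (j, b) j' hα.ne' b' ξ
  have e2 := hop_add_same hh hk hω s (j', b') j hα.ne b ξ
  have key := ds_exchange (qhalf_ne_zero k r) (Y_ne_zero (r := r) (ω := ω) s j ξ)
    (Y_ne_zero (r := r) (ω := ω) s j' ξ) b b'
  have hne : ∀ (l i : Fin ((s : ℕ) / 2)) (lt c : Bool) (ξ ζ : Tableau n k), i ≠ l →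
      ds (qhalf k r) lt (Y r ω s i ξ) (mv (qhalf k r) c (Y r ω s l ζ)) ≠ 0 := by
    intro l i lt c ξ ζ hil
    obtain ⟨ζ', hζ⟩ := exists_mv_eq (r := r) (ω := ω) hk s.2 l.2 ζ c
    rw [hζ, ← pow_ne_zero_iff two_ne_zero, ds_sq]
    exact dd_Y_ne_zero hh hk hω s.2 i.2 l.2 (fun e => hil (Fin.ext e)) _ _
  have n1 := hne j j' true b (ξ + step n k s j' b') ξ hα.ne'
  have n2 := hne j' j false b' (ξ + step n k s j b) ξ hα.ne
  simp only [decide_eq_true hα, decide_eq_false hα.asymm] at e1 e2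
  rw [Y_add_step hk s.2 j'.2] at e1 n1
  rw [Y_add_step hk s.2 j.2] at e2 n2
  -- Multiplying by the two factors that change makes `e1`, `e2` and the local identity `key`
  -- combine linearly.
  refine mul_right_cancel₀ (mul_ne_zero n1 n2) ?_
  generalize hop (stdRoots r ω) s (j, b) ξ = p at *
  generalize hop (stdRoots r ω) s (j', b') ξ = p' at *
  generalize hop (stdRoots r ω) s (j, b) (ξ + step n k s j' b') = p1 at *
  generalize hop (stdRoots r ω) s (j', b') (ξ + step n k s j b) = p2 at *
  generalize br (qhalf k r) (sgn b (Y r ω s j ξ) / sgn b' (Y r ω s j' ξ) * qhalf k r ^ 2) = m at *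
  generalize br (qhalf k r) (sgn b (Y r ω s j ξ) / (sgn b' (Y r ω s j' ξ) * qhalf k r ^ 2)) = m' at *
  generalize ds (qhalf k r) true (stp (qhalf k r) b' (Y r ω s j' ξ)) _ = d1 at *
  generalize ds (qhalf k r) false (stp (qhalf k r) b (Y r ω s j ξ)) _ = d2 at *
  linear_combination (p * m * d1) * e2 - (p' * m' * d2) * e1 + p * p' * key

lemma hop_exchange (hh : Admissible (qhalf k r)) (hk : k ≠ 0) (hω : ω.IsGeneric r)
    (s : Fin n) (α α' : Fin ((s : ℕ) / 2) × Bool) (hα : α.1 ≠ α'.1) (ξ : Tableau n k) :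
    hop (stdRoots r ω) s α ξ * hop (stdRoots r ω) s α' (ξ + step n k s α.1 α.2)
        * br (qhalf k r) (sgn α.2 (Y r ω s α.1 ξ) / sgn α'.2 (Y r ω s α'.1 ξ) * qhalf k r ^ 2)
      = hop (stdRoots r ω) s α' ξ * hop (stdRoots r ω) s α (ξ + step n k s α'.1 α'.2)
        * br (qhalf k r)
          (sgn α.2 (Y r ω s α.1 ξ) / (sgn α'.2 (Y r ω s α'.1 ξ) * qhalf k r ^ 2)) := by
  rcases lt_or_gt_of_ne hα with h | h
  · exact hop_exchange_of_lt hh hk hω s α α' h ξ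
  -- The relation is antisymmetric: exchanging the two moves interchanges the two brackets up to a
  -- common sign.
  · have e := hop_exchange_of_lt hh hk hω s α' α h ξ
    have h0 := qhalf_ne_zero k r
    have hx := sgn_ne_zero α.2 (Y_ne_zero (r := r) (ω := ω) s α.1 ξ)
    have hy := sgn_ne_zero α'.2 (Y_ne_zero (r := r) (ω := ω) s α'.1 ξ)
    generalize sgn α.2 (Y r ω s α.1 ξ) = x at *
    generalize sgn α'.2 (Y r ω s α'.1 ξ) = y at *
    rw [br_of_mul_eq_one (show y / x * qhalf k r ^ 2 * (x / (y * qhalf k r ^ 2)) = 1 by field_simp),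
      br_of_mul_eq_one (show y / (x * qhalf k r ^ 2) * (x / y * qhalf k r ^ 2) = 1 by field_simp)]
      at e
    linear_combination e

lemma hop_transport_up (hh : Admissible (qhalf k r)) (hk : k ≠ 0) (hω : ω.IsGeneric r)
    (s t : Fin n) (hst : (t : ℕ) = s + 1) (α : Fin ((s : ℕ) / 2) × Bool)
    (β : Fin ((t : ℕ) / 2) × Bool) (ξ : Tableau n k) :
    hop (stdRoots r ω) s α ξ * hop (stdRoots r ω) t β (ξ + step n k s α.1 α.2)
        * br (qhalf k r) (sgn β.2 (Y r ω t β.1 ξ) / sgn α.2 (Y r ω s α.1 ξ) * qhalf k r)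
      = hop (stdRoots r ω) t β ξ * hop (stdRoots r ω) s α (ξ + step n k t β.1 β.2)
        * br (qhalf k r)
          (sgn β.2 (Y r ω t β.1 ξ) / (sgn α.2 (Y r ω s α.1 ξ) * qhalf k r)) := by
  obtain ⟨j, b⟩ := α
  obtain ⟨j', b'⟩ := β
  simp only
  have hc : ((t : ℕ), (j' : ℕ)) ∈ nbs s := mem_nbs.mpr ⟨Or.inl hst, j'.2⟩
  have hc' : ((s : ℕ), (j : ℕ)) ∈ nbs t := mem_nbs.mpr ⟨Or.inr (by simp only; omega), j.2⟩
  have e1 := hop_add_nbs (r := r) (ω := ω) hk s (j, b) hc b' ξ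
  have e2 := hop_add_nbs (r := r) (ω := ω) hk t (j', b') hc' b ξ
  have key := gs_exchange (qhalf_ne_zero k r) (Y_ne_zero (r := r) (ω := ω) s j ξ)
    (Y_ne_zero (r := r) (ω := ω) t j' ξ) b b'
  have hne : ∀ (s : Fin n) (l : Fin ((s : ℕ) / 2)) (c : ℕ × ℕ) (up b : Bool) (ξ ζ : Tableau n k),
      c ∈ nbs s →
      gs (qhalf k r) up (Y r ω c.1 c.2 ξ) (mv (qhalf k r) b (Y r ω s l ζ)) ≠ 0 := by
    intro s l c up b ξ ζ hc
    obtain ⟨ζ', hζ⟩ := exists_mv_eq (r := r) (ω := ω) hk s.2 l.2 ζ b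
    rw [hζ, ← pow_ne_zero_iff two_ne_zero, gs_sq]
    exact gg_Y_ne_zero hh hk hω s.2 l.2 hc _ _
  have n1 := hne s j _ true b ξ ξ hc
  have n2 := hne t j' _ false b' ξ ξ hc'
  simp only [decide_eq_true (show (s : ℕ) < t by omega),
    decide_eq_false (show ¬ (t : ℕ) < s by omega)] at e1 e2 n1 n2
  rw [Y_add_step hk t.2 j'.2] at e1
  rw [Y_add_step hk s.2 j.2] at e2
  refine mul_right_cancel₀ (mul_ne_zero n1 n2) ?_
  generalize hop (stdRoots r ω) s (j, b) ξ = p at *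
  generalize hop (stdRoots r ω) t (j', b') ξ = p' at *
  generalize hop (stdRoots r ω) s (j, b) (ξ + step n k t j' b') = p1 at *
  generalize hop (stdRoots r ω) t (j', b') (ξ + step n k s j b) = p2 at *
  generalize br (qhalf k r) (sgn b' (Y r ω t j' ξ) / sgn b (Y r ω s j ξ) * qhalf k r) = m at *
  generalize br (qhalf k r) (sgn b' (Y r ω t j' ξ) / (sgn b (Y r ω s j ξ) * qhalf k r)) = m' at *
  generalize gs (qhalf k r) true (Y r ω t j' ξ) _ = d1 at *
  generalize gs (qhalf k r) false (Y r ω s j ξ) _ = d2 at *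
  linear_combination (p * m * d1) * e2 - (p' * m' * d2) * e1 + p * p' * key

lemma hop_transport (hh : Admissible (qhalf k r)) (hk : k ≠ 0) (hω : ω.IsGeneric r)
    (s t : Fin n) (hst : (t : ℕ) = s + 1 ∨ (s : ℕ) = t + 1) (α : Fin ((s : ℕ) / 2) × Bool)
    (β : Fin ((t : ℕ) / 2) × Bool) (ξ : Tableau n k) :
    hop (stdRoots r ω) s α ξ * hop (stdRoots r ω) t β (ξ + step n k s α.1 α.2)
        * br (qhalf k r) (sgn β.2 (Y r ω t β.1 ξ) / sgn α.2 (Y r ω s α.1 ξ) * qhalf k r)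
      = hop (stdRoots r ω) t β ξ * hop (stdRoots r ω) s α (ξ + step n k t β.1 β.2)
        * br (qhalf k r)
          (sgn β.2 (Y r ω t β.1 ξ) / (sgn α.2 (Y r ω s α.1 ξ) * qhalf k r)) := by
  rcases hst with h | h
  · exact hop_transport_up hh hk hω s t h α β ξ
  · have e := hop_transport_up hh hk hω t s h β α ξ
    have h0 := qhalf_ne_zero k r
    have hx := sgn_ne_zero α.2 (Y_ne_zero (r := r) (ω := ω) s α.1 ξ)
    have hy := sgn_ne_zero β.2 (Y_ne_zero (r := r) (ω := ω) t β.1 ξ)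
    generalize sgn α.2 (Y r ω s α.1 ξ) = x at *
    generalize sgn β.2 (Y r ω t β.1 ξ) = y at *
    rw [br_of_mul_eq_one (show x / y * qhalf k r * (y / (x * qhalf k r)) = 1 by field_simp),
      br_of_mul_eq_one (show x / (y * qhalf k r) * (y / x * qhalf k r) = 1 by field_simp)]
      at e
    linear_combination e

end Roots

end UqSo

namespace UqSo

/-! ### The relations for the standard choice of the square roots -/

section Relations

variable {n k : ℕ} {r : ℤ} {ω : Params n}

lemma br_sgn_mul_sq {h : ℂ} (hh : h ≠ 0) (b : Bool) {u : ℂ} (hu : u ≠ 0) (x x' : ℂ) :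
    x' * br h (sgn b u) = x * br h (sgn b u * h ^ 2) ↔ x' * br h u = x * br h (stp h b u) := by
  cases b
  · rw [sgn_false, show u⁻¹ * h ^ 2 = (stp h false u)⁻¹ by
      simp only [stp, Bool.false_eq_true, if_false]; field_simp, br_inv, br_inv, mul_neg, mul_neg,
      neg_inj]
  · rfl

/-- A step in an adjacent row changes one factor of the numerator. -/
lemma dcoef_add_nbs (hk : k ≠ 0) (s t : Fin n) (i : Fin ((t : ℕ) / 2))
    (hc : ((t : ℕ), (i : ℕ)) ∈ nbs s) (b : Bool) (ξ : Tableau n k) :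
    dcoef r ω s (ξ + step n k t i b) * br (qhalf k r) (sgn b (Y r ω t i ξ))
      = dcoef r ω s ξ * br (qhalf k r) (sgn b (Y r ω t i ξ) * qhalf k r ^ 2) := by
  rw [br_sgn_mul_sq (qhalf_ne_zero k r) b (Y_ne_zero _ _ _), ← Y_add_step hk t.2 i.2]
  rw [dcoef, dcoef]
  split_ifs with hs
  · ring
  · have hc' := mem_nbs.mp hc
    have hs : ∀ i' : Fin ((s : ℕ) / 2), ¬ ((s : ℕ) = t ∧ (i' : ℕ) = i) := by
      intro i'
      have := i'.2
      simp only at hc'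
      omega
    have e1 : ∀ i' : Fin ((s : ℕ) / 2), Y r ω s i' (ξ + step n k t i b) = Y r ω s i' ξ :=
      fun i' => Y_add_step_other (hs i') _ _
    have e2 := prod_mul_swap
      (f := fun d : ℕ × ℕ => br (qhalf k r) (Y r ω d.1 d.2 (ξ + step n k t i b)))
      (g := fun d : ℕ × ℕ => br (qhalf k r) (Y r ω d.1 d.2 ξ)) hc (fun d _ hdc => by
        rw [Y_add_step_other fun e => hdc (Prod.ext e.1 e.2)])
    simp only [e1, mul_assoc, div_mul_eq_mul_div]
    rw [e2]

lemma indep_single (hk : k ≠ 0) (hω : ω.IsGeneric r) {s j : ℕ} (hs : s ≤ n) (hj : j < s / 2)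
    (ξ : Tableau n k) : Indep (qhalf k r) (Y r ω s j ξ) :=
  indep_Y hk (hω.base_single hs hj) ξ

lemma Indep.sgn {h u : ℂ} (hu : Indep h u) (b : Bool) : Indep h (sgn b u) := by
  cases b
  · exact hu.inv
  · exact hu

/-- Only [y+1/2][y-1/2] in the denominator changes. It is even in y, so both directions obey one
formula; after the step it shares the factor [y+1/2] with its old value. -/
lemma dcoef_add_self (hh : Admissible (qhalf k r)) (hk : k ≠ 0) (hω : ω.IsGeneric r)
    (s : Fin n) (j : Fin ((s : ℕ) / 2)) (b : Bool) (ξ : Tableau n k) :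
    dcoef r ω s (ξ + step n k s j b) * br (qhalf k r) (sgn b (Y r ω s j ξ) * qhalf k r ^ 3)
      = dcoef r ω s ξ * br (qhalf k r) (sgn b (Y r ω s j ξ) / qhalf k r) := by
  have h0 := qhalf_ne_zero k r
  have hI := indep_single hk hω s.2.le j.2 ξ
  have hu := Y_ne_zero (r := r) (ω := ω) s j ξ
  rw [dcoef, dcoef]
  split_ifs with hs
  · ring
  · have e1 : ∏ c ∈ nbs s, br (qhalf k r) (Y r ω c.1 c.2 (ξ + step n k s j b))
        = ∏ c ∈ nbs s, br (qhalf k r) (Y r ω c.1 c.2 ξ) := by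
      refine Finset.prod_congr rfl fun c hc => ?_
      rw [Y_add_step_other]
      rw [mem_nbs] at hc
      have := j.2
      omega
    have e2 := prod_mul_swap (s := Finset.univ) (i := j)
      (f := fun i : Fin ((s : ℕ) / 2) => br (qhalf k r) (Y r ω s i (ξ + step n k s j b) * qhalf k r)
        * br (qhalf k r) (Y r ω s i (ξ + step n k s j b) / qhalf k r))
      (g := fun i : Fin ((s : ℕ) / 2) => br (qhalf k r) (Y r ω s i ξ * qhalf k r)
        * br (qhalf k r) (Y r ω s i ξ / qhalf k r)) (Finset.mem_univ _) (fun i _ hi => by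
        rw [Y_add_step_other fun e => hi (Fin.ext e.2)])
    have hne : ∀ ξ' : Tableau n k, ∏ i : Fin ((s : ℕ) / 2),
        (br (qhalf k r) (Y r ω s i ξ' * qhalf k r)
          * br (qhalf k r) (Y r ω s i ξ' / qhalf k r)) ≠ 0 := by
      intro ξ'
      refine Finset.prod_ne_zero_iff.mpr fun i _ => mul_ne_zero ?_ ?_
      · exact (indep_single hk hω s.2.le i.2 ξ').br_ne_zero' hh 1 (by rw [zpow_one])
      · exact (indep_single hk hω s.2.le i.2 ξ').br_ne_zero' hh (-1)
          (by rw [zpow_neg, zpow_one, div_eq_mul_inv])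
    rw [e1]
    have hn := (hI.sgn b).br_ne_zero hh 1
    rw [zpow_one] at hn
    have e3 : br (qhalf k r) (Y r ω s j ξ * qhalf k r) * br (qhalf k r) (Y r ω s j ξ / qhalf k r)
        = br (qhalf k r) (sgn b (Y r ω s j ξ) * qhalf k r)
          * br (qhalf k r) (sgn b (Y r ω s j ξ) / qhalf k r) := by
      cases b
      · rw [sgn_false, br_of_mul_eq_one
          (show Y r ω s j ξ * qhalf k r * ((Y r ω s j ξ)⁻¹ / qhalf k r) = 1 by field_simp),
          br_of_mul_eq_one
          (show Y r ω s j ξ / qhalf k r * ((Y r ω s j ξ)⁻¹ * qhalf k r) = 1 by field_simp)]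
        ring
      · rfl
    have e4 : br (qhalf k r) (stp (qhalf k r) b (Y r ω s j ξ) * qhalf k r)
          * br (qhalf k r) (stp (qhalf k r) b (Y r ω s j ξ) / qhalf k r)
        = br (qhalf k r) (sgn b (Y r ω s j ξ) * qhalf k r ^ 3)
          * br (qhalf k r) (sgn b (Y r ω s j ξ) * qhalf k r) := by
      cases b
      · simp only [sgn_false, stp, Bool.false_eq_true, if_false]
        rw [br_of_mul_eq_one (show Y r ω s j ξ * (qhalf k r ^ 2)⁻¹ * qhalf k r
            * ((Y r ω s j ξ)⁻¹ * qhalf k r) = 1 by field_simp), br_of_mul_eq_one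
          (show Y r ω s j ξ * (qhalf k r ^ 2)⁻¹ / qhalf k r
            * ((Y r ω s j ξ)⁻¹ * qhalf k r ^ 3) = 1 by field_simp)]
        ring
      · simp only [sgn_true, stp, if_true]
        congr 2
        · ring
        · field_simp
    rw [Y_add_step hk s.2 j.2, e3, e4] at e2
    have n1 := hne ξ
    have n2 := hne (ξ + step n k s j b)
    rw [mul_assoc, mul_assoc, div_mul_eq_mul_div, div_mul_eq_mul_div]
    congr 1
    rw [div_eq_div_iff n2 n1, mul_assoc, mul_assoc]
    congr 1
    refine mul_right_cancel₀ hn ?_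
    linear_combination -e2

lemma coef_exchange (hh : Admissible (qhalf k r)) (hk : k ≠ 0) (hω : ω.IsGeneric r)
    (s : Fin n) (α α' : Fin ((s : ℕ) / 2) × Bool) (hα : α.1 ≠ α'.1) (ξ : Tableau n k) :
    coef r ω (stdRoots r ω) s α ξ * coef r ω (stdRoots r ω) s α' (ξ + step n k s α.1 α.2)
        * br (qhalf k r) (sgn α.2 (Y r ω s α.1 ξ) / sgn α'.2 (Y r ω s α'.1 ξ) * qhalf k r ^ 2)
      = coef r ω (stdRoots r ω) s α' ξ * coef r ω (stdRoots r ω) s α (ξ + step n k s α'.1 α'.2)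
        * br (qhalf k r)
          (sgn α.2 (Y r ω s α.1 ξ) / (sgn α'.2 (Y r ω s α'.1 ξ) * qhalf k r ^ 2)) := by
  have e := hop_exchange hh hk hω s α α' hα ξ
  rw [coef, coef, coef, coef, Y_add_step_other (fun e => hα (Fin.ext e.2.symm)),
    Y_add_step_other (fun e => hα (Fin.ext e.2))]
  linear_combination (cst ω s α * cst ω s α' * wt (qhalf k r) s (sgn α.2 (Y r ω s α.1 ξ))
    * wt (qhalf k r) s (sgn α'.2 (Y r ω s α'.1 ξ))) * e

lemma coef_transport (hh : Admissible (qhalf k r)) (hk : k ≠ 0) (hω : ω.IsGeneric r)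
    (s t : Fin n) (hst : (t : ℕ) = s + 1 ∨ (s : ℕ) = t + 1) (α : Fin ((s : ℕ) / 2) × Bool)
    (β : Fin ((t : ℕ) / 2) × Bool) (ξ : Tableau n k) :
    coef r ω (stdRoots r ω) s α ξ * coef r ω (stdRoots r ω) t β (ξ + step n k s α.1 α.2)
        * br (qhalf k r) (sgn β.2 (Y r ω t β.1 ξ) / sgn α.2 (Y r ω s α.1 ξ) * qhalf k r)
      = coef r ω (stdRoots r ω) t β ξ * coef r ω (stdRoots r ω) s α (ξ + step n k t β.1 β.2)
        * br (qhalf k r)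
          (sgn β.2 (Y r ω t β.1 ξ) / (sgn α.2 (Y r ω s α.1 ξ) * qhalf k r)) := by
  have e := hop_transport hh hk hω s t hst α β ξ
  rw [coef, coef, coef, coef, Y_add_step_other (fun e => by omega),
    Y_add_step_other (fun e => by omega)]
  linear_combination (cst ω s α * cst ω t β * wt (qhalf k r) s (sgn α.2 (Y r ω s α.1 ξ))
    * wt (qhalf k r) t (sgn β.2 (Y r ω t β.1 ξ))) * e

lemma indep_sgn_sgn {h u v : ℂ} (h1 : Indep h (u * v)) (h2 : Indep h (u / v)) (b b' : Bool) :
    Indep h (sgn b u * sgn b' v) ∧ Indep h (sgn b u / sgn b' v) := by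
  have h3 := h1.inv
  have h4 := h2.inv
  rw [mul_inv] at h3
  rw [div_eq_mul_inv, mul_inv, inv_inv] at h4
  rw [div_eq_mul_inv] at h2
  cases b <;> cases b' <;> simp only [sgn_true, sgn_false, div_eq_mul_inv, inv_inv] <;>
    exact ⟨by assumption, by assumption⟩

lemma rho_ne_rho (hh : Admissible (qhalf k r)) {z w : ℂ} (hz : z ≠ 0) (hw : w ≠ 0)
    (h1 : br (qhalf k r) (z * w) ≠ 0) (h2 : br (qhalf k r) (z / w) ≠ 0) : rho z ≠ rho w := by
  rw [← sub_ne_zero, rho_sub_rho hh hz hw]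
  exact mul_ne_zero (kap_ne_zero hh) (mul_ne_zero h1 h2)

lemma points_injective (hh : Admissible (qhalf k r)) (hk : k ≠ 0) (hω : ω.IsGeneric r)
    (s : Fin n) (ξ : Tableau n k) :
    Function.Injective fun α : Fin ((s : ℕ) / 2) × Bool =>
      rho (sgn α.2 (Y r ω s α.1 ξ) * qhalf k r) := by
  have h0 := qhalf_ne_zero k r
  rintro ⟨j, b⟩ ⟨j', b'⟩ hαα
  by_contra hne
  have hj := Y_ne_zero (r := r) (ω := ω) s j ξ
  have hj' := Y_ne_zero (r := r) (ω := ω) s j' ξ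
  refine rho_ne_rho hh (mul_ne_zero (sgn_ne_zero b hj) h0) (mul_ne_zero (sgn_ne_zero b' hj') h0)
    ?_ ?_ hαα
  · by_cases hjj : j = j'
    · subst hjj
      have hb : b' = !b := by
        rw [Bool.eq_not]; rintro rfl; exact hne rfl
      rw [hb, sgn_not, show sgn b (Y r ω s j ξ) * qhalf k r * ((sgn b (Y r ω s j ξ))⁻¹ * qhalf k r)
        = qhalf k r ^ 2 by have := sgn_ne_zero b hj; field_simp, br_sq hh]
      exact one_ne_zero
    · refine (indep_sgn_sgn (indep_mul hk (hω.base_add s.2 j.2 j'.2) ξ ξ) (indep_div hk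
        (hω.base_sub s.2 j.2 j'.2 fun e => hjj (Fin.ext e)) ξ ξ) b b').1.br_ne_zero' hh 2 ?_
      norm_cast
      ring
  · rw [mul_div_mul_right _ _ h0]
    by_cases hjj : j = j'
    · subst hjj
      have hb : b' = !b := by
        rw [Bool.eq_not]; rintro rfl; exact hne rfl
      rw [hb, sgn_not, div_inv_eq_mul]
      have := indep_mul hk (hω.base_add s.2 j.2 j.2) ξ ξ
      refine Indep.br_ne_zero' hh (z := sgn b (Y r ω s j ξ) * sgn b (Y r ω s j ξ)) ?_ 0 (by simp)
      cases b
      · simp only [sgn_false]; rw [← mul_inv]; exact this.inv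
      · exact this
    · exact (indep_sgn_sgn (indep_mul hk (hω.base_add s.2 j.2 j'.2) ξ ξ) (indep_div hk
        (hω.base_sub s.2 j.2 j'.2 fun e => hjj (Fin.ext e)) ξ ξ) b b').2.br_ne_zero' hh 0 (by simp)

lemma points_ne_one (hh : Admissible (qhalf k r)) (hk : k ≠ 0) (hω : ω.IsGeneric r)
    (s : Fin n) (ξ : Tableau n k) (α : Fin ((s : ℕ) / 2) × Bool) :
    rho (sgn α.2 (Y r ω s α.1 ξ) * qhalf k r) ≠ rho 1 := by
  have hI := ((indep_single hk hω s.2.le α.1.2 ξ).sgn α.2).br_ne_zero hh 1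
  rw [zpow_one] at hI
  refine rho_ne_rho hh (mul_ne_zero (sgn_ne_zero _ (Y_ne_zero _ _ _)) (qhalf_ne_zero k r))
    one_ne_zero ?_ ?_
  · rwa [mul_one]
  · rwa [div_one]

/-! ### The sums over round trips -/

lemma br_sq_arg (h : ℂ) {y : ℂ} (hy : y ≠ 0) : br h (y ^ 2) = br h y * (y + y⁻¹) := by
  rw [br, br, div_mul_eq_mul_div]
  congr 1
  field_simp
  ring

lemma indep_sq (hk : k ≠ 0) (hω : ω.IsGeneric r) (s : Fin n) (j : Fin ((s : ℕ) / 2)) (b : Bool)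
    (ξ : Tableau n k) : Indep (qhalf k r) (sgn b (Y r ω s j ξ) ^ 2) := by
  have := indep_mul hk (hω.base_add s.2 j.2 j.2) ξ ξ
  cases b
  · rw [sgn_false, sq, ← mul_inv]; exact this.inv
  · rw [sgn_true, sq]; exact this

/-- By [2y] = [y](q^y + q^(-y)) the even weights amount to one further neighbour with coordinate
`h`, in the form `gg h h y`, over the denominator of `interpolation_even`. -/
lemma wt_mul_even {h : ℂ} (hh : Admissible h) {s : ℕ} (hs : Even s) {y : ℂ} (hy : y ≠ 0)
    (h1 : br h (y ^ 2) ≠ 0) (h2 : br h (y ^ 2 * h ^ 4) ≠ 0) :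
    wt h s y * wt h s (y * h ^ 2)⁻¹ * br h (y ^ 2 * h ^ 4) = -gg h h y / br h (y ^ 2) := by
  have h0 := hh.ne_zero
  have hy2 : y * h ^ 2 ≠ 0 := mul_ne_zero hy (pow_ne_zero 2 h0)
  have e1 := br_sq_arg h hy
  have e2 := br_sq_arg h hy2
  rw [show (y * h ^ 2) ^ 2 = y ^ 2 * h ^ 4 by ring] at e2
  rw [e1] at h1
  rw [e2] at h2
  have e3 : gg h h y = -(br h (y * h ^ 2) * br h y) := by
    rw [gg, br_of_mul_eq_one (show h / (y * h) * y = 1 by field_simp),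
      show h * y * h = y * h ^ 2 by ring]
    ring
  rw [e1, e2, e3, wt, wt, if_pos hs, if_pos hs, inv_inv, add_comm (y * h ^ 2)⁻¹]
  have := left_ne_zero_of_mul h1
  have := right_ne_zero_of_mul h1
  have := right_ne_zero_of_mul h2
  generalize y * h ^ 2 + (y * h ^ 2)⁻¹ = A at *
  generalize y + y⁻¹ = B at *
  generalize br h y = C at *
  generalize br h (y * h ^ 2) = E at *
  field_simp

/-- The squared bracket is, up to the scale `kap`, the distance to the node `rho 1` in
`interpolation_odd`. -/
lemma wt_mul_odd {h : ℂ} (hh : Admissible h) {s : ℕ} (hs : ¬ Even s) {y : ℂ} (hy : y ≠ 0)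
    (h2 : br h (y ^ 2 * h ^ 4) ≠ 0) :
    wt h s y * wt h s (y * h ^ 2)⁻¹ * br h (y ^ 2 * h ^ 4)
      = (br h (y ^ 2) * br h (y * h) ^ 2)⁻¹ := by
  have h0 := hh.ne_zero
  have e1 : br h ((y * h ^ 2)⁻¹ ^ 2) = -br h (y ^ 2 * h ^ 4) :=
    br_of_mul_eq_one (by field_simp)
  have e2 : br h ((y * h ^ 2)⁻¹ * h) = -br h (y * h) :=
    br_of_mul_eq_one (by field_simp)
  rw [wt, wt, if_neg hs, if_neg hs, e1, e2, neg_mul_neg]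
  generalize br h (y ^ 2 * h ^ 4) = C at h2
  generalize br h (y * h) = B
  have e3 : (C * B)⁻¹ * C = B⁻¹ := by
    rw [mul_inv_rev, mul_assoc, inv_mul_cancel₀ h2, mul_one]
  rw [mul_assoc, e3, ← mul_inv]
  ring

lemma gg_sgn {h : ℂ} (b : Bool) (v u : ℂ) : gg h (sgn b v) u = gg h v u := by
  cases b
  · rw [sgn_false, gg, gg, show v⁻¹ * u * h = (v / (u * h))⁻¹ by
      rw [inv_div, div_eq_mul_inv]; ring, show v⁻¹ / (u * h) = (v * u * h)⁻¹ by
      rw [mul_assoc, mul_inv, div_eq_mul_inv], br_inv, br_inv]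
    ring
  · rfl

/-- If `e` is the signed coordinate of the neighbour before its move, `e * h ^ 2` is the one after
it. The denominators in `serre_of_local` then cancel a factor of the radicand. -/
lemma gg_eq_of_move {h e y : ℂ} (hh : h ≠ 0) :
    br h (e / y * h) * br h (e * y * h ^ 3) = gg h (e * h ^ 2) y := by
  rw [gg, mul_comm]
  congr 2
  · ring
  · field_simp

lemma term_eq (hk : k ≠ 0) (hω : ω.IsGeneric r) {R : Roots n k} (hR : IsRootChoice k r ω R)
    (s : Fin n) (α : Fin ((s : ℕ) / 2) × Bool) (ζ : Tableau n k) (X G : ℂ) :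
    coef r ω R s α ζ * coef r ω R s (α.1, !α.2) (ζ + step n k s α.1 α.2) * (X / G)
      = -(radU r ω s α.1 ζ (sgn α.2 (Y r ω s α.1 ζ)) / G
        * (wt (qhalf k r) s (sgn α.2 (Y r ω s α.1 ζ))
          * wt (qhalf k r) s (sgn α.2 (Y r ω s α.1 ζ) * qhalf k r ^ 2)⁻¹ * X)) := by
  rw [coef_mul_coef_back hk hω hR]
  ring

lemma gg_sgn_ne_zero (hh : Admissible (qhalf k r)) (hk : k ≠ 0) (hω : ω.IsGeneric r) {s j : ℕ}
    (hs : s < n) (hj : j < s / 2) {c : ℕ × ℕ} (hc : c ∈ nbs s) (b : Bool) (ξ ζ : Tableau n k) :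
    gg (qhalf k r) (Y r ω c.1 c.2 ξ) (sgn b (Y r ω s j ζ)) ≠ 0 := by
  have := indep_sgn_sgn (indep_nbs_mul hk hω hs hj hc ξ ζ) (indep_nbs_div hk hω hs hj hc ξ ζ)
    true b
  exact gg_ne_zero hh this.1 this.2

/-- The diagonal identity in an even row, for the move of a neighbour. -/
lemma total_even_move (hh : Admissible (qhalf k r)) (hk : k ≠ 0) (hω : ω.IsGeneric r)
    {R : Roots n k} (hR : IsRootChoice k r ω R) (s : Fin n) (hs : Even (s : ℕ))
    (hs1 : 1 ≤ (s : ℕ)) {c : ℕ × ℕ} (hc : c ∈ nbs s) (b : Bool) (ζ : Tableau n k) :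
    ∑ α : Fin ((s : ℕ) / 2) × Bool, coef r ω R s α ζ
        * coef r ω R s (α.1, !α.2) (ζ + step n k s α.1 α.2)
        * (br (qhalf k r) (sgn α.2 (Y r ω s α.1 ζ) ^ 2 * qhalf k r ^ 4)
          / gg (qhalf k r) (sgn b (Y r ω c.1 c.2 ζ)) (sgn α.2 (Y r ω s α.1 ζ))) = -1 := by
  classical
  have h0 := qhalf_ne_zero k r
  have hcard := card_nbs hs1
  -- The factor of the moving neighbour c is cancelled and replaced by the fictitious neighbour `h`
  -- from `wt_mul_even`; the degree stays one below the number of nodes.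
  have key := interpolation_even hh (u := fun i : Fin ((s : ℕ) / 2) => Y r ω s i ζ)
    (fun i => Y_ne_zero _ _ _) (nbs s)
    (v := fun d => if d = c then qhalf k r else Y r ω d.1 d.2 ζ)
    (fun d _ => by
      split_ifs
      · exact h0
      · exact Y_ne_zero _ _ _)
    (by rw [Fintype.card_fin, hcard]; obtain ⟨p, hp⟩ := hs; omega)
    (points_injective hh hk hω s ζ)
  rw [← key]
  refine Finset.sum_congr rfl fun α _ => ?_
  have hsq := indep_sq hk hω s α.1 α.2 ζ
  rw [term_eq hk hω hR, wt_mul_even hh hs (sgn_ne_zero _ (Y_ne_zero _ _ _))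
    (hsq.br_ne_zero' hh 0 (by simp)) (hsq.br_ne_zero' hh 4 (by norm_cast)), gg_sgn, radU]
  have hg := gg_sgn_ne_zero hh hk hω s.2 α.1.2 hc α.2 ζ ζ
  have e := prod_mul_swap
    (f := fun d : ℕ × ℕ => gg (qhalf k r) (Y r ω d.1 d.2 ζ) (sgn α.2 (Y r ω s α.1 ζ)))
    (g := fun d : ℕ × ℕ => gg (qhalf k r) (if d = c then qhalf k r else Y r ω d.1 d.2 ζ)
      (sgn α.2 (Y r ω s α.1 ζ))) hc (fun d _ hdc => by rw [if_neg hdc])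
  simp only [if_true] at e
  rw [eq_comm, ← eq_div_iff hg] at e
  rw [e]
  ring

/-- The diagonal identity in an even row, for a diagonal operator of an adjacent row. -/
lemma total_even_diag (hh : Admissible (qhalf k r)) (hk : k ≠ 0) (hω : ω.IsGeneric r)
    {R : Roots n k} (hR : IsRootChoice k r ω R) (s : Fin n) (hs : Even (s : ℕ))
    (hs1 : 1 ≤ (s : ℕ)) (ζ : Tableau n k) :
    ∑ α : Fin ((s : ℕ) / 2) × Bool, coef r ω R s α ζ
        * coef r ω R s (α.1, !α.2) (ζ + step n k s α.1 α.2)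
        * (br (qhalf k r) (sgn α.2 (Y r ω s α.1 ζ) ^ 2 * qhalf k r ^ 4)
          / gg (qhalf k r) (qhalf k r) (sgn α.2 (Y r ω s α.1 ζ))) = -1 := by
  have h0 := qhalf_ne_zero k r
  have hcard := card_nbs hs1
  have key := interpolation_even hh (u := fun i : Fin ((s : ℕ) / 2) => Y r ω s i ζ)
    (fun i => Y_ne_zero _ _ _) (nbs s) (v := fun d => Y r ω d.1 d.2 ζ)
    (fun d _ => Y_ne_zero _ _ _)
    (by rw [Fintype.card_fin, hcard]; obtain ⟨p, hp⟩ := hs; omega)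
    (points_injective hh hk hω s ζ)
  rw [← key]
  refine Finset.sum_congr rfl fun α _ => ?_
  have hsq := indep_sq hk hω s α.1 α.2 ζ
  rw [term_eq hk hω hR, wt_mul_even hh hs (sgn_ne_zero _ (Y_ne_zero _ _ _))
    (hsq.br_ne_zero' hh 0 (by simp)) (hsq.br_ne_zero' hh 4 (by norm_cast)), radU]
  have hI := (indep_single hk hω s.2.le α.1.2 ζ).sgn α.2
  have hy := hI.1
  -- Here the denominator cancels exactly the fictitious neighbour, and all true neighbours remain.
  have hg : gg (qhalf k r) (qhalf k r) (sgn α.2 (Y r ω s α.1 ζ)) ≠ 0 := by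
    refine mul_ne_zero (hI.br_ne_zero' hh 2 (by norm_cast; ring)) (hI.inv.br_ne_zero' hh 0 ?_)
    field_simp
  generalize gg (qhalf k r) (qhalf k r) (sgn α.2 (Y r ω s α.1 ζ)) = g at hg
  rw [neg_div, mul_neg, neg_neg, div_mul_div_comm, mul_comm _ g, mul_comm g (br _ _),
    mul_comm g, mul_div_mul_right _ _ hg, div_div, mul_comm (br _ _)]

/-- The diagonal identity in an odd row. -/
lemma total_odd_move (hh : Admissible (qhalf k r)) (hk : k ≠ 0) (hω : ω.IsGeneric r)
    {R : Roots n k} (hR : IsRootChoice k r ω R) (s t : Fin n) (hs : ¬ Even (s : ℕ))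
    (i : Fin ((t : ℕ) / 2)) (hc : ((t : ℕ), (i : ℕ)) ∈ nbs s) (b : Bool) (ξ ζ : Tableau n k)
    (hζ : ζ = ξ + step n k t i b) :
    ∑ α : Fin ((s : ℕ) / 2) × Bool, coef r ω R s α ζ
        * coef r ω R s (α.1, !α.2) (ζ + step n k s α.1 α.2)
        * (br (qhalf k r) (sgn α.2 (Y r ω s α.1 ζ) ^ 2 * qhalf k r ^ 4)
          / gg (qhalf k r) (sgn b (Y r ω t i ζ)) (sgn α.2 (Y r ω s α.1 ζ)))
      + (dcoef r ω s ζ ^ 2 - (qhalf k r ^ 2 + (qhalf k r ^ 2)⁻¹) * (dcoef r ω s ζ * dcoef r ω s ξ)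
        + dcoef r ω s ξ ^ 2) = -1 := by
  classical
  have h0 := qhalf_ne_zero k r
  have hs1 : 1 ≤ (s : ℕ) := by
    by_contra h
    exact hs (by rw [show (s : ℕ) = 0 by omega]; exact Even.zero)
  have hcard := card_nbs hs1
  -- The factor of the moving neighbour is cancelled by the denominator and not replaced, so its
  -- place is erased.
  have key := interpolation_odd hh (u := fun i : Fin ((s : ℕ) / 2) => Y r ω s i ζ)
    (fun i => Y_ne_zero _ _ _) ((nbs s).erase (t, i)) (v := fun d => Y r ω d.1 d.2 ζ)
    (fun d _ => Y_ne_zero _ _ _)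
    (by rw [Fintype.card_fin, Finset.card_erase_of_mem hc, hcard]; rw [Nat.not_even_iff] at hs; omega)
    (points_injective hh hk hω s ζ) (points_ne_one hh hk hω s ζ)
  set Δ := (∏ d ∈ (nbs s).erase ((t : ℕ), (i : ℕ)), br (qhalf k r) (Y r ω d.1 d.2 ζ))
    / ∏ i : Fin ((s : ℕ) / 2), (br (qhalf k r) (Y r ω s i ζ * qhalf k r)
      * br (qhalf k r) (Y r ω s i ζ / qhalf k r)) with hΔ
  have hI := indep_single hk hω t.2.le i.2 ξ
  have hb : br (qhalf k r) (Y r ω t i ξ) ≠ 0 := hI.br_ne_zero' hh 0 (by simp)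
  have hv := Y_ne_zero (r := r) (ω := ω) t i ξ
  have eζ : dcoef r ω s ζ = Complex.I * (br (qhalf k r) (Y r ω t i ζ) * Δ) := by
    rw [dcoef, if_neg hs, ← Finset.mul_prod_erase _ _ hc, hΔ, mul_div_assoc]
  have eξ : dcoef r ω s ξ = Complex.I * (br (qhalf k r) (Y r ω t i ξ) * Δ) := by
    have e := dcoef_add_nbs (r := r) (ω := ω) hk s t i hc b ξ
    rw [br_sgn_mul_sq h0 b hv, ← Y_add_step hk t.2 i.2, ← hζ, eζ] at e
    have hb' : br (qhalf k r) (Y r ω t i ζ) ≠ 0 :=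
      (indep_single hk hω t.2.le i.2 ζ).br_ne_zero' hh 0 (by simp)
    refine mul_right_cancel₀ hb' ?_
    rw [← e]
    ring
  -- Adjacent q-numbers satisfy [x±1]² - (q+q⁻¹)[x±1][x] + [x]² = 1. The three diagonal terms
  -- therefore add up to -Δ², the missing node `rho 1`.
  have eQ : br (qhalf k r) (Y r ω t i ζ) ^ 2 - (qhalf k r ^ 2 + (qhalf k r ^ 2)⁻¹)
      * (br (qhalf k r) (Y r ω t i ζ) * br (qhalf k r) (Y r ω t i ξ))
      + br (qhalf k r) (Y r ω t i ξ) ^ 2 = 1 := by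
    rw [hζ, Y_add_step hk t.2 i.2, ← br_sq hh]
    have hd := hh.den_ne_zero
    simp only [br]
    generalize hD : qhalf k r ^ 2 - (qhalf k r ^ 2)⁻¹ = D at hd
    field_simp
    cases b
    · simp only [stp, Bool.false_eq_true, if_false]
      rw [← hD]
      field_simp
      ring
    · simp only [stp, if_true]
      rw [← hD]
      field_simp
      ring
  have esum : ∑ α : Fin ((s : ℕ) / 2) × Bool, coef r ω R s α ζ
        * coef r ω R s (α.1, !α.2) (ζ + step n k s α.1 α.2)
        * (br (qhalf k r) (sgn α.2 (Y r ω s α.1 ζ) ^ 2 * qhalf k r ^ 4)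
          / gg (qhalf k r) (sgn b (Y r ω t i ζ)) (sgn α.2 (Y r ω s α.1 ζ)))
      = -∑ α : Fin ((s : ℕ) / 2) × Bool,
        (∏ d ∈ (nbs s).erase (t, i), gg (qhalf k r) (Y r ω d.1 d.2 ζ) (sgn α.2 (Y r ω s α.1 ζ)))
        / (br (qhalf k r) (sgn α.2 (Y r ω s α.1 ζ) ^ 2)
          * br (qhalf k r) (sgn α.2 (Y r ω s α.1 ζ) * qhalf k r) ^ 2
          * ∏ i ∈ Finset.univ.erase α.1, dd (qhalf k r) (Y r ω s i ζ)
            (sgn α.2 (Y r ω s α.1 ζ))) := by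
    rw [← Finset.sum_neg_distrib]
    refine Finset.sum_congr rfl fun α _ => ?_
    have hsq := indep_sq hk hω s α.1 α.2 ζ
    rw [term_eq hk hω hR, wt_mul_odd hh hs (sgn_ne_zero _ (Y_ne_zero _ _ _))
      (hsq.br_ne_zero' hh 4 (by norm_cast)), gg_sgn, radU]
    have hg := gg_sgn_ne_zero hh hk hω s.2 α.1.2 hc α.2 ζ ζ
    rw [← Finset.mul_prod_erase _ _ hc]
    simp only
    rw [mul_div_assoc, mul_div_cancel_left₀ _ hg, div_mul_eq_mul_div, ← div_eq_mul_inv, div_div]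
  rw [esum, eζ, eξ]
  linear_combination -key + Δ ^ 2 * (br (qhalf k r) (Y r ω t i ζ) ^ 2
    - (qhalf k r ^ 2 + (qhalf k r ^ 2)⁻¹)
      * (br (qhalf k r) (Y r ω t i ζ) * br (qhalf k r) (Y r ω t i ξ))
      + br (qhalf k r) (Y r ω t i ξ) ^ 2) * Complex.I_sq - Δ ^ 2 * eQ

end Relations

end UqSo

namespace UqSo

/-! ### The representation -/

lemma serre_zero_right {A : Type*} [Ring A] [Algebra ℂ A] (c : ℂ) (X : A) :
    serre c X X 0 = -0 := by
  simp [serre]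

lemma serre_eq_neg_of_summands {A ι : Type*} [Ring A] [Algebra ℂ A] [Fintype ι] (c : ℂ) (X : A)
    (T : ι → A) (T₀ : A) (h : ∀ i, serre c X X (T i) = -T i) (h₀ : serre c X X T₀ = -T₀) :
    serre c X X (∑ i, T i + T₀) = -(∑ i, T i + T₀) := by
  rw [serre_add_right, serre_sum_right, h₀, Finset.sum_congr rfl fun i _ => h i,
    Finset.sum_neg_distrib, neg_add]

section Representation

variable {n k : ℕ} {r : ℤ} {ω : Params n}

lemma mem_nbs_of_adj {s t : ℕ} (hst : t = s + 1 ∨ s = t + 1) (i : Fin (t / 2)) :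
    (t, (i : ℕ)) ∈ nbs s := by
  refine mem_nbs.mpr ⟨?_, i.2⟩
  simp only
  omega

/-- The cubic relation for the operators of two adjacent rows, one summand at a time. -/
lemma serre_op_wshift (hh : Admissible (qhalf k r)) (hk : k ≠ 0) (hω : ω.IsGeneric r)
    (s t : Fin n) (hst : (t : ℕ) = s + 1 ∨ (s : ℕ) = t + 1) (hs1 : 1 ≤ (s : ℕ))
    (β : Fin ((t : ℕ) / 2) × Bool) :
    serre (qhalf k r ^ 2 + (qhalf k r ^ 2)⁻¹) (op k r ω (stdRoots r ω) s)
        (op k r ω (stdRoots r ω) s)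
        (wshift (coef r ω (stdRoots r ω) t β) (step n k t β.1 β.2))
      = -wshift (coef r ω (stdRoots r ω) t β) (step n k t β.1 β.2) := by
  have h0 := qhalf_ne_zero k r
  have hc := mem_nbs_of_adj hst β.1
  have hne : ∀ (j : ℕ) (i : ℕ), ¬ ((s : ℕ) = t ∧ j = i) := by intro j i; omega
  have hne' : ∀ (j : ℕ) (i : ℕ), ¬ ((t : ℕ) = s ∧ j = i) := by intro j i; omega
  have hηζ : ∀ ξ : Tableau n k, sgn β.2 (Y r ω t β.1 ξ) * qhalf k r ^ 2
      = sgn β.2 (Y r ω t β.1 (ξ + step n k t β.1 β.2)) := fun ξ =>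
    (sgn_Y_add_step hk t.2 β.1.2 ξ β.2).symm
  rw [op_eq _ s hs1]
  refine serre_of_local (G := Tableau n k) (ι := Fin ((s : ℕ) / 2)) hh
    (y := fun α ξ => sgn α.2 (Y r ω s α.1 ξ))
    (η := fun ξ => sgn β.2 (Y r ω t β.1 ξ)) (vec := fun α => step n k s α.1 α.2)
    (S := coef r ω (stdRoots r ω) s) (t := coef r ω (stdRoots r ω) t β)
    (β := step n k t β.1 β.2) (D := dcoef r ω s)
    ?_ ?_ ?_ ?_ ?_ ?_ ?_ ?_ ?_ ?_ ?_ ?_ ?_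
  · exact fun i b => step_not _ _ b
  · exact fun i b ξ => sgn_not b _
  · exact fun α ξ => sgn_ne_zero _ (Y_ne_zero _ _ _)
  · exact fun ξ => sgn_ne_zero _ (Y_ne_zero _ _ _)
  · intro α ξ
    simp only [Y_add_step_other (hne _ _)]
  · exact fun α ξ => sgn_Y_add_step hk s.2 α.1.2 ξ α.2
  · intro α α' ξ h
    rw [Y_add_step_other fun e => h (Fin.ext e.2.symm)]
  · intro α ξ
    simp only [Y_add_step_other (hne' _ _)]
  · intro α ξ
    exact (indep_sgn_sgn (indep_nbs_mul hk hω s.2 α.1.2 hc ξ ξ)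
      (indep_nbs_div hk hω s.2 α.1.2 hc ξ ξ) β.2 α.2).2.br_ne_zero' hh 1 (by rw [zpow_one])
  · exact fun α ξ => coef_transport hh hk hω s t hst α β ξ
  · exact fun α α' ξ h => coef_exchange hh hk hω s α α' h ξ
  · by_cases hs : Even (s : ℕ)
    · exact Or.inl fun ξ => by rw [dcoef, if_pos hs]
    · refine Or.inr ⟨fun ξ => ⟨?_, fun α => ?_⟩, fun ξ => dcoef_add_nbs hk s t β.1 hc β.2 ξ,
        fun α ξ => dcoef_add_self hh hk hω s α.1 α.2 ξ⟩
      · exact ((indep_single hk hω t.2.le β.1.2 ξ).sgn β.2).br_ne_zero' hh 0 (by simp)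
      · exact ((indep_single hk hω s.2.le α.1.2 ξ).sgn α.2).br_ne_zero' hh 3 (by norm_cast)
  · intro ξ
    have e : ∀ α : Fin ((s : ℕ) / 2) × Bool, Y r ω s α.1 ξ
        = Y r ω s α.1 (ξ + step n k t β.1 β.2) := fun α =>
      (Y_add_step_other (hne _ _) _ _).symm
    simp only [gg_eq_of_move h0, hηζ]
    simp only [e]
    by_cases hs : Even (s : ℕ)
    · rw [total_even_move hh hk hω stdRoots_isRootChoice s hs hs1 hc β.2, dcoef, dcoef, if_pos hs,
        if_pos hs]
      ring
    · exact total_odd_move hh hk hω stdRoots_isRootChoice s t hs β.1 hc β.2 ξ _ rfl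

/-- The diagonal part of T is treated as a move by 0 whose fictitious coordinate η is q^(-1/2): the
change of `dcoef` under a step of the row s then takes the form of the transport relation, and η h²
= h. -/
lemma serre_op_diag (hh : Admissible (qhalf k r)) (hk : k ≠ 0) (hω : ω.IsGeneric r)
    (s t : Fin n) (hst : (t : ℕ) = s + 1 ∨ (s : ℕ) = t + 1) (hs1 : 1 ≤ (s : ℕ)) :
    serre (qhalf k r ^ 2 + (qhalf k r ^ 2)⁻¹) (op k r ω (stdRoots r ω) s)
        (op k r ω (stdRoots r ω) s) (wshift (dcoef r ω t) 0)
      = -wshift (dcoef (k := k) r ω t) 0 := by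
  have h0 := qhalf_ne_zero k r
  by_cases ht : Even (t : ℕ)
  · have hz : dcoef (k := k) r ω t = fun _ => 0 := by
      ext ξ; rw [dcoef, if_pos ht]
    rw [hz, wshift_zero]
    exact serre_zero_right _ _
  have hs : Even (s : ℕ) := by
    rcases hst with h | h
    · rwa [h, Nat.even_add_one, not_not] at ht
    · rwa [h, Nat.even_add_one]
  have hy : ∀ (α : Fin ((s : ℕ) / 2) × Bool) (ξ : Tableau n k),
      Indep (qhalf k r) (sgn α.2 (Y r ω s α.1 ξ)) := fun α ξ =>
    (indep_single hk hω s.2.le α.1.2 ξ).sgn α.2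
  rw [op_eq _ s hs1]
  refine serre_of_local (G := Tableau n k) (ι := Fin ((s : ℕ) / 2)) hh
    (y := fun α ξ => sgn α.2 (Y r ω s α.1 ξ))
    (η := fun ξ => (qhalf k r)⁻¹) (vec := fun α => step n k s α.1 α.2)
    (S := coef r ω (stdRoots r ω) s) (t := dcoef r ω t) (β := 0) (D := dcoef r ω s)
    ?_ ?_ ?_ ?_ ?_ ?_ ?_ ?_ ?_ ?_ ?_ ?_ ?_
  · exact fun i b => step_not _ _ b
  · exact fun i b ξ => sgn_not b _
  · exact fun α ξ => sgn_ne_zero _ (Y_ne_zero _ _ _)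
  · exact fun ξ => inv_ne_zero h0
  · intro α ξ
    simp only [add_zero]
  · exact fun α ξ => sgn_Y_add_step hk s.2 α.1.2 ξ α.2
  · intro α α' ξ h
    rw [Y_add_step_other fun e => h (Fin.ext e.2.symm)]
  · exact fun α ξ => rfl
  · intro α ξ
    refine (hy α ξ).inv.br_ne_zero' hh 0 ?_
    have := (hy α ξ).1
    field_simp
  · intro α ξ
    have e := dcoef_add_nbs (r := r) (ω := ω) hk t s α.1 (mem_nbs_of_adj hst.symm α.1) α.2 ξ
    have hy0 := (hy α ξ).1
    simp only [add_zero]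
    generalize sgn α.2 (Y r ω s α.1 ξ) = y at *
    rw [br_of_mul_eq_one (show (qhalf k r)⁻¹ / y * qhalf k r * y = 1 by field_simp),
      br_of_mul_eq_one (show (qhalf k r)⁻¹ / (y * qhalf k r) * (y * qhalf k r ^ 2) = 1 by
        field_simp)]
    linear_combination -coef r ω (stdRoots r ω) s α ξ * e
  · exact fun α α' ξ h => coef_exchange hh hk hω s α α' h ξ
  · exact Or.inl fun ξ => by rw [dcoef, if_pos hs]
  · intro ξ
    simp only [gg_eq_of_move h0, add_zero]
    rw [show (qhalf k r)⁻¹ * qhalf k r ^ 2 = qhalf k r by field_simp,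
      total_even_diag hh hk hω stdRoots_isRootChoice s hs hs1, dcoef, if_pos hs]
    ring

lemma serre_op (hh : Admissible (qhalf k r)) (hk : k ≠ 0) (hω : ω.IsGeneric r)
    (s t : Fin n) (hst : (t : ℕ) = s + 1 ∨ (s : ℕ) = t + 1) (hs1 : 1 ≤ (s : ℕ))
    (ht1 : 1 ≤ (t : ℕ)) :
    serre (qroot k r + (qroot k r)⁻¹) (op k r ω (stdRoots r ω) s)
        (op k r ω (stdRoots r ω) s) (op k r ω (stdRoots r ω) t)
      = -op k r ω (stdRoots r ω) t := by
  rw [← qhalf_sq, op_eq _ t ht1]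
  exact serre_eq_neg_of_summands _ _ _ _ (serre_op_wshift hh hk hω s t hst hs1)
    (serre_op_diag hh hk hω s t hst hs1)

lemma wshift_commute {G : Type*} [AddCommGroup G] {f f' : G → ℂ} {g g' : G}
    (h : ∀ ξ, f (ξ + g') = f ξ) (h' : ∀ ξ, f' (ξ + g) = f' ξ) :
    Commute (wshift f g) (wshift f' g') := by
  rw [Commute, SemiconjBy, wshift_mul, wshift_mul, add_comm g' g]
  congr 1
  ext ξ
  rw [h, h', mul_comm]

lemma dcoef_add_far (s : Fin n) {t i : ℕ} (ht : t ≠ s) (ht1 : t ≠ s + 1) (ht2 : t + 1 ≠ s)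
    (b : Bool) (ξ : Tableau n k) : dcoef r ω s (ξ + step n k t i b) = dcoef r ω s ξ := by
  have e1 : ∀ c ∈ nbs s, Y r ω c.1 c.2 (ξ + step n k t i b) = Y r ω c.1 c.2 ξ := by
    intro c hc
    rw [Y_add_step_other]
    rw [mem_nbs] at hc
    omega
  have e2 : ∀ j, Y r ω s j (ξ + step n k t i b) = Y r ω s j ξ := fun j =>
    Y_add_step_other (fun e => ht e.1.symm) _ _
  rw [dcoef, dcoef, Finset.prod_congr rfl fun c hc => by rw [e1 c hc]]
  simp only [e2]

lemma coef_add_far (hk : k ≠ 0) (s : Fin n) (α : Fin ((s : ℕ) / 2) × Bool) {t i : ℕ}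
    (ht : t ≠ s) (ht1 : t ≠ s + 1) (ht2 : t + 1 ≠ s) (b : Bool) (ξ : Tableau n k) :
    coef r ω (stdRoots r ω) s α (ξ + step n k t i b) = coef r ω (stdRoots r ω) s α ξ := by
  rw [coef, coef, hop_add_far hk s α ht ht1 ht2, Y_add_step_other fun e => ht e.1.symm]

/-- The matrix elements depend only on the row being moved and the two adjacent rows, and the other
operator moves none of these. -/
lemma op_commute (hk : k ≠ 0) (s t : Fin n) (hst : (s : ℕ) + 1 < t) (hs1 : 1 ≤ (s : ℕ)) :
    Commute (op k r ω (stdRoots r ω) s) (op k r ω (stdRoots r ω) t) := by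
  rw [op_eq _ s hs1, op_eq _ t (by omega)]
  refine Commute.add_left (Commute.sum_left _ _ _ fun α _ => ?_) ?_ <;>
    refine Commute.add_right (Commute.sum_right _ _ _ fun β _ => ?_) ?_ <;>
    refine wshift_commute (fun ξ => ?_) fun ξ => ?_
  · exact coef_add_far hk s α (by omega) (by omega) (by omega) _ _
  · exact coef_add_far hk t β (by omega) (by omega) (by omega) _ _
  · rw [add_zero]
  · exact dcoef_add_far t (by omega) (by omega) (by omega) _ _
  · exact dcoef_add_far s (by omega) (by omega) (by omega) _ _
  · rw [add_zero]
  · rw [add_zero]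
  · rw [add_zero]

theorem exists_representation (hh : Admissible (qhalf k r)) (hk : k ≠ 0) (hω : ω.IsGeneric r) :
    ∃ T : Alg (qroot k r) n →ₐ[ℂ] Module.End ℂ (Space n k),
      IsTomega k r ω (stdRoots r ω) T := by
  let f : Fin (n - 1) → Module.End ℂ (Space n k) := fun i =>
    op k r ω (stdRoots r ω) ⟨(i : ℕ) + 1, by omega⟩
  refine ⟨RingQuot.liftAlgHom ℂ ⟨FreeAlgebra.lift ℂ f, ?_⟩, fun i => ?_⟩
  · intro x y hxy
    induction hxy with
    | serre_left i j h =>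
      have := serre_op hh hk hω ⟨(i : ℕ) + 1, by omega⟩ ⟨(j : ℕ) + 1, by omega⟩
        (Or.inl (by simp [h])) (by simp) (by simp)
      simp only [map_add, map_sub, map_mul, map_smul, map_neg, map_pow, FreeAlgebra.lift_ι_apply]
      rw [serre] at this
      simp only [f, sq, ← this, mul_assoc]
    | serre_right i j h =>
      have := serre_op hh hk hω ⟨(j : ℕ) + 1, by omega⟩ ⟨(i : ℕ) + 1, by omega⟩
        (Or.inr (by simp [h])) (by simp) (by simp)
      simp only [map_add, map_sub, map_mul, map_smul, map_neg, map_pow, FreeAlgebra.lift_ι_apply]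
      rw [serre] at this
      simp only [f, sq, ← this, mul_assoc]
      abel
    | comm i j h =>
      simp only [map_mul, FreeAlgebra.lift_ι_apply]
      exact op_commute hk ⟨(i : ℕ) + 1, by omega⟩ ⟨(j : ℕ) + 1, by omega⟩ (by simpa using h)
        (by simp)
  · rw [gen, RingQuot.liftAlgHom_mkAlgHom_apply, FreeAlgebra.lift_ι_apply]

lemma sum_row_lengths (n : ℕ) : ∑ s ∈ Finset.range n, s / 2 = numPosRoots n := by
  induction n with
  | zero => rfl
  | succ m ih =>
    rw [Finset.sum_range_succ, ih, numPosRoots, numPosRoots]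
    obtain ⟨p, rfl | rfl⟩ := m.even_or_odd'
    · rcases p with _ | p
      · rfl
      · rw [show 2 * (p + 1) / 2 = p + 1 by omega, show (2 * (p + 1) - 1) / 2 = p by omega,
          show (2 * (p + 1) + 1) / 2 = p + 1 by omega,
          show (2 * (p + 1) + 1 - 1) / 2 = p + 1 by omega]
        ring
    · rw [show (2 * p + 1) / 2 = p by omega, show (2 * p + 1 - 1) / 2 = p by omega,
        show (2 * p + 1 + 1) / 2 = p + 1 by omega, show (2 * p + 1 + 1 - 1) / 2 = p by omega]
      ring

lemma finrank_space (hk : k ≠ 0) : Module.finrank ℂ (Space n k) = k ^ numPosRoots n := by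
  have : NeZero k := ⟨hk⟩
  rw [Module.finrank_finsupp_self, ← sum_row_lengths, Fintype.card_pi]
  simp only [Fintype.card_pi, ZMod.card, Finset.prod_const, Finset.card_univ, Fintype.card_fin]
  rw [Finset.prod_pow_eq_pow_sum, Finset.sum_range]

end Representation

end UqSo

namespace UqSo

/-! ### Simultaneous diagonal operators in a family of representations -/

section Separation

/-- A subalgebra of the functions on a finite set contains the indicators of the classes of
points that it does not separate. -/
lemma exists_class_indicator {X : Type*} [Finite X] (D : Subalgebra ℂ (X → ℂ)) (x : X) :
    ∃ p ∈ D, p x = 1 ∧ ∀ y, (∃ F ∈ D, F x ≠ F y) → p y = 0 := by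
  classical
  have := Fintype.ofFinite X
  -- For each y there is a normalized function, 1 at x and 0 at y if y can be separated; the product
  -- over all y is the indicator.
  have hF : ∀ y : X, ∃ F ∈ D, F x = 1 ∧ ((∃ F ∈ D, F x ≠ F y) → F y = 0) := by
    intro y
    by_cases h : ∃ F ∈ D, F x ≠ F y
    · obtain ⟨F, hF, hxy⟩ := h
      have hd : F x - F y ≠ 0 := sub_ne_zero.mpr hxy
      refine ⟨(F x - F y)⁻¹ • (F - F y • 1),
        D.smul_mem (D.sub_mem hF (D.smul_mem D.one_mem _)) _, ?_, fun _ => ?_⟩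
      · simp [hd]
      · simp
    · exact ⟨1, D.one_mem, rfl, fun h' => absurd h' h⟩
  choose F hFD hFx hFy using hF
  refine ⟨∏ y, F y, D.prod_mem fun y _ => hFD y, ?_, fun y hy => ?_⟩
  · rw [Finset.prod_apply]
    exact Finset.prod_eq_one fun y _ => hFx y
  · rw [Finset.prod_apply]
    exact Finset.prod_eq_zero (Finset.mem_univ y) (hFy y hy)

variable {A B G : Type*} [Ring A] [Algebra ℂ A] [AddCommGroup G]

/-- The functions on the disjoint union of the bases by which some element of the algebra acts
diagonally in all representations of the family. -/
def diagAlg (T : B → A →ₐ[ℂ] Module.End ℂ (G →₀ ℂ)) : Subalgebra ℂ (B × G → ℂ) where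
  carrier := {F | ∃ a, ∀ b, T b a = wshift (fun ξ => F (b, ξ)) 0}
  mul_mem' := by
    rintro F F' ⟨a, ha⟩ ⟨a', ha'⟩
    refine ⟨a * a', fun b => ?_⟩
    rw [map_mul, ha, ha', wshift_mul, add_zero]
    simp only [add_zero, Pi.mul_apply, mul_comm]
  add_mem' := by
    rintro F F' ⟨a, ha⟩ ⟨a', ha'⟩
    refine ⟨a + a', fun b => ?_⟩
    rw [map_add, ha, ha', wshift_add]
    rfl
  algebraMap_mem' := by
    intro c
    refine ⟨algebraMap ℂ A c, fun b => ?_⟩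
    rw [AlgHom.commutes]
    refine end_ext fun ξ => ?_
    rw [wshift_single, add_zero, Module.algebraMap_end_apply]
    rfl

lemma mem_diagAlg {T : B → A →ₐ[ℂ] Module.End ℂ (G →₀ ℂ)} {F : B × G → ℂ} :
    F ∈ diagAlg T ↔ ∃ a, ∀ b, T b a = wshift (fun ξ => F (b, ξ)) 0 := Iff.rfl

/-- The states that are not separated by the diagonal operators. -/
def Linked (T : B → A →ₐ[ℂ] Module.End ℂ (G →₀ ℂ)) (x y : B × G) : Prop :=
  ∀ F ∈ diagAlg T, F x = F y

/-- Between two projections a sum of weighted shifts reduces to one summand. -/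
lemma wshift_sandwich {κ : Type*} [Fintype κ] (S : κ → G → ℂ) (vec : κ → G) (D p p' : G → ℂ)
    (α : κ) (h0 : ∀ ζ, p ζ * p' ζ = 0) (h : ∀ β, β ≠ α → ∀ ζ, p ζ * p' (ζ + vec β) = 0) :
    wshift p' 0 * (∑ β, wshift (S β) (vec β) + wshift D 0) * wshift p 0
      = wshift (fun ζ => p ζ * p' (ζ + vec α) * S α ζ) (vec α) := by
  classical
  refine end_ext fun ξ => ?_
  simp only [Module.End.mul_apply, LinearMap.add_apply, LinearMap.coe_sum, Finset.sum_apply,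
    wshift_single, map_smul, map_add, map_sum, add_zero, smul_add, Finset.smul_sum, smul_smul]
  have hD : p ξ * (D ξ * p' ξ) = 0 := by rw [mul_left_comm, h0, mul_zero]
  rw [hD, zero_smul, add_zero, Finset.sum_eq_single α]
  · congr 1
    ring
  · intro β _ hβ
    rw [mul_left_comm, h β hβ, mul_zero, zero_smul]
  · exact fun h => absurd (Finset.mem_univ α) h

/-- If linked states agree under `π` and `π` distinguishes the moves of an operator, then the
products of the matrix elements of a move and of its reverse agree at linked states. -/
lemma Linked.back_and_forth [Finite B] [Finite G] {H κ : Type*} [AddCommGroup H] [Fintype κ]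
    {T : B → A →ₐ[ℂ] Module.End ℂ (G →₀ ℂ)} (π : G →+ H)
    (hπ : ∀ x y, Linked T x y → π x.2 = π y.2) (a : A) (S : B → κ → G → ℂ) (D : B → G → ℂ)
    (vec : κ → G) (opp : κ → κ)
    (ha : ∀ b, T b a = ∑ β, wshift (S b β) (vec β) + wshift (D b) 0)
    (hopp : ∀ β, vec (opp β) = -vec β) (hv0 : ∀ β, π (vec β) ≠ 0)
    (hv : Function.Injective fun β => π (vec β))
    (hS : ∀ b β ξ, S b β ξ * S b (opp β) (ξ + vec β) ≠ 0)
    {x y : B × G} (hxy : Linked T x y) (α : κ) :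
    S x.1 α x.2 * S x.1 (opp α) (x.2 + vec α) = S y.1 α y.2 * S y.1 (opp α) (y.2 + vec α) := by
  -- The indicators of the classes of the initial and of the final state of the move. All states of
  -- one class share their image under π, and that isolates the moves `α` and `opp α`.
  obtain ⟨p, hp, hpx, hp0⟩ := exists_class_indicator (diagAlg T) x
  obtain ⟨p', hp', hpx', hp0'⟩ := exists_class_indicator (diagAlg T) (x.1, x.2 + vec α)
  have e1 : ∀ z, p z ≠ 0 → π z.2 = π x.2 := fun z hz => by
    refine (hπ _ _ fun F hF => ?_).symm
    by_contra hne
    exact hz (hp0 z ⟨F, hF, hne⟩)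
  have e2 : ∀ z, p' z ≠ 0 → Linked T (x.1, x.2 + vec α) z := fun z hz F hF => by
    by_contra hne
    exact hz (hp0' z ⟨F, hF, hne⟩)
  have e2' : ∀ z, p' z ≠ 0 → π z.2 = π x.2 + π (vec α) := fun z hz => by
    rw [← map_add]
    exact (hπ _ _ (e2 z hz)).symm
  obtain ⟨a₁, h₁⟩ := mem_diagAlg.mp hp
  obtain ⟨a₂, h₂⟩ := mem_diagAlg.mp hp'
  have s0 : ∀ b ζ, p (b, ζ) * p' (b, ζ) = 0 := by
    intro b ζ
    by_contra hne
    have t1 := e1 _ (left_ne_zero_of_mul hne)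
    rw [e2' _ (right_ne_zero_of_mul hne)] at t1
    exact hv0 α (by simpa using t1)
  have s1 : ∀ b β, β ≠ α → ∀ ζ, p (b, ζ) * p' (b, ζ + vec β) = 0 := by
    intro b β hβ ζ
    by_contra hne
    have t1 := e1 _ (left_ne_zero_of_mul hne)
    have t2 := e2' _ (right_ne_zero_of_mul hne)
    rw [map_add] at t2
    rw [t1] at t2
    exact hβ (hv (add_left_cancel t2))
  have s2 : ∀ b β, β ≠ opp α → ∀ ζ, p' (b, ζ) * p (b, ζ + vec β) = 0 := by
    intro b β hβ ζ
    by_contra hne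
    have t1 := e2' _ (left_ne_zero_of_mul hne)
    have t2 := e1 _ (right_ne_zero_of_mul hne)
    rw [map_add] at t2
    rw [t1, add_assoc, add_eq_left] at t2
    refine hβ (hv ?_)
    simp only [hopp, map_neg]
    exact (neg_eq_of_add_eq_zero_right t2).symm
  have hF : (fun z : B × G => p z * p' (z.1, z.2 + vec α) * S z.1 α z.2
      * (p' (z.1, z.2 + vec α) * p z * S z.1 (opp α) (z.2 + vec α))) ∈ diagAlg T := by
    refine ⟨(a₁ * a * a₂) * (a₂ * a * a₁), fun b => ?_⟩
    simp only [map_mul]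
    rw [h₁, h₂, ha, wshift_sandwich (S b) vec (D b) _ _ (opp α)
      (fun ζ => by rw [mul_comm]; exact s0 b ζ) (s2 b), wshift_sandwich (S b) vec (D b) _ _ α
      (s0 b) (s1 b), wshift_mul, hopp, add_neg_cancel]
    simp only [add_neg_cancel_right]
  have hval := hxy _ hF
  simp only [hpx, hpx', one_mul] at hval
  have hpy : p y = 1 := by rw [← hxy p hp, hpx]
  have hne := hS x.1 α x.2
  -- The common value is nonzero by `hS`, so the moved y lies in the support of `p'`; being linked
  -- to the moved x, it has the value 1 there.
  have hy' : p' (y.1, y.2 + vec α) ≠ 0 := by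
    intro h
    rw [h] at hval
    simp [hne] at hval
  have hpy' : p' (y.1, y.2 + vec α) = 1 := by rw [← e2 _ hy' p' hp', hpx']
  simpa only [hpy, hpy', one_mul] using hval

/-- Two monic polynomials of degree d that agree at d or more points coincide, and hence have the
same roots. -/
lemma exists_eq_of_prod_sub_eq {κ : Type*} [Fintype κ] {d : ℕ} {f g : Fin d → ℂ} {P : κ → ℂ}
    (hP : Function.Injective P) (hd : d ≤ Fintype.card κ)
    (h : ∀ α, ∏ i, (f i - P α) = ∏ i, (g i - P α)) (i : Fin d) : ∃ j, f i = g j := by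
  have hdeg : ∀ f : Fin d → ℂ,
      (∏ i, (Polynomial.X - Polynomial.C (f i))).degree = (d : WithBot ℕ) := by
    intro f
    rw [Polynomial.degree_prod]
    simp
  have hm : ∀ f : Fin d → ℂ, (∏ i, (Polynomial.X - Polynomial.C (f i))).Monic := fun f =>
    Polynomial.monic_prod_of_monic _ _ fun i _ => Polynomial.monic_X_sub_C _
  have heq : ∏ i, (Polynomial.X - Polynomial.C (f i))
      = ∏ i, (Polynomial.X - Polynomial.C (g i)) := by
    refine Polynomial.eq_of_degree_sub_lt_of_eval_index_eq (v := P) Finset.univ hP.injOn ?_ ?_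
    · refine (Polynomial.degree_sub_lt_left ?_ (hm f).ne_zero ?_).trans_le ?_
      · rw [hdeg, hdeg]
      · rw [(hm f).leadingCoeff, (hm g).leadingCoeff]
      · rw [hdeg]
        exact_mod_cast hd
    · intro α _
      rw [Polynomial.eval_prod, Polynomial.eval_prod]
      simp only [Polynomial.eval_sub, Polynomial.eval_X, Polynomial.eval_C]
      have e : ∀ f : Fin d → ℂ, ∏ i, (P α - f i) = (-1) ^ d * ∏ i, (f i - P α) := by
        intro f
        rw [← Fin.prod_const, ← Finset.prod_mul_distrib]
        exact Finset.prod_congr rfl fun i _ => by ring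
      rw [e, e, h α]
  have hr : (∏ i, (Polynomial.X - Polynomial.C (g i))).eval (f i) = 0 := by
    rw [← heq, Polynomial.eval_prod]
    exact Finset.prod_eq_zero (Finset.mem_univ i) (by simp)
  rw [Polynomial.eval_prod, Finset.prod_eq_zero_iff] at hr
  obtain ⟨j, -, hj⟩ := hr
  refine ⟨j, ?_⟩
  simpa [sub_eq_zero] using hj

end Separation

end UqSo

namespace UqSo

/-! ### Separation of the tableaux -/

section Tableaux

variable {n k : ℕ} {r : ℤ} {ω : Params n}

lemma wt_ne_zero {h : ℂ} (hh : Admissible h) {s : ℕ} {y : ℂ} (hy : Indep h y)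
    (hy2 : Indep h (y ^ 2)) : wt h s y ≠ 0 := by
  have e := hy2.br_ne_zero hh 0
  rw [zpow_zero, mul_one] at e
  rw [wt]
  split_ifs
  · rw [br_sq_arg h hy.1] at e
    exact inv_ne_zero (right_ne_zero_of_mul e)
  · exact inv_ne_zero (mul_ne_zero e (hy.br_ne_zero' hh 1 (by rw [zpow_one])))

lemma wt_mul_wt_ne_zero (hh : Admissible (qhalf k r)) (hk : k ≠ 0) (hω : ω.IsGeneric r)
    (s : Fin n) (α : Fin ((s : ℕ) / 2) × Bool) (ξ : Tableau n k) :
    wt (qhalf k r) s (sgn α.2 (Y r ω s α.1 ξ))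
      * wt (qhalf k r) s (sgn α.2 (Y r ω s α.1 ξ) * qhalf k r ^ 2)⁻¹ ≠ 0 := by
  have h1 := (indep_single hk hω s.2.le α.1.2 ξ).sgn α.2
  have h2 := indep_sq hk hω s α.1 α.2 ξ
  have h3 := h1.mul_zpow hh.ne_zero 2
  have h4 := h2.mul_zpow hh.ne_zero 4
  norm_cast at h3 h4
  rw [show sgn α.2 (Y r ω s α.1 ξ) ^ 2 * qhalf k r ^ 4
    = (sgn α.2 (Y r ω s α.1 ξ) * qhalf k r ^ 2) ^ 2 by ring] at h4
  refine mul_ne_zero (wt_ne_zero hh h1 h2) (wt_ne_zero hh h3.inv ?_)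
  rw [inv_pow]
  exact h4.inv

lemma dd_sgn_ne_zero (hh : Admissible (qhalf k r)) (hk : k ≠ 0) (hω : ω.IsGeneric r) {s i j : ℕ}
    (hs : s < n) (hi : i < s / 2) (hj : j < s / 2) (hij : i ≠ j) (b : Bool) (ξ ζ : Tableau n k) :
    dd (qhalf k r) (Y r ω s i ξ) (sgn b (Y r ω s j ζ)) ≠ 0 := by
  have := indep_sgn_sgn (indep_mul hk (hω.base_add hs hi hj) ξ ζ)
    (indep_div hk (hω.base_sub hs hi hj hij) ξ ζ) true b
  exact dd_ne_zero hh this.1 this.2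

lemma radU_ne_zero (hh : Admissible (qhalf k r)) (hk : k ≠ 0) (hω : ω.IsGeneric r)
    (s : Fin n) (α : Fin ((s : ℕ) / 2) × Bool) (ξ : Tableau n k) :
    radU r ω s α.1 ξ (sgn α.2 (Y r ω s α.1 ξ)) ≠ 0 :=
  div_ne_zero
    (Finset.prod_ne_zero_iff.mpr fun _ hc => gg_sgn_ne_zero hh hk hω s.2 α.1.2 hc α.2 ξ ξ)
    (Finset.prod_ne_zero_iff.mpr fun i hi => dd_sgn_ne_zero hh hk hω s.2 i.2 α.1.2
      (fun e => Finset.ne_of_mem_erase hi (Fin.ext e)) α.2 ξ ξ)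

lemma coef_mul_coef_back_ne_zero (hh : Admissible (qhalf k r)) (hk : k ≠ 0) (hω : ω.IsGeneric r)
    {R : Roots n k} (hR : IsRootChoice k r ω R) (s : Fin n) (α : Fin ((s : ℕ) / 2) × Bool)
    (ξ : Tableau n k) :
    coef r ω R s α ξ * coef r ω R s (α.1, !α.2) (ξ + step n k s α.1 α.2) ≠ 0 := by
  rw [coef_mul_coef_back hk hω hR]
  exact neg_ne_zero.mpr (mul_ne_zero (radU_ne_zero hh hk hω s α ξ)
    (wt_mul_wt_ne_zero hh hk hω s α ξ))

/-- The row `s` of a tableau. -/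
def rowHom (n k : ℕ) (s : Fin n) : Tableau n k →+ (Fin ((s : ℕ) / 2) → ZMod k) :=
  Pi.evalAddMonoidHom _ s

lemma rowHom_step (s : Fin n) (j i : Fin ((s : ℕ) / 2)) (b : Bool) :
    rowHom n k s (step n k s j b) i = if i = j then (if b then 1 else -1) else 0 := by
  simp [rowHom, step, ev, Fin.ext_iff]

lemma one_ne_neg_one (hk : Odd k) (hk1 : 1 < k) : (1 : ZMod k) ≠ -1 := by
  intro e
  have h2 : ((2 : ℕ) : ZMod k) = 0 := by
    push_cast
    linear_combination e
  rw [ZMod.natCast_eq_zero_iff] at h2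
  have := Nat.le_of_dvd (by norm_num) h2
  obtain ⟨c, hc⟩ := hk
  omega

lemma rowHom_step_ne_zero (hk1 : 1 < k) (s : Fin n)
    (α : Fin ((s : ℕ) / 2) × Bool) : rowHom n k s (step n k s α.1 α.2) ≠ 0 := by
  have : Fact (1 < k) := ⟨hk1⟩
  intro e
  have := congrFun e α.1
  rw [rowHom_step, if_pos rfl, Pi.zero_apply] at this
  cases h : α.2 <;> simp [h] at this

/-- The two directions at one place differ because 1 ≠ -1 modulo an odd k > 1. -/
lemma rowHom_step_injective (hk : Odd k) (hk1 : 1 < k) (s : Fin n) :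
    Function.Injective fun α : Fin ((s : ℕ) / 2) × Bool =>
      rowHom n k s (step n k s α.1 α.2) := by
  have : Fact (1 < k) := ⟨hk1⟩
  have h1 := one_ne_neg_one hk hk1
  rintro ⟨j, b⟩ ⟨j', b'⟩ e
  have e' := congrFun e j
  simp only [rowHom_step, if_true] at e'
  by_cases hj : j = j'
  · subst hj
    rw [if_pos rfl] at e'
    cases b <;> cases b' <;> simp_all
  · rw [if_neg hj] at e'
    cases b <;> simp at e'

variable {B : Type*}

/-- The coordinates in the row `t` determine the entries, also for different parameters. -/
structure SeparatedRow (r : ℤ) (ω : B → Params n) (t : ℕ) : Prop where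
  add : ∀ b b' i j, i < t / 2 → j < t / 2 → OffLattice r (base (ω b) t i + base (ω b') t j)
  sub : ∀ b b' i j, i < t / 2 → j < t / 2 → i ≠ j →
    OffLattice r (base (ω b) t i - base (ω b') t j)
  int : ∀ b b' i, i < t / 2 → ∃ d : ℤ, base (ω b) t i = base (ω b') t i + d

lemma Indep.rho_ne {h z w : ℂ} (h1 : Indep h (z * w)) (h2 : (z / w) ^ 2 ≠ 1) : rho z ≠ rho w := by
  have hz : z ≠ 0 := left_ne_zero_of_mul h1.1
  have hw : w ≠ 0 := right_ne_zero_of_mul h1.1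
  intro e
  have h3 : (z * w) ^ 2 ≠ 1 := by simpa using h1.2 0
  rw [rho, rho] at e
  have h4 : (z ^ 2 - w ^ 2) * ((z * w) ^ 2 - 1) = 0 := by
    field_simp at e
    linear_combination e
  rcases mul_eq_zero.mp h4 with h5 | h5
  · apply h2
    rw [div_pow, div_eq_one_iff_eq (pow_ne_zero 2 hw)]
    linear_combination h5
  · exact h3 (by linear_combination h5)

/-- Equal `rho` means z = ±w or z = ±w⁻¹. The sums being off the lattice excludes the inverse, the
differences exclude distinct places, and oddness of k excludes the sign. -/
lemma SeparatedRow.eq_of_rho_eq {ω : B → Params n} {t : ℕ} (hsep : SeparatedRow r ω t)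
    (hk : Odd k) (hr : IsCoprime r (k : ℤ)) {b b' : B} {i j : ℕ} (hi : i < t / 2) (hj : j < t / 2)
    {ξ ξ' : Tableau n k} (e : rho (Y r (ω b) t i ξ) = rho (Y r (ω b') t j ξ')) :
    Y r (ω b) t i ξ = Y r (ω b') t i ξ' := by
  have hk0 : k ≠ 0 := hk.pos.ne'
  have h0 := qhalf_ne_zero k r
  have e2 : (Y r (ω b) t i ξ / Y r (ω b') t j ξ') ^ 2 = 1 := by
    by_contra hne
    exact (indep_mul hk0 (hsep.add b b' i j hi hj) ξ ξ').rho_ne hne e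
  by_cases hij : i = j
  · subst hij
    obtain ⟨d, hd⟩ := hsep.int b b' i hi
    have e3 : Y r (ω b) t i ξ / Y r (ω b') t i ξ'
        = (qhalf k r ^ 2) ^ (d + (ent ξ t i).val - (ent ξ' t i).val : ℤ) := by
      have := qpow_ne_zero k r (base (ω b') t i)
      have := qv_ne_zero k r (ent ξ' t i)
      have h2 : qhalf k r ^ 2 ≠ 0 := pow_ne_zero _ h0
      have := zpow_ne_zero (lshift t i) h0
      rw [Y, Y, hd, qpow_add, ← qroot_zpow, zpow_sub₀ h2, zpow_add₀ h2, zpow_natCast,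
        zpow_natCast, qv, qv]
      field_simp
    rw [e3, ← zpow_natCast, ← zpow_mul, qroot_zpow_eq_one_iff hk0 hr] at e2
    -- q^(2m) = 1 implies q^m = 1, as 2 is invertible modulo the odd number k.
    have e4 : (k : ℤ) ∣ d + (ent ξ t i).val - (ent ξ' t i).val := by
      refine IsCoprime.dvd_of_dvd_mul_right ?_ e2
      obtain ⟨c, hc⟩ := hk
      exact ⟨1, -c, by push_cast [hc]; ring⟩
    rw [← qroot_zpow_eq_one_iff hk0 hr, ← e3, div_eq_one_iff_eq (Y_ne_zero _ _ _)] at e4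
    exact e4
  · exact absurd e2 (by simpa using (indep_div hk0 (hsep.sub b b' i j hi hj hij) ξ ξ').2 0)

end Tableaux

end UqSo

namespace UqSo

/-! ### Irreducibility and nonequivalence -/

section Irreducibility

variable {n k : ℕ} {r : ℤ} {B : Type*}

lemma separatedRow_of_lt {ω : B → Params n} (hω : ∀ b, (ω b).IsGeneric r)
    (hsame : ∀ b b', (ω b).h = (ω b').h) {t : ℕ} (ht : t < n) : SeparatedRow r ω t := by
  have e : ∀ b b' i, base (ω b) t i = base (ω b') t i := by
    intro b b' i
    rw [base, base]
    simp only [ht, dite_true, hsame b b']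
  refine ⟨fun b b' i j hi hj => ?_, fun b b' i j hi hj hij => ?_, fun b b' i _ => ⟨0, ?_⟩⟩
  · rw [e b' b]
    exact (hω b).base_add ht hi hj
  · rw [e b' b]
    exact (hω b).base_sub ht hi hj hij
  · rw [e b b', Int.cast_zero, add_zero]

lemma Y_eq_iff_ent_eq (hk : k ≠ 0) (hr : IsCoprime r (k : ℤ)) {ω ω' : Params n}
    (h : ω.h = ω'.h) {s : ℕ} (hs : s < n) (j : ℕ) (ξ ξ' : Tableau n k) :
    Y r ω s j ξ = Y r ω' s j ξ' ↔ ent ξ s j = ent ξ' s j := by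
  have e : base ω s j = base ω' s j := by
    rw [base, base]
    simp only [hs, dite_true, h]
  rw [Y, Y, e]
  refine ⟨fun h' => qv_injective hk hr (mul_left_cancel₀ ?_ h'), fun h' => by rw [h']⟩
  exact mul_ne_zero (qpow_ne_zero _ _ _) (zpow_ne_zero _ (qhalf_ne_zero _ _))

lemma dcoef_one (hn : 1 < n) (ω : Params n) (ξ : Tableau n k) :
    dcoef r ω ⟨1, hn⟩ ξ = Complex.I * br (qhalf k r) (Y r ω 2 0 ξ) := by
  rw [dcoef, if_neg (by simp), prod_nbs]
  have e0 : ∀ (m : ℕ) (_ : m = 0) (f : Fin m → ℂ), ∏ i, f i = 1 := by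
    rintro _ rfl f
    exact Fin.prod_univ_zero f
  have e1 : ∀ (m : ℕ) (_ : m = 1) (f : ℕ → ℂ), ∏ i : Fin m, f i = f 0 := by
    rintro _ rfl f
    exact Fin.prod_univ_one _
  refine congrArg (Complex.I * ·) ((congrArg₂ (· / ·) (congrArg₂ (· * ·)
    (e1 _ (by simp) fun i => br (qhalf k r) (Y r ω 2 i ξ)) (e0 _ (by simp) _))
    (e0 _ (by simp) _)).trans ?_)
  rw [mul_one, div_one]

lemma IsTomega.apply_gen {ω : Params n} {R : Roots n k}
    {T : Alg (qroot k r) n →ₐ[ℂ] Module.End ℂ (Space n k)} (hT : IsTomega k r ω R T)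
    (s : Fin n) (hs : 1 ≤ (s : ℕ)) :
    T (gen (qroot k r) n ⟨(s : ℕ) - 1, by omega⟩) = op k r ω R s := by
  rw [hT]
  congr 1
  exact Fin.ext (Nat.sub_add_cancel hs)

/-- From the products of the matrix elements of a move and its reverse one reads off the
coordinates in the row above. -/
lemma Y_next_eq (hk : Odd k) (hh : Admissible (qhalf k r)) (hr : IsCoprime r (k : ℤ))
    {ω : B → Params n} (hω : ∀ b, (ω b).IsGeneric r) {R : B → Roots n k}
    (hR : ∀ b, IsRootChoice k r (ω b) (R b)) (s : Fin n) (hs : 2 ≤ (s : ℕ))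
    (hsep : SeparatedRow r ω (s + 1)) {x y : B × Tableau n k}
    (h0 : ∀ j < (s : ℕ) / 2, Y r (ω x.1) s j x.2 = Y r (ω y.1) s j y.2)
    (h1 : ∀ j < ((s : ℕ) - 1) / 2, Y r (ω x.1) (s - 1) j x.2 = Y r (ω y.1) (s - 1) j y.2)
    (hc : ∀ α : Fin ((s : ℕ) / 2) × Bool, coef r (ω x.1) (R x.1) s α x.2
        * coef r (ω x.1) (R x.1) s (α.1, !α.2) (x.2 + step n k s α.1 α.2)
      = coef r (ω y.1) (R y.1) s α y.2
        * coef r (ω y.1) (R y.1) s (α.1, !α.2) (y.2 + step n k s α.1 α.2))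
    (i : ℕ) (hi : i < ((s : ℕ) + 1) / 2) :
    Y r (ω x.1) (s + 1) i x.2 = Y r (ω y.1) (s + 1) i y.2 := by
  have hk0 : k ≠ 0 := hk.pos.ne'
  have hprod : ∀ α : Fin ((s : ℕ) / 2) × Bool,
      ∏ i : Fin (((s : ℕ) + 1) / 2),
        (rho (Y r (ω x.1) (s + 1) i x.2) - rho (sgn α.2 (Y r (ω x.1) s α.1 x.2) * qhalf k r))
      = ∏ i : Fin (((s : ℕ) + 1) / 2),
        (rho (Y r (ω y.1) (s + 1) i y.2)
          - rho (sgn α.2 (Y r (ω x.1) s α.1 x.2) * qhalf k r)) := by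
    intro α
    have e := hc α
    have nw := wt_mul_wt_ne_zero hh hk0 (hω x.1) s α x.2
    -- The weights, the row s and the row s - 1 agree on both sides and are nonzero, so they cancel;
    -- only the factors from the row s + 1 are left.
    rw [coef_mul_coef_back hk0 (hω _) (hR _), coef_mul_coef_back hk0 (hω _) (hR _), neg_inj,
      ← h0 α.1 α.1.2, mul_left_inj' nw, radU, radU, prod_nbs, prod_nbs] at e
    have nd : ∏ i ∈ Finset.univ.erase α.1, dd (qhalf k r) (Y r (ω x.1) s i x.2)
        (sgn α.2 (Y r (ω x.1) s α.1 x.2)) ≠ 0 :=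
      Finset.prod_ne_zero_iff.mpr fun i hi => dd_sgn_ne_zero hh hk0 (hω x.1) s.2 i.2 α.1.2
        (fun e => Finset.ne_of_mem_erase hi (Fin.ext e)) α.2 x.2 x.2
    have nl : ∏ i : Fin (((s : ℕ) - 1) / 2), gg (qhalf k r) (Y r (ω x.1) (s - 1) i x.2)
        (sgn α.2 (Y r (ω x.1) s α.1 x.2)) ≠ 0 :=
      Finset.prod_ne_zero_iff.mpr fun i _ => gg_sgn_ne_zero hh hk0 (hω x.1) s.2 α.1.2
        (c := ((s : ℕ) - 1, (i : ℕ))) (mem_nbs.mpr ⟨Or.inr rfl, i.2⟩) α.2 x.2 x.2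
    have el : ∏ i : Fin (((s : ℕ) - 1) / 2), gg (qhalf k r) (Y r (ω y.1) (s - 1) i y.2)
        (sgn α.2 (Y r (ω x.1) s α.1 x.2)) = _ :=
      Finset.prod_congr rfl fun i _ => by rw [← h1 i i.2]
    have ed : ∏ i ∈ Finset.univ.erase α.1, dd (qhalf k r) (Y r (ω y.1) s i y.2)
        (sgn α.2 (Y r (ω x.1) s α.1 x.2)) = _ :=
      Finset.prod_congr rfl fun i _ => by rw [← h0 i i.2]
    simp only at e el
    rw [el, ed, div_left_inj' nd, mul_left_inj' nl] at e
    have hu := sgn_ne_zero α.2 (Y_ne_zero (r := r) (ω := ω x.1) s α.1 x.2)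
    simp only [← kap_mul_gg hh (Y_ne_zero _ _ _) hu, Finset.prod_mul_distrib]
    rw [e]
  -- There are 2⌊s/2⌋ nodes against ⌊(s+1)/2⌋ unknowns, which suffices for s ≥ 2.
  obtain ⟨j, hj⟩ := exists_eq_of_prod_sub_eq (points_injective hh hk0 (hω x.1) s x.2)
    (by simp only [Fintype.card_prod, Fintype.card_fin, Fintype.card_bool]; omega) hprod ⟨i, hi⟩
  exact hsep.eq_of_rho_eq hk hr hi j.2 hj

/-- Linked tableaux agree in all rows. -/
lemma Linked.Y_eq [Finite B] (hn : 2 ≤ n) (hk : Odd k) (hk1 : 1 < k) (hr : IsCoprime r (k : ℤ))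
    {ω : B → Params n} (hω : ∀ b, (ω b).IsGeneric r)
    (hsame : ∀ b b', (ω b).h = (ω b').h) {R : B → Roots n k}
    (hR : ∀ b, IsRootChoice k r (ω b) (R b))
    {T : B → Alg (qroot k r) n →ₐ[ℂ] Module.End ℂ (Space n k)}
    (hT : ∀ b, IsTomega k r (ω b) (R b) (T b)) (t : ℕ) (ht : t ≤ n) (hsep : SeparatedRow r ω t)
    {x y : B × Tableau n k} (hxy : Linked T x y) (i : ℕ) (hi : i < t / 2) :
    Y r (ω x.1) t i x.2 = Y r (ω y.1) t i y.2 := by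
  have hk0 : k ≠ 0 := hk.pos.ne'
  have hh := admissible_qhalf hk hk1 hr
  have : NeZero k := ⟨hk0⟩
  induction t using Nat.strong_induction_on generalizing x y i with
  | _ t ih =>
  rcases Nat.lt_or_ge t 3 with h3 | h3
  · obtain rfl : t = 2 := by omega
    obtain rfl : i = 0 := by omega
    -- Row 1 is empty, so I_21 has no moves and is itself diagonal, with eigenvalues i[l_{1,2}].
    have hF : (fun z : B × Tableau n k =>
        Complex.I * br (qhalf k r) (Y r (ω z.1) 2 0 z.2)) ∈ diagAlg T := by
      refine ⟨gen (qroot k r) n ⟨0, by omega⟩, fun b => ?_⟩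
      rw [hT b, op_eq _ _ le_rfl]
      have : IsEmpty (Fin ((⟨0 + 1, by omega⟩ : Fin n) / 2 : ℕ) × Bool) := ⟨fun α => by
        have := α.1.2
        simp at this⟩
      rw [Finset.univ_eq_empty, Finset.sum_empty, zero_add]
      congr 1
      funext ξ
      exact dcoef_one (by omega) (ω b) ξ
    have e := mul_left_cancel₀ Complex.I_ne_zero (hxy _ hF)
    refine hsep.eq_of_rho_eq hk hr hi hi ?_
    have e1 := rho_sub_two hh (Y_ne_zero (r := r) (ω := ω x.1) 2 0 x.2)
    have e2 := rho_sub_two hh (Y_ne_zero (r := r) (ω := ω y.1) 2 0 y.2)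
    rw [e] at e1
    linear_combination e1 - e2
  -- All linked pairs are needed here, not only the given one: this says that the row s is constant
  -- on the classes.
  · have hlow : ∀ s < t, ∀ x y, Linked T x y → ∀ j < s / 2,
        Y r (ω x.1) s j x.2 = Y r (ω y.1) s j y.2 := fun s hs x y hxy j hj =>
      ih s hs (by omega) (separatedRow_of_lt hω hsame (by omega)) hxy j hj
    obtain ⟨s, rfl⟩ : ∃ s, t = s + 1 := ⟨t - 1, by omega⟩
    have hs : s < n := ht
    refine Y_next_eq hk hh hr hω hR ⟨s, hs⟩ (by simp only; omega) hsep
      (hlow s (by omega) x y hxy) (hlow (s - 1) (by omega) x y hxy) (fun α => ?_) i hi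
    refine hxy.back_and_forth (rowHom n k ⟨s, hs⟩) (fun u v huv => ?_)
      (gen (qroot k r) n ⟨s - 1, by omega⟩) (fun b => coef r (ω b) (R b) ⟨s, hs⟩)
      (fun b => dcoef r (ω b) ⟨s, hs⟩) (fun β => step n k s β.1 β.2) (fun β => (β.1, !β.2))
      (fun b => ?_) (fun β => step_not _ _ _) (rowHom_step_ne_zero hk1 ⟨s, hs⟩)
      (rowHom_step_injective hk hk1 ⟨s, hs⟩)
      (fun b β ξ => coef_mul_coef_back_ne_zero hh hk0 (hω b) (hR b) ⟨s, hs⟩ β ξ) α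
    · funext j
      have := hlow s (by omega) u v huv j j.2
      rw [Y_eq_iff_ent_eq hk0 hr (hsame _ _) hs] at this
      have hj : (j : ℕ) < s / 2 := j.2
      simp only [ent, hs, hj, and_self, dite_true] at this
      exact this
    · rw [← op_eq _ _ (by simp only; omega)]
      exact (hT b).apply_gen ⟨s, hs⟩ (by simp only; omega)

lemma step_sum_eq [NeZero k] (ζ : Tableau n k) :
    ∑ s : Fin n, ∑ j : Fin ((s : ℕ) / 2), (ζ s j).val • step n k s j true = ζ := by
  funext s j
  simp only [Finset.sum_apply, Pi.smul_apply, step, ev, if_true]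
  rw [Finset.sum_eq_single s, Finset.sum_eq_single j]
  · simp
  · intro j' _ hj
    rw [if_neg fun e => hj (Fin.ext e.2.symm), smul_zero]
  · simp
  · intro s' _ hs
    refine Finset.sum_eq_zero fun j' _ => ?_
    rw [if_neg fun e => hs (Fin.ext e.1.symm), smul_zero]
  · simp

/-- A set of tableaux that is closed under the positive unit steps is empty or everything. -/
lemma mem_of_step_closed (hk : k ≠ 0) {S : Set (Tableau n k)} {ξ : Tableau n k} (hξ : ξ ∈ S)
    (hS : ∀ ζ ∈ S, ∀ (s : Fin n) (j : Fin ((s : ℕ) / 2)), ζ + step n k s j true ∈ S)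
    (η : Tableau n k) : η ∈ S := by
  have : NeZero k := ⟨hk⟩
  let P : AddSubmonoid (Tableau n k) :=
    { carrier := {g | ∀ ζ ∈ S, ζ + g ∈ S}
      zero_mem' := fun ζ hζ => by rwa [add_zero]
      add_mem' := fun {a b} ha hb ζ hζ => by
        rw [← add_assoc]
        exact hb _ (ha ζ hζ) }
  -- The steps have finite order, so positive ones already generate all translations.
  have hP : η - ξ ∈ P := by
    rw [← step_sum_eq (η - ξ)]
    exact P.sum_mem fun s _ => P.sum_mem fun j _ => P.nsmul_mem (fun ζ hζ => hS ζ hζ s j) _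
  have := hP ξ hξ
  rwa [add_sub_cancel] at this

/-- The projections on the lines of the basis belong to the image of the algebra. -/
lemma exists_projection (hn : 2 ≤ n) (hk : Odd k) (hk1 : 1 < k) (hr : IsCoprime r (k : ℤ))
    {ω : Params n} (hω : ω.IsGeneric r) {R : Roots n k} (hR : IsRootChoice k r ω R)
    {T : Alg (qroot k r) n →ₐ[ℂ] Module.End ℂ (Space n k)} (hT : IsTomega k r ω R T)
    (ξ : Tableau n k) : ∃ a p, T a = wshift p 0 ∧ p ξ = 1 ∧ ∀ ζ, ζ ≠ ξ → p ζ = 0 := by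
  have hk0 : k ≠ 0 := hk.pos.ne'
  have : NeZero k := ⟨hk0⟩
  obtain ⟨p, ⟨a, ha⟩, hp1, hp0⟩ := exists_class_indicator (diagAlg fun _ : Unit => T) ((), ξ)
  refine ⟨a, fun ζ => p ((), ζ), ha (), hp1, fun ζ hζ => hp0 _ ?_⟩
  by_contra! hl
  apply hζ
  refine tableau_ext fun s j hs hj => ?_
  have := Linked.Y_eq hn hk hk1 hr (ω := fun _ : Unit => ω) (fun _ => hω) (fun _ _ => rfl)
    (R := fun _ => R) (fun _ => hR) (fun _ => hT) s hs.le
    (separatedRow_of_lt (fun _ => hω) (fun _ _ => rfl) hs) hl j hj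
  exact ((Y_eq_iff_ent_eq hk0 hr rfl hs j _ _).mp this).symm

/-- The projections put a basis vector into any nonzero invariant subspace; the nonvanishing matrix
elements of the positive moves then reach all the others. -/
theorem isIrreducibleRep (hn : 2 ≤ n) (hk : Odd k) (hk1 : 1 < k) (hr : IsCoprime r (k : ℤ))
    {ω : Params n} (hω : ω.IsGeneric r) {R : Roots n k} (hR : IsRootChoice k r ω R)
    {T : Alg (qroot k r) n →ₐ[ℂ] Module.End ℂ (Space n k)} (hT : IsTomega k r ω R T) :
    IsIrreducibleRep T := by
  have hk0 : k ≠ 0 := hk.pos.ne'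
  have hh := admissible_qhalf hk hk1 hr
  refine ⟨inferInstance, fun W hW => or_iff_not_imp_left.mpr fun hne => ?_⟩
  choose a p ha hp1 hp0 using exists_projection hn hk hk1 hr hω hR hT
  have hproj : ∀ ξ (v : Space n k), T (a ξ) v = v ξ • ket ξ := by
    intro ξ v
    rw [ha]
    induction v using Finsupp.induction_linear with
    | zero => simp
    | add v w hv hw => rw [map_add, hv, hw, Finsupp.add_apply, add_smul]
    | single ζ c =>
      rw [show Finsupp.single ζ c = c • Finsupp.single ζ (1 : ℂ) by simp, map_smul, wshift_single,
        add_zero, Finsupp.smul_apply]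
      by_cases hζ : ζ = ξ
      · subst hζ
        simp [hp1, ket]
      · simp [hp0 ξ ζ hζ, hζ]
  obtain ⟨v, hvW, hv⟩ := W.ne_bot_iff.mp hne
  obtain ⟨ξ, hξ⟩ := Finsupp.ne_iff.mp hv
  have hket : ∀ (ξ : Tableau n k), ∀ v ∈ W, v ξ ≠ 0 → ket ξ ∈ W := by
    intro ξ v hv hvξ
    have := hW (a ξ) v hv
    rw [hproj] at this
    exact (W.smul_mem_iff hvξ).mp this
  have hall : ∀ η : Tableau n k, ket η ∈ W := by
    refine mem_of_step_closed (S := {ξ | ket ξ ∈ W}) hk0 (hket ξ v hvW hξ) fun ζ hζ s j => ?_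
    have hs1 : 1 ≤ (s : ℕ) := by have := j.2; omega
    have hmem := hW (gen (qroot k r) n ⟨(s : ℕ) - 1, by omega⟩) _ hζ
    refine hket _ _ hmem ?_
    rw [hT.apply_gen s hs1, op_eq _ s hs1]
    simp only [ket, LinearMap.add_apply, LinearMap.coe_sum, Finset.sum_apply, wshift_single,
      Finsupp.add_apply, Finsupp.finsetSum_apply, Finsupp.smul_apply, add_zero]
    -- Different moves lead to different tableaux and none leads back to `ζ`, so this coordinate is
    -- a single matrix element.
    rw [Finset.sum_eq_single (j, true), Finsupp.single_eq_same, Finsupp.single_eq_of_ne,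
      smul_zero, add_zero, smul_eq_mul, mul_one]
    · exact left_ne_zero_of_mul (coef_mul_coef_back_ne_zero hh hk0 hω hR s (j, true) ζ)
    · intro e
      apply rowHom_step_ne_zero hk1 s (j, true)
      rw [show step n k s j true = 0 by simpa using e, map_zero]
    · intro β _ hβ
      rw [Finsupp.single_eq_of_ne, smul_zero]
      intro e
      apply hβ
      apply rowHom_step_injective hk hk1 s
      simp only
      rw [add_left_cancel e]
    · simp
  rw [eq_top_iff]
  intro v _
  induction v using Finsupp.induction_linear with
  | zero => exact W.zero_mem
  | add v w hv hw => exact W.add_mem (hv trivial) (hw trivial)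
  | single ζ c =>
    rw [show Finsupp.single ζ c = c • ket ζ by simp [ket]]
    exact W.smul_mem c (hall ζ)

end Irreducibility

end UqSo

namespace UqSo

/-! ### Nonequivalence for different top rows -/

section Nonequivalence

variable {n k : ℕ} {r : ℤ} {ω : Params n}

lemma OffLattice.sub_int {x : ℂ} (hx : OffLattice r x) (d : ℤ) : OffLattice r (x - d) := by
  intro t ht
  apply hx (t + 2 * r * d)
  push_cast
  linear_combination ht

lemma OffLattice.add_int {x : ℂ} (hx : OffLattice r x) (d : ℤ) : OffLattice r (x + d) := by
  simpa using hx.sub_int (-d)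

/-- A shift of the top row by integers preserves the genericity. -/
lemma Params.IsGeneric.replace_top (hω : ω.IsGeneric r) {m' : Fin (n / 2) → ℂ}
    (hm : ∀ i, ∃ d : ℤ, ω.m i = m' i + d) : ({ ω with m := m' } : Params n).IsGeneric r where
  c_ne_zero := hω.c_ne_zero
  top i := by
    obtain ⟨d, hd⟩ := hm i
    simpa [hd] using (hω.top i).sub_int d
  row := hω.row
  row_sub := hω.row_sub
  row_add := hω.row_add
  next_sub := hω.next_sub
  next_add := hω.next_add
  top_sub s hs i j := by
    obtain ⟨d, hd⟩ := hm j
    have := (hω.top_sub s hs i j).add_int d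
    rw [hd] at this
    convert this using 1
    simp only
    ring
  top_add s hs i j := by
    obtain ⟨d, hd⟩ := hm j
    have := (hω.top_add s hs i j).sub_int d
    rw [hd] at this
    convert this using 1
    simp only
    ring

lemma base_top (ω : Params n) (j : Fin (n / 2)) : base ω n j = ω.m j := by
  simp [base]

lemma separatedRow_top {B : Type*} {ω' : B → Params n} (hω : ω.IsTopGeneric r)
    (hm : ∀ b i, ∃ d : ℤ, (ω' b).m i = ω.m i + d) : SeparatedRow r ω' n := by
  refine ⟨fun b b' i j hi hj => ?_, fun b b' i j hi hj hij => ?_, fun b b' i hi => ?_⟩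
  · obtain ⟨d, hd⟩ := hm b ⟨i, hi⟩
    obtain ⟨d', hd'⟩ := hm b' ⟨j, hj⟩
    have := ((hω.add ⟨i, hi⟩ ⟨j, hj⟩).add_int d).add_int d'
    rw [base_top (ω' b) ⟨i, hi⟩, base_top (ω' b') ⟨j, hj⟩, hd, hd']
    convert this using 1
    ring
  · obtain ⟨d, hd⟩ := hm b ⟨i, hi⟩
    obtain ⟨d', hd'⟩ := hm b' ⟨j, hj⟩
    have := ((hω.sub ⟨i, hi⟩ ⟨j, hj⟩ (by simpa using hij)).add_int d).sub_int d'
    rw [base_top (ω' b) ⟨i, hi⟩, base_top (ω' b') ⟨j, hj⟩, hd, hd']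
    convert this using 1
    ring
  · obtain ⟨d, hd⟩ := hm b ⟨i, hi⟩
    obtain ⟨d', hd'⟩ := hm b' ⟨i, hi⟩
    refine ⟨d - d', ?_⟩
    rw [base_top (ω' b) ⟨i, hi⟩, base_top (ω' b') ⟨i, hi⟩, hd, hd']
    push_cast
    ring

/-- Both representations form one family over `Bool`, and the separation argument is carried one row
further, to the top row, where the two members differ. -/
theorem not_areEquivalent (hn : 2 ≤ n) (hk : Odd k) (hk1 : 1 < k) (hr : IsCoprime r (k : ℤ))
    (hω : ω.IsGeneric r) (htop : ω.IsTopGeneric r) {m' : Fin (n / 2) → ℂ} (hne : m' ≠ ω.m)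
    (hm : ∀ i, ∃ d : ℤ, |d| < (k : ℤ) ∧ ω.m i - m' i = d) {R R' : Roots n k}
    (hR : IsRootChoice k r ω R) (hR' : IsRootChoice k r { ω with m := m' } R')
    {T T' : Alg (qroot k r) n →ₐ[ℂ] Module.End ℂ (Space n k)} (hT : IsTomega k r ω R T)
    (hT' : IsTomega k r { ω with m := m' } R' T') : ¬ AreEquivalent T T' := by
  rintro ⟨f, hf⟩
  have hk0 : k ≠ 0 := hk.pos.ne'
  have : NeZero k := ⟨hk0⟩
  have hm' : ∀ i, ∃ d : ℤ, ω.m i = m' i + d := fun i => by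
    obtain ⟨d, -, hd⟩ := hm i
    exact ⟨d, by linear_combination hd⟩
  let ω' : Bool → Params n := fun b => if b then ω else { ω with m := m' }
  let R₂ : Bool → Roots n k := fun b => if b then R else R'
  let T₂ : Bool → Alg (qroot k r) n →ₐ[ℂ] Module.End ℂ (Space n k) := fun b => if b then T else T'
  have hω' : ∀ b, (ω' b).IsGeneric r := fun b => by
    cases b
    · exact hω.replace_top hm'
    · exact hω
  have hsame : ∀ b b', (ω' b).h = (ω' b').h := fun b b' => by cases b <;> cases b' <;> rfl
  have hR₂ : ∀ b, IsRootChoice k r (ω' b) (R₂ b) := fun b => by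
    cases b
    · exact hR'
    · exact hR
  have hT₂ : ∀ b, IsTomega k r (ω' b) (R₂ b) (T₂ b) := fun b => by
    cases b
    · exact hT'
    · exact hT
  have hsep : SeparatedRow r ω' n := separatedRow_top htop fun b i => by
    cases b
    · obtain ⟨d, hd⟩ := hm' i
      refine ⟨-d, ?_⟩
      change m' i = _
      rw [hd]
      push_cast
      ring
    · exact ⟨0, by simp [ω']⟩
  have hunlinked : ∀ ξ ξ' : Tableau n k, ¬ Linked T₂ (true, ξ) (false, ξ') := by
    intro ξ ξ' hl
    apply hne
    funext i
    have e : Y r ω n i ξ = Y r { ω with m := m' } n i ξ' :=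
      Linked.Y_eq hn hk hk1 hr hω' hsame hR₂ hT₂ n le_rfl hsep hl i i.2
    obtain ⟨d, hd1, hd⟩ := hm i
    -- The top row is not part of a tableau, so `ent` takes its default value 0 there and `Y`
    -- depends on the parameters alone.
    have e0 : ∀ ζ : Tableau n k, ent ζ n i = 0 := fun ζ => by simp [ent]
    rw [Y, Y, e0, e0] at e
    have e1 := mul_right_cancel₀ (zpow_ne_zero _ (qhalf_ne_zero k r))
      (mul_right_cancel₀ (qv_ne_zero k r 0) e)
    rw [base_top, base_top, ← div_eq_one_iff_eq (qpow_ne_zero _ _ _), ← qpow_sub, hd,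
      ← qroot_zpow, qroot_zpow_eq_one_iff hk0 hr] at e1
    -- Equal top coordinates give q^d = 1, so k divides d; the bound |d| < k is needed exactly here.
    have hd0 : d = 0 := Int.eq_zero_of_abs_lt_dvd e1 hd1
    rw [hd0, Int.cast_zero] at hd
    exact (sub_eq_zero.mp hd).symm
  -- The indicator of a class that contains a state of the first member and no state of the second.
  obtain ⟨p, ⟨a, ha⟩, hp1, hp0⟩ := exists_class_indicator (diagAlg T₂) (true, 0)
  have h1 : T a (ket 0) = ket 0 := by
    have : T a = _ := ha true
    rw [this, ket, wshift_single, hp1, one_smul, add_zero]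
  have h2 : T' a = 0 := by
    have : T' a = _ := ha false
    rw [this, ← wshift_zero 0]
    congr 1
    funext ξ
    refine hp0 _ ?_
    by_contra! hl
    exact hunlinked 0 ξ hl
  have h3 := hf a (ket 0)
  rw [h1, h2, LinearMap.zero_apply, LinearEquiv.map_eq_zero_iff] at h3
  exact one_ne_zero (Finsupp.single_eq_zero.mp h3)

end Nonequivalence

end UqSo

theorem theorem6 (n k : ℕ) (r : ℤ) (hn : 2 ≤ n) (hk : Odd k) (hk1 : 1 < k)
    (hr : IsCoprime r (k : ℤ)) :
    -- the operators define a representation on a space of dimension `k ^ N`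
    (∀ ω : UqSo.Params n, ω.IsGeneric r →
      Module.finrank ℂ (UqSo.Space n k) = k ^ UqSo.numPosRoots n ∧
      ∃ R : UqSo.Roots n k, UqSo.IsRootChoice k r ω R ∧
        ∃ T : UqSo.Alg (UqSo.qroot k r) n →ₐ[ℂ] Module.End ℂ (UqSo.Space n k),
          UqSo.IsTomega k r ω R T) ∧
    -- irreducibility
    (∀ ω : UqSo.Params n, ω.IsGeneric r →
      ∀ R : UqSo.Roots n k, UqSo.IsRootChoice k r ω R →
      ∀ T : UqSo.Alg (UqSo.qroot k r) n →ₐ[ℂ] Module.End ℂ (UqSo.Space n k),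
        UqSo.IsTomega k r ω R T → UqSo.IsIrreducibleRep T) ∧
    -- nonequivalence for different top rows
    (∀ ω : UqSo.Params n, ω.IsGeneric r → ω.IsTopGeneric r →
      ∀ m' : Fin (n / 2) → ℂ, m' ≠ ω.m →
      (∀ i, ∃ d : ℤ, |d| < (k : ℤ) ∧
        UqSo.lOf n i (ω.m i) - UqSo.lOf n i (m' i) = (d : ℂ)) →
      ∀ R R' : UqSo.Roots n k, UqSo.IsRootChoice k r ω R →
        UqSo.IsRootChoice k r { ω with m := m' } R' →
      ∀ T T' : UqSo.Alg (UqSo.qroot k r) n →ₐ[ℂ] Module.End ℂ (UqSo.Space n k),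
        UqSo.IsTomega k r ω R T → UqSo.IsTomega k r { ω with m := m' } R' T' →
        ¬ UqSo.AreEquivalent T T') := by
  have hk0 : k ≠ 0 := hk.pos.ne'
  have hh := UqSo.admissible_qhalf hk hk1 hr
  refine ⟨fun ω hω => ⟨UqSo.finrank_space hk0, UqSo.stdRoots r ω, UqSo.stdRoots_isRootChoice,
    UqSo.exists_representation hh hk0 hω⟩,
    fun ω hω R hR T hT => UqSo.isIrreducibleRep hn hk hk1 hr hω hR hT,
    fun ω hω htop m' hne hm R R' hR hR' T T' hT hT' =>
      UqSo.not_areEquivalent hn hk hk1 hr hω htop hne (fun i => ?_) hR hR' hT hT'⟩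
  obtain ⟨d, hd1, hd⟩ := hm i
  refine ⟨d, hd1, ?_⟩
  rw [← hd, UqSo.lOf, UqSo.lOf]
  ring
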